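/- **Setting.** Items $M=\{1,\dots,m\}$ are divided among players $N=\{1,2,3\}$; player $i$ gives item $j$ the value $a_{ij}>0$ (mutual absolute continuity), and $\sum_j a_{ij}=1$ for each $i$. An allocation is a matrix $X=(x_{ij})$ with $x_{ij}\ge 0$, $\sum_i x_{ij}=1$ for all $j$; it is integer if $x_{ij}\in\{0,1\}$. Put $a(X)=(\sum_j a_{ij}x_{ij})_{i\in N}\in\mathbb R^3$ and $IPS=\{a(X)\}$ (a convex polytope). The Pareto boundary is the set of $a(X)$ with $X$ (strongly) Pareto optimal. A Pareto face is a two-dimensional face of $IPS$ contained in the Pareto boundary. Let $\Delta$ be the simplex $\{p\in\mathbb R^3: p_i\ge 0,\ \sum_i p_i=1\}$ with vertices $e_1,e_2,e_3$ and relative interior $\mathring\Delta$, and let $N(x)=x/(x_1+x_2+x_3)$. Item $j$ is placed at $a^n_j=N(a_{1j},a_{2j},a_{3j})\in\mathring\Delta$; its supporting segments are the segments $[a^n_j,e_i]$, $i\in N$. Two items are s-independent if neither of them lies on a supporting segment of the other. For $\beta\in\mathring\Delta$ let $RD(\beta)=N(1/\beta_1,1/\beta_2,1/\beta_3)$. The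 disputing segments of $\beta$ are the three half-open segments which continue the lines from $e_h$ to $\beta$ beyond $\beta$ (with $\beta$ excluded) up to the side opposite to $e_h$, $h\in N$. Together with $\beta$ they cut $\Delta$ into three closed regions, one around each vertex. The Pareto allocation rule $PAR(\beta)$ allows item $j$ to be assigned to player $i$ iff $a^n_j$ lies in the closed region around $e_i$. The face corresponding to $\beta$ is the set $F_\beta$ of points of $IPS$ that maximize $x\mapsto\sum_i RD(\beta)_i\,x_i$ over $IPS$. An item is contested at $\beta$ if it is located at $\beta$ or lies on a disputing segment of $\beta$. Several items that lie on one and the same disputing segment of $\beta$, or that are all located at $\beta$, may be replaced by a single item, by adding up, for each player, their utilities; this is called merging. We say that $\beta\in\mathring\Delta$ is of one of the types (f1)–(f6) if, after some (possibly trivial) merging, the corresponding one of the following configurations occurs, no item other than the listed ones being contested at $\beta$: * (f1) an item $j$ is located at $\beta$; * (f2) $\beta$ lies on supporting segments of two s-independent items $j,k$; * (f3) $\beta$ lies on supporting segments of three pairwise s-independent items $j,k,\ell$; * (f4) an item $j$ is located at $\beta$, and a second item $k$ lies on a disputing segment of $\beta$; * (f5) $\beta$ lies on supporting segments of two s-independent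 items $j,k$, and a further item $h$ is located at $\beta$; * (f6) $\beta$ lies on supporting segments of three pairwise s-independent items $j,k,\ell$, and a further item $h$ is located at $\beta$. **Theorem.** 1. For each Pareto face $F$ there is exactly one $\beta\in\mathring\Delta$ with $F=F_\beta$, and this $\beta$ is of exactly one of the types (f1)–(f6). 2. Conversely, let $\beta\in\mathring\Delta$, and suppose that after some merging one of the configurations occurs. Then $F_\beta$ is a Pareto face, the merged problem has the same face corresponding to $\beta$, and $F=F_\beta$ is described as follows. Here allocations are the integer allocations of the merged problem that follow $PAR(\beta)$. In each case the items not listed are univocally assigned, and each vertex of $F$ is the value of exactly one allocation. * (f1) Item $j$ can be assigned to any of the three players. There are 3 allocations, and $F$ is a triangle. * (f2) Each of $j,k$ is disputed by exactly two players, and exactly one player takes part in both disputes. There are 4 allocations, and $F$ is a parallelogram. * (f3) Each of $j,k,\ell$ is disputed by exactly two players, and each player takes part in exactly two of the disputes. There are 8 allocations, and $F$ is a centrally symmetric hexagon, with opposite sides parallel and of equal length; the two allocations that do not give vertices have values in the relative interior of $F$. * (f4) Item $j$ can be assigned to any player, and $k$ is disputed by exactly two players. There are 6 allocations, and $F$ is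 a trapezoid (exactly one pair of parallel sides, of unequal length); the values of the two allocations that do not give vertices lie inside its larger base. * (f5) Items $j,k$ are as in (f2), and $h$ can be assigned to any player. There are 12 allocations, and $F$ is a pentagon with two disjoint pairs of parallel sides, the two sides of each pair being of unequal length. The longer side of each pair contains, apart from its endpoints, the values of two allocations, and the remaining three allocations have values in the relative interior of $F$. * (f6) Items $j,k,\ell$ are as in (f3), and $h$ can be assigned to any player. There are 24 allocations, and $F$ is a hexagon whose opposite sides are parallel and of unequal length. The longer side of each pair contains, apart from its endpoints, the values of two allocations, and the remaining 12 allocations have values in the relative interior of $F$. -/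

import Mathlib

open scoped BigOperators

noncomputable section

namespace FairDivision

/-- Three dimensional Euclidean space; coordinates are indexed by the three players. -/
abbrev E3 : Type := EuclideanSpace ℝ (Fin 3)

/-- A matrix of evaluations: `a i j` is the value of item `j` for player `i`. -/
abbrev Evaluation (m : ℕ) : Type := Fin 3 → Fin m → ℝ

/-! ### Allocations, partition range, Pareto boundary -/

/-- `X i j` is the share of item `j` given to player `i`. -/
def IsAllocation {m : ℕ} (X : Fin 3 → Fin m → ℝ) : Prop :=
  (∀ i j, 0 ≤ X i j) ∧ ∀ j, ∑ i, X i j = 1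

/-- The vector of the total values received by the players. -/
def value {m : ℕ} (a : Evaluation m) (X : Fin 3 → Fin m → ℝ) : E3 :=
  WithLp.toLp 2 fun i => ∑ j, a i j * X i j

/-- The allocation matrix of an integer allocation, given as a vector of players:
item `j` goes entirely to player `x j`. -/
def integerAllocation {m : ℕ} (x : Fin m → Fin 3) : Fin 3 → Fin m → ℝ :=
  fun i j => if x j = i then 1 else 0

/-- Strong Pareto optimality. -/
def IsParetoOptimal {m : ℕ} (a : Evaluation m) (X : Fin 3 → Fin m → ℝ) : Prop :=
  IsAllocation X ∧
    ¬ ∃ X' : Fin 3 → Fin m → ℝ, IsAllocation X' ∧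
      (∀ i, value a X i ≤ value a X' i) ∧ ∃ i, value a X i < value a X' i

/-- The partition range (individual pieces set). -/
def IPS {m : ℕ} (a : Evaluation m) : Set E3 :=
  {x | ∃ X, IsAllocation X ∧ x = value a X}

/-- The Pareto boundary of the partition range. -/
def paretoBoundary {m : ℕ} (a : Evaluation m) : Set E3 :=
  {x | ∃ X, IsParetoOptimal a X ∧ x = value a X}

/-- A face of the Pareto boundary: a two dimensional (exposed) face of the convex polytope `IPS a`
that is contained in the Pareto boundary. -/
def IsParetoFace {m : ℕ} (a : Evaluation m) (F : Set E3) : Prop :=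
  IsExposed ℝ (IPS a) F ∧ F ⊆ paretoBoundary a ∧ Module.finrank ℝ (vectorSpan ℝ F) = 2

/-! ### The Radon-Nikodym simplex -/

/-- The vertex of the simplex associated with player `i`. -/
def vertex (i : Fin 3) : E3 := EuclideanSpace.single i (1 : ℝ)

/-- The Radon-Nikodym simplex. -/
def RNS : Set E3 := {p | (∀ i, 0 ≤ p i) ∧ ∑ i, p i = 1}

/-- The relative interior of the simplex. -/
def openRNS : Set E3 := {p | (∀ i, 0 < p i) ∧ ∑ i, p i = 1}

/-- The normalizing operator. -/
def normalize (x : Fin 3 → ℝ) : E3 :=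
  WithLp.toLp 2 fun i => x i / ∑ k, x k

/-- The position of item `j` in the simplex. -/
def position {m : ℕ} (a : Evaluation m) (j : Fin m) : E3 := normalize fun i => a i j

/-- The map sending a point of the open simplex to the normalized vector of reciprocals. -/
def RD (β : E3) : E3 := normalize fun i => 1 / β i

/-- The disputing segment of `β` on the line through `β` and the vertex of player `h`: the part of
this line inside the simplex that goes from `β` (excluded) to the side opposite to the vertex.
It separates the regions of the two players other than `h`. -/
def disputingSegment (β : E3) (h : Fin 3) : Set E3 :=
  {p | p ∈ RNS ∧ ∃ t : ℝ, 0 < t ∧ p = β + t • (β - vertex h)}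

/-- The union of the three supporting segments of item `j`, which join the position of the item to
the three vertices. -/
def supportingSegments {m : ℕ} (a : Evaluation m) (j : Fin m) : Set E3 :=
  ⋃ i : Fin 3, segment ℝ (position a j) (vertex i)

/-- Support independence of two items. -/
def SIndependent {m : ℕ} (a : Evaluation m) (j k : Fin m) : Prop :=
  position a j ∉ supportingSegments a k ∧ position a k ∉ supportingSegments a j

/-- Item `j` lies on one of the disputing segments of `β`. -/
def OnDisputing {m : ℕ} (a : Evaluation m) (β : E3) (j : Fin m) : Prop :=
  ∃ h, position a j ∈ disputingSegment β h

/-- Item `j` lies on one of the disputing segments of `β`, or at `β` itself. -/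
def Contested {m : ℕ} (a : Evaluation m) (β : E3) (j : Fin m) : Prop :=
  position a j = β ∨ OnDisputing a β j

/-- The (closed) part of the simplex, cut out by the disputing segments of `β`, that contains the
vertex of player `i`. The line through `β` and a vertex `h` is `p i * β k = p k * β i`, where
`i` and `k` are the two other players. -/
def region (β : E3) (i : Fin 3) : Set E3 :=
  {p | p ∈ RNS ∧ ∀ k, p k * β i ≤ p i * β k}

/-- The players to whom the Pareto allocation rule after `β` can assign (a share of) item `j`. -/
def claimants {m : ℕ} (a : Evaluation m) (β : E3) (j : Fin m) : Set (Fin 3) :=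
  {i | position a j ∈ region β i}

/-- The integer allocations that follow the Pareto allocation rule after `β`. -/
def integerPAR {m : ℕ} (a : Evaluation m) (β : E3) : Set (Fin m → Fin 3) :=
  {x | ∀ j, x j ∈ claimants a β j}

/-- The face corresponding to `β`: the set of points of `IPS a` at which the hyperplane with
coefficients `RD β` supports `IPS a`. -/
def faceAt {m : ℕ} (a : Evaluation m) (β : E3) : Set E3 :=
  {x | x ∈ IPS a ∧ ∀ y ∈ IPS a, ∑ i, RD β i * y i ≤ ∑ i, RD β i * x i}

/-! ### Replacing several items by a single one -/

/-- The evaluations after all the items in each fibre of `f` have been replaced by a single item,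
obtained by summing up the utilities for each player. -/
def merge {m n : ℕ} (a : Evaluation m) (f : Fin m → Fin n) : Evaluation n :=
  fun i l => ∑ j with f j = l, a i j

/-- Distinct items are put together by `f` only if they lie on one and the same disputing segment of
`β`, or if all of them are located at `β`. -/
def IsMerging {m n : ℕ} (a : Evaluation m) (β : E3) (f : Fin m → Fin n) : Prop :=
  Function.Surjective f ∧
    ∀ j k, j ≠ k → f j = f k →
      (position a j = β ∧ position a k = β) ∨
      ∃ h, position a j ∈ disputingSegment β h ∧ position a k ∈ disputingSegment β h

/-! ### Polygons -/

/-- `F` is a convex polygon with the `n` vertices `v 0, …, v (n - 1)`, listed in cyclic order, so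
that its sides are the segments from `v i` to `v (i + 1)`. -/
structure IsPolygon (n : ℕ) [NeZero n] (F : Set E3) (v : Fin n → E3) : Prop where
  injective : Function.Injective v
  eq_hull : F = convexHull ℝ (Set.range v)
  extreme : Set.extremePoints ℝ F = Set.range v
  side : ∀ i, IsExtreme ℝ F (segment ℝ (v i) (v (i + 1)))
  planar : Module.finrank ℝ (vectorSpan ℝ F) = 2

/-- The sides starting at `v i` and at `v k` are parallel. -/
def SidesParallel {n : ℕ} [NeZero n] (v : Fin n → E3) (i k : Fin n) : Prop :=
  (affineSpan ℝ {v i, v (i + 1)}).Parallel (affineSpan ℝ {v k, v (k + 1)})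

/-- The length of the side starting at `v i`. -/
def sideLength {n : ℕ} [NeZero n] (v : Fin n → E3) (i : Fin n) : ℝ := dist (v i) (v (i + 1))

/-- Every one of the listed points is the value of exactly one integer allocation following the
Pareto allocation rule after `β`. -/
def VerticesFromPAR {m n : ℕ} (a : Evaluation m) (β : E3) (v : Fin n → E3) : Prop :=
  ∀ i, ∃! x : Fin m → Fin 3, x ∈ integerPAR a β ∧ value a (integerAllocation x) = v i

/-- The integer allocations following the Pareto allocation rule after `β` whose values lie on the
side starting at `v i`, endpoints excluded. -/
def extraOnSide {m n : ℕ} [NeZero n] (a : Evaluation m) (β : E3) (v : Fin n → E3) (i : Fin n) :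
    Set (Fin m → Fin 3) :=
  {x | x ∈ integerPAR a β ∧ value a (integerAllocation x) ∈ openSegment ℝ (v i) (v (i + 1))}

/-- The integer allocations following the Pareto allocation rule after `β` whose values lie in the
(relative) interior of `F`. -/
def insideFace {m : ℕ} (a : Evaluation m) (β : E3) (F : Set E3) : Set (Fin m → Fin 3) :=
  {x | x ∈ integerPAR a β ∧ value a (integerAllocation x) ∈ intrinsicInterior ℝ F}

/-! ### The six configurations of items -/

/-- The six types. -/
inductive FaceType
  | f1 | f2 | f3 | f4 | f5 | f6

/-- A type, together with the items that are involved. -/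
inductive Configuration (m : ℕ)
  | f1 (j : Fin m)
  | f2 (j k : Fin m)
  | f3 (j k l : Fin m)
  | f4 (j k : Fin m)
  | f5 (j k h : Fin m)
  | f6 (j k l h : Fin m)

/-- Forget the items. -/
def Configuration.type {m : ℕ} : Configuration m → FaceType
  | .f1 _ => .f1
  | .f2 _ _ => .f2
  | .f3 _ _ _ => .f3
  | .f4 _ _ => .f4
  | .f5 _ _ _ => .f5
  | .f6 _ _ _ _ => .f6

/-- How the items sit relative to `β` and its disputing segments. -/
def Configuration.Occurs {m : ℕ} (a : Evaluation m) (β : E3) : Configuration m → Prop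
  | .f1 j =>
      position a j = β ∧ ∀ q, q ≠ j → ¬ Contested a β q
  | .f2 j k =>
      SIndependent a j k ∧ β ∈ supportingSegments a j ∧ β ∈ supportingSegments a k ∧
      ∀ q, q ≠ j → q ≠ k → ¬ Contested a β q
  | .f3 j k l =>
      SIndependent a j k ∧ SIndependent a j l ∧ SIndependent a k l ∧
      β ∈ supportingSegments a j ∧ β ∈ supportingSegments a k ∧ β ∈ supportingSegments a l ∧
      ∀ q, q ≠ j → q ≠ k → q ≠ l → ¬ Contested a β q
  | .f4 j k =>
      position a j = β ∧ OnDisputing a β k ∧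
      ∀ q, q ≠ j → q ≠ k → ¬ Contested a β q
  | .f5 j k h =>
      SIndependent a j k ∧ β ∈ supportingSegments a j ∧ β ∈ supportingSegments a k ∧
      position a h = β ∧
      ∀ q, q ≠ j → q ≠ k → q ≠ h → ¬ Contested a β q
  | .f6 j k l h =>
      SIndependent a j k ∧ SIndependent a j l ∧ SIndependent a k l ∧
      β ∈ supportingSegments a j ∧ β ∈ supportingSegments a k ∧ β ∈ supportingSegments a l ∧
      position a h = β ∧
      ∀ q, q ≠ j → q ≠ k → q ≠ l → q ≠ h → ¬ Contested a β q

/-- `β` is of type `t` for the evaluations `a`: after replacing, where necessary, several items on a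
single disputing segment (or at `β`) by a single one, a configuration of this type occurs. -/
def HasType {m : ℕ} (a : Evaluation m) (β : E3) (t : FaceType) : Prop :=
  ∃ (n : ℕ) (f : Fin m → Fin n) (c : Configuration n),
    IsMerging a β f ∧ c.type = t ∧ c.Occurs (merge a f) β

/-- Exactly two players can get a share of the item. -/
def DisputedByTwo {m : ℕ} (a : Evaluation m) (β : E3) (j : Fin m) : Prop :=
  (claimants a β j).ncard = 2

/-- All the items outside `S` are univocally assigned. -/
def OthersAssigned {m : ℕ} (a : Evaluation m) (β : E3) (S : Set (Fin m)) : Prop :=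
  ∀ q, q ∉ S → ∃! i, i ∈ claimants a β q

/-- Each player takes part in exactly two of the disputes over the three items. -/
def EachInTwoDisputes {m : ℕ} (a : Evaluation m) (β : E3) (j k l : Fin m) : Prop :=
  ∀ i : Fin 3, {q : Fin m | (q = j ∨ q = k ∨ q = l) ∧ i ∈ claimants a β q}.ncard = 2

/-- The description of the face `F` for each configuration: who can get the contested items, the
shape of the face, and the place on the face of the integer allocations. -/
def Configuration.Describes {m : ℕ} (a : Evaluation m) (β : E3) (F : Set E3) :
    Configuration m → Prop
  -- a triangle
  | .f1 j =>
      claimants a β j = Set.univ ∧ OthersAssigned a β {j} ∧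
      (integerPAR a β).ncard = 3 ∧
      ∃ v : Fin 3 → E3, IsPolygon 3 F v ∧ VerticesFromPAR a β v
  -- a parallelogram
  | .f2 j k =>
      DisputedByTwo a β j ∧ DisputedByTwo a β k ∧
      (claimants a β j ∩ claimants a β k).ncard = 1 ∧ OthersAssigned a β {j, k} ∧
      (integerPAR a β).ncard = 4 ∧
      ∃ v : Fin 4 → E3, IsPolygon 4 F v ∧ VerticesFromPAR a β v ∧
        SidesParallel v 0 2 ∧ SidesParallel v 1 3 ∧
        sideLength v 0 = sideLength v 2 ∧ sideLength v 1 = sideLength v 3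
  -- a centrally symmetric hexagon
  | .f3 j k l =>
      DisputedByTwo a β j ∧ DisputedByTwo a β k ∧ DisputedByTwo a β l ∧
      EachInTwoDisputes a β j k l ∧ OthersAssigned a β {j, k, l} ∧
      (integerPAR a β).ncard = 8 ∧
      ∃ v : Fin 6 → E3, IsPolygon 6 F v ∧ VerticesFromPAR a β v ∧
        (∃ c : E3, ∀ i, midpoint ℝ (v i) (v (i + 3)) = c) ∧
        (∀ i, SidesParallel v i (i + 3) ∧ sideLength v i = sideLength v (i + 3)) ∧
        (insideFace a β F).ncard = 2
  -- a trapezoid; the side starting at `v 0` is its larger base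
  | .f4 j k =>
      claimants a β j = Set.univ ∧ DisputedByTwo a β k ∧ OthersAssigned a β {j, k} ∧
      (integerPAR a β).ncard = 6 ∧
      ∃ v : Fin 4 → E3, IsPolygon 4 F v ∧ VerticesFromPAR a β v ∧
        SidesParallel v 0 2 ∧ ¬ SidesParallel v 1 3 ∧ sideLength v 2 < sideLength v 0 ∧
        (extraOnSide a β v 0).ncard = 2
  -- a pentagon; the sides starting at `v 0` and `v 2`, and those starting at `v 1` and `v 4`, are
  -- the two pairs of parallel sides
  | .f5 j k h =>
      DisputedByTwo a β j ∧ DisputedByTwo a β k ∧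
      (claimants a β j ∩ claimants a β k).ncard = 1 ∧ claimants a β h = Set.univ ∧
      OthersAssigned a β {j, k, h} ∧
      (integerPAR a β).ncard = 12 ∧
      ∃ v : Fin 5 → E3, IsPolygon 5 F v ∧ VerticesFromPAR a β v ∧
        SidesParallel v 0 2 ∧ sideLength v 2 < sideLength v 0 ∧
        SidesParallel v 1 4 ∧ sideLength v 4 < sideLength v 1 ∧
        (extraOnSide a β v 0).ncard = 2 ∧ (extraOnSide a β v 1).ncard = 2 ∧
        (insideFace a β F).ncard = 3
  -- a hexagon with parallel opposite sides of unequal length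
  | .f6 j k l h =>
      DisputedByTwo a β j ∧ DisputedByTwo a β k ∧ DisputedByTwo a β l ∧
      EachInTwoDisputes a β j k l ∧ claimants a β h = Set.univ ∧
      OthersAssigned a β {j, k, l, h} ∧
      (integerPAR a β).ncard = 24 ∧
      ∃ v : Fin 6 → E3, IsPolygon 6 F v ∧ VerticesFromPAR a β v ∧
        (∀ i, SidesParallel v i (i + 3) ∧ sideLength v i ≠ sideLength v (i + 3) ∧
          (sideLength v (i + 3) < sideLength v i → (extraOnSide a β v i).ncard = 2)) ∧
        (insideFace a β F).ncard = 12

end FairDivision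

end

open scoped BigOperators

noncomputable section

namespace FairDivision

/-! ### Positions in the simplex expressed through sets of claimants -/

section

variable {m n : ℕ}

/-! For `β` in the open simplex, let the weight of item `j` be `W j = max_i a i j / β i`. The
claimants of `j` are the players attaining this maximum (`exists_weight`), so a claimant `i` values
the item at exactly `β i * W j`. The geometry thereby becomes combinatorial: all three players claim
an item iff it sits at `β`, all but `h` claim it iff it lies on the disputing segment opposite to
`h`, and otherwise there is a single claimant. Items whose supporting segments pass through `β` are
s-independent iff they lie on two different disputing segments. Merging items with the same
claimants adds their weights and changes neither the claimants nor the face (`claimants_merge`,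
`faceAt_merge`).

The points of `faceAt a β` are the values of the allocations that give items only to claimants. To
see that every Pareto face `F` is of this form (`exists_faceAt_of_isParetoFace`), take an allocation
with value in `F` that gives every item to all the players allowed on `F`. It is Pareto optimal, so
no cyclic exchange improves it, and a potential argument for matrices without improving cycles
yields positive weights `w` whose weighted sum it maximizes. With `β` the normalized reciprocals of
`w`, `F ⊆ faceAt a β`; both sets span the same plane of directions, on which the functional exposing
`F` vanishes, so they are equal. This plane is the kernel of the functional with coefficients `RD β`
and therefore determines `β`.

The type is determined by whether some item sits at `β` and by how many disputing segments carry
items (`HasType.signature`). After merging everything that can be merged, each of these data is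
carried by at most one item; two-dimensionality requires every player to have a contested item, and
this excludes the combinations outside the list.

For the shape, use as coordinates the weight `y l` that each player gets from the contested items,
in units of `β`. Since every contested item has at least two claimants, the face becomes the
possibly degenerate hexagon `0 ≤ y l ≤ ub l`, `∑ y = S` (`IsItemChart.faceAt_eq`). Its vertices come
from greedy assignments, which serve one player as much as possible and then a second one. Which
integer assignments are vertices, lie on a side or lie inside depends only on who gets which item
and not on the sizes of the weights. What remains for each type is a finite check, settled by
`decide`, and a comparison of side lengths that are sums of weights. -/

theorem exists_third : ∀ i k : Fin 3, ∃ l, l ≠ i ∧ l ≠ k := by decide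

theorem finset_fin_three_cases : ∀ t : Finset (Fin 3), t.Nonempty →
    t = Finset.univ ∨ (∃ h, t = {h}ᶜ) ∨ ∃ i, i ∈ t ∧ ∀ k, k ∈ t → k = i := by decide

theorem sum_evaluation_pos {a : Evaluation m} (ha : ∀ i j, 0 < a i j) (j : Fin m) :
    0 < ∑ i, a i j :=
  Finset.sum_pos (fun i _ => ha i j) Finset.univ_nonempty

theorem position_apply (a : Evaluation m) (j : Fin m) (i : Fin 3) :
    position a j i = a i j / ∑ k, a k j := rfl

theorem position_mem_openRNS {a : Evaluation m} (ha : ∀ i j, 0 < a i j) (j : Fin m) :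
    position a j ∈ openRNS := by
  have hs := sum_evaluation_pos ha j
  refine ⟨fun i => div_pos (ha i j) hs, ?_⟩
  simp only [position_apply, ← Finset.sum_div]
  exact div_self hs.ne'

theorem openRNS_subset_RNS : openRNS ⊆ RNS := fun _ h => ⟨fun i => (h.1 i).le, h.2⟩

theorem openRNS_sum {β : E3} (hβ : β ∈ openRNS) : β 0 + β 1 + β 2 = 1 := by
  simpa [Fin.sum_univ_three] using hβ.2

theorem mem_claimants_iff {a : Evaluation m} (ha : ∀ i j, 0 < a i j) (β : E3) (j : Fin m)
    (i : Fin 3) : i ∈ claimants a β j ↔ ∀ k, a k j * β i ≤ a i j * β k := by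
  have hs := sum_evaluation_pos ha j
  have hp := openRNS_subset_RNS (position_mem_openRNS ha j)
  have key : ∀ k, (position a j k * β i ≤ position a j i * β k ↔
      a k j * β i ≤ a i j * β k) := fun k => by
    rw [position_apply, position_apply, div_mul_eq_mul_div, div_mul_eq_mul_div,
      div_le_div_iff_of_pos_right hs]
  constructor
  · intro h k
    exact (key k).1 (h.2 k)
  · intro h
    exact ⟨hp, fun k => (key k).2 (h k)⟩

/-- The common value, for all claimants, of the item in units of `β`. -/
theorem exists_weight {a : Evaluation m} (ha : ∀ i j, 0 < a i j) {β : E3} (hβ : β ∈ openRNS)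
    (j : Fin m) : ∃ W : ℝ, 0 < W ∧ (∀ i, a i j ≤ β i * W) ∧
      ∀ i, i ∈ claimants a β j ↔ a i j = β i * W := by
  obtain ⟨i₀, hi₀⟩ := Finite.exists_max fun i => a i j / β i
  have hle : ∀ i, a i j ≤ β i * (a i₀ j / β i₀) := fun i => by
    have := (div_le_iff₀ (hβ.1 i)).1 (hi₀ i)
    linarith
  refine ⟨a i₀ j / β i₀, div_pos (ha _ _) (hβ.1 _), hle, fun i => ?_⟩
  rw [mem_claimants_iff ha]
  constructor
  · intro h
    refine le_antisymm (hle i) ?_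
    have := h i₀
    rw [← mul_div_assoc, div_le_iff₀ (hβ.1 _)]
    linarith
  · intro h k
    have h1 := mul_le_mul_of_nonneg_right (hle k) (hβ.1 i).le
    rw [h]
    linarith

theorem claimants_nonempty {a : Evaluation m} (ha : ∀ i j, 0 < a i j) {β : E3}
    (hβ : β ∈ openRNS) (j : Fin m) : (claimants a β j).Nonempty := by
  obtain ⟨i₀, hi₀⟩ := Finite.exists_max fun i => a i j / β i
  refine ⟨i₀, (mem_claimants_iff ha β j i₀).2 fun k => ?_⟩
  have := hi₀ k
  rwa [div_le_div_iff₀ (hβ.1 _) (hβ.1 _)] at this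

theorem mem_claimants_iff_position {a : Evaluation m} (ha : ∀ i j, 0 < a i j) (β : E3)
    (j : Fin m) (i : Fin 3) :
    i ∈ claimants a β j ↔ ∀ k, position a j k * β i ≤ position a j i * β k :=
  ⟨fun h => h.2, fun h => ⟨openRNS_subset_RNS (position_mem_openRNS ha j), h⟩⟩

/-- If all players claim the item, its position and `β` are proportional; both have coordinate sum
one. -/
theorem claimants_eq_univ_iff {a : Evaluation m} (ha : ∀ i j, 0 < a i j) {β : E3}
    (hβ : β ∈ openRNS) (j : Fin m) : claimants a β j = Set.univ ↔ position a j = β := by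
  have hp := position_mem_openRNS ha j
  constructor
  · intro h
    have key : ∀ i k, position a j k * β i = position a j i * β k := fun i k =>
      le_antisymm ((mem_claimants_iff_position ha β j i).1 (h ▸ Set.mem_univ i) k)
        ((mem_claimants_iff_position ha β j k).1 (h ▸ Set.mem_univ k) i)
    ext i
    have := Finset.sum_congr rfl fun k (_ : k ∈ Finset.univ) => key i k
    rw [← Finset.sum_mul, ← Finset.mul_sum, hp.2, hβ.2] at this
    linarith
  · intro h
    ext i
    simp only [Set.mem_univ, iff_true]
    rw [mem_claimants_iff_position ha, h]
    intro k
    rw [mul_comm]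

theorem vertex_apply (h i : Fin 3) : vertex h i = if i = h then 1 else 0 := by
  simp [vertex, PiLp.single_apply]

theorem mem_disputing_apply {β p : E3} {h : Fin 3} {t : ℝ} (hp : p = β + t • (β - vertex h))
    (i : Fin 3) : p i = (1 + t) * β i - (if i = h then t else 0) := by
  rw [hp]
  simp [vertex_apply]
  split_ifs <;> ring

/-- On the segment opposite to `h` a point has the form `(1 + t) β - t e_h` with `t > 0`: its ratios
to `β` are `1 + t` for the other two players and strictly smaller for `h`. -/
theorem claimants_eq_compl_iff {a : Evaluation m} (ha : ∀ i j, 0 < a i j) {β : E3}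
    (hβ : β ∈ openRNS) (j : Fin m) (h : Fin 3) :
    claimants a β j = {h}ᶜ ↔ position a j ∈ disputingSegment β h := by
  have hp := position_mem_openRNS ha j
  obtain ⟨hpos, hsum⟩ := hp
  constructor
  · intro hc
    refine ⟨openRNS_subset_RNS ⟨hpos, hsum⟩, ?_⟩
    have key : ∀ i k, i ≠ h → k ≠ h → position a j k * β i = position a j i * β k :=
      fun i k hi hk =>
      le_antisymm ((mem_claimants_iff_position ha β j i).1 (hc ▸ hi) k)
        ((mem_claimants_iff_position ha β j k).1 (hc ▸ hk) i)
    have hlt : ∃ k, position a j h * β k < position a j k * β h := by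
      by_contra! hcon
      have : h ∈ claimants a β j := (mem_claimants_iff_position ha β j h).2 hcon
      rw [hc] at this
      exact this rfl
    obtain ⟨k, hk⟩ := hlt
    have hkh : k ≠ h := by rintro rfl; exact lt_irrefl _ hk
    have hbk := hβ.1 k
    have hv : ∀ i, i ≠ h → position a j i = position a j k / β k * β i := fun i hi => by
      field_simp
      linarith [key i k hi hkh]
    have hlt : position a j h < position a j k / β k * β h := by
      rw [div_mul_eq_mul_div, lt_div_iff₀ hbk]
      exact hk
    -- The common ratio of the two claimants is `1 + t`; the coordinate of `h` then follows from the
    -- coordinate sum.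
    set r := position a j k / β k with hr
    have hsb := openRNS_sum hβ
    rw [Fin.sum_univ_three] at hsum
    have hform : ∀ i, position a j i = r * β i - (if i = h then r - 1 else 0) := by
      intro i
      split_ifs with hi
      · subst hi
        fin_cases i <;> simp only [Fin.zero_eta, Fin.mk_one, Fin.reduceFinMk] at *
        · have := hv 1 (by decide); have := hv 2 (by decide); linear_combination hsum - this - hv 1 (by decide) - r * hsb
        · have := hv 0 (by decide); have := hv 2 (by decide); linear_combination hsum - this - hv 0 (by decide) - r * hsb
        · have := hv 0 (by decide); have := hv 1 (by decide); linear_combination hsum - this - hv 0 (by decide) - r * hsb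
      · rw [hv i hi]; ring
    refine ⟨r - 1, ?_, ?_⟩
    · have := hform h
      rw [if_pos rfl] at this
      linarith
    · ext i
      rw [mem_disputing_apply rfl, hform i]
      ring_nf
  · rintro ⟨-, t, ht, hp⟩
    have hf := mem_disputing_apply hp
    ext i
    rw [mem_claimants_iff_position ha]
    simp only [Set.mem_compl_iff, Set.mem_singleton_iff]
    constructor
    · rintro h' rfl
      obtain ⟨k, hk⟩ : ∃ k : Fin 3, k ≠ i := exists_ne i
      have := h' k
      rw [hf, hf, if_neg hk, if_pos rfl] at this
      nlinarith [mul_pos ht (hβ.1 k)]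
    · intro hi k
      rw [hf i, if_neg hi, hf k]
      split_ifs
      · nlinarith [mul_pos ht (hβ.1 i)]
      · linarith

theorem onDisputing_iff {a : Evaluation m} (ha : ∀ i j, 0 < a i j) {β : E3}
    (hβ : β ∈ openRNS) (j : Fin m) : OnDisputing a β j ↔ ∃ h, claimants a β j = {h}ᶜ :=
  exists_congr fun h => (claimants_eq_compl_iff ha hβ j h).symm

theorem set_fin_three_cases (s : Set (Fin 3)) (hs : s.Nonempty) :
    s = Set.univ ∨ (∃ h, s = {h}ᶜ) ∨ ∃! i, i ∈ s := by
  classical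
  have := finset_fin_three_cases s.toFinset (by simpa using hs)
  simpa [← Finset.coe_inj, ExistsUnique] using this

theorem contested_iff {a : Evaluation m} (ha : ∀ i j, 0 < a i j) {β : E3}
    (hβ : β ∈ openRNS) (j : Fin m) :
    Contested a β j ↔ claimants a β j = Set.univ ∨ ∃ h, claimants a β j = {h}ᶜ := by
  rw [Contested, onDisputing_iff ha hβ, claimants_eq_univ_iff ha hβ]

theorem not_contested_iff {a : Evaluation m} (ha : ∀ i j, 0 < a i j) {β : E3}
    (hβ : β ∈ openRNS) (j : Fin m) :
    ¬ Contested a β j ↔ ∃! i, i ∈ claimants a β j := by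
  rw [contested_iff ha hβ]
  constructor
  · intro h
    rcases set_fin_three_cases _ (claimants_nonempty ha hβ j) with h' | h' | h'
    · exact absurd (Or.inl h') h
    · exact absurd (Or.inr h') h
    · exact h'
  · rintro ⟨i, hi, hu⟩ (h | ⟨k, h⟩)
    · obtain ⟨k, hk⟩ : ∃ k : Fin 3, k ≠ i := exists_ne i
      exact hk (hu k (h ▸ Set.mem_univ k))
    · obtain ⟨l, hl⟩ : ∃ l : Fin 3, l ≠ k ∧ l ≠ i := exists_third k i
      exact hl.2 (hu l (h ▸ hl.1))

/-- Solving `β = s p + t e_i` for `p` gives `p = β + (t / s)(β - e_i)`; here `s ≠ 0` because `β` is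
interior. -/
theorem mem_supportingSegments_iff {a : Evaluation m} (ha : ∀ i j, 0 < a i j) {β : E3}
    (hβ : β ∈ openRNS) (j : Fin m) :
    β ∈ supportingSegments a j ↔ position a j = β ∨ OnDisputing a β j := by
  have hp := position_mem_openRNS ha j
  simp only [supportingSegments, Set.mem_iUnion]
  constructor
  · rintro ⟨i, s, t, hs, ht, hst, h⟩
    have hs' : s ≠ 0 := by
      rintro rfl
      obtain ⟨k, hk⟩ : ∃ k : Fin 3, k ≠ i := exists_ne i
      have := hβ.1 k
      rw [← h] at this
      simp [vertex_apply, hk] at this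
    rcases ht.eq_or_lt with rfl | ht
    · left
      have : s = 1 := by linarith
      simpa [this] using h
    · right
      have hspos := lt_of_le_of_ne hs hs'.symm
      refine ⟨i, openRNS_subset_RNS hp, t / s, div_pos ht hspos, ?_⟩
      rw [← h]
      have : s = 1 - t := by linarith
      ext k
      simp
      field_simp
      subst this
      ring
  · rintro (h | ⟨i, -, t, ht, h⟩)
    · exact ⟨0, h ▸ left_mem_segment _ _ _⟩
    · refine ⟨i, 1 / (1 + t), t / (1 + t), by positivity, by positivity, by field_simp, ?_⟩
      rw [h]
      ext k
      simp
      field_simp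
      ring

/-- Of two items on the same disputing segment, the one nearer to `β` lies on a supporting segment
of the other; hence s-independence forces different segments. -/
theorem disputing_mem_segment {β p q : E3} {h : Fin 3} {t s : ℝ} (ht : 0 < t) (hts : t ≤ s)
    (hp : p = β + t • (β - vertex h)) (hq : q = β + s • (β - vertex h)) :
    p ∈ segment ℝ q (vertex h) := by
  refine ⟨(1 + t) / (1 + s), (s - t) / (1 + s), div_nonneg (by linarith) (by linarith),
    div_nonneg (by linarith) (by linarith), ?_, ?_⟩
  · have : 1 + s ≠ 0 := by linarith
    field_simp
    ring
  · have : 1 + s ≠ 0 := by linarith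
    rw [hp, hq]
    ext k
    simp
    field_simp
    ring

/-- A point in which the share of `h` in units of `β` is minimal can not lie on a supporting
segment of an item in which it is maximal. -/
theorem position_notMem_supportingSegments {a : Evaluation m} (ha : ∀ i j, 0 < a i j) {β : E3}
    (hβ : β ∈ openRNS) {j k : Fin m} {h h' : Fin 3} (hne : h ≠ h')
    (hj : position a j ∈ disputingSegment β h) (hk : position a k ∈ disputingSegment β h') :
    position a j ∉ supportingSegments a k := by
  obtain ⟨-, t, ht, hpj⟩ := hj
  obtain ⟨-, s, hs, hpk⟩ := hk
  have hfj := mem_disputing_apply hpj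
  have hfk := mem_disputing_apply hpk
  have hppos := position_mem_openRNS ha j
  simp only [supportingSegments, Set.mem_iUnion, not_exists]
  rintro i ⟨x, y, hx, hy, hxy, heq⟩
  have hev : ∀ l, x * position a k l + y * (if l = i then 1 else 0) = position a j l := by
    intro l
    rw [← heq]
    simp [vertex_apply]
  have hx0 : 0 < x := by
    rcases hx.eq_or_lt with rfl | h0
    · obtain ⟨l, hl⟩ : ∃ l : Fin 3, l ≠ i := exists_ne i
      have := hev l
      rw [if_neg hl] at this
      have := hppos.1 l
      linarith
    · exact h0
  obtain ⟨h'', h1, h2⟩ : ∃ l : Fin 3, l ≠ h ∧ l ≠ h' := exists_third h h'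
  have e0 := hev h
  have e1 := hev h'
  have e2 := hev h''
  rw [hfj, hfk] at e0 e1 e2
  have hb0 := hβ.1 h
  have hb1 := hβ.1 h'
  have hb2 := hβ.1 h''
  rw [if_neg hne, if_pos rfl] at e0
  rw [if_pos rfl, if_neg hne.symm] at e1
  rw [if_neg h2, if_neg h1] at e2
  -- If `i = h'`, the third player's coordinate gives `x (1 + s) = 1 + t`, and the coordinate of `h`
  -- then forces `t = 0`.
  by_cases hi : i = h'
  · subst hi
    rw [if_neg hne] at e0
    rw [if_neg h2] at e2
    have : x * (1 + s) = 1 + t := by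
      apply mul_right_cancel₀ hb2.ne'
      linarith
    have e3 : x * ((1 + s) * β h - 0) = (1 + t) * β h := by rw [← this]; ring
    linarith
  -- Otherwise the coordinate of `h'` gives `x (1 + s) > 1 + t`, while that of `h` gives `x (1 + s)
  -- < 1 + t`.
  · rw [if_neg (Ne.symm hi)] at e1
    have hy' : 0 ≤ y * (if h = i then 1 else 0 : ℝ) := by split_ifs <;> simp [hy]
    have hxs : 0 < x * s := mul_pos hx0 hs
    have h3 : x * (1 + s) * β h ≤ (1 + t) * β h - t := by nlinarith
    have h4 : x * (1 + s) * β h' = (1 + t) * β h' + x * s := by linarith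
    have h5 : x * (1 + s) < 1 + t := lt_of_mul_lt_mul_right (by linarith) hb0.le
    nlinarith

theorem sIndependent_of_claimants {a : Evaluation m} (ha : ∀ i j, 0 < a i j) {β : E3}
    (hβ : β ∈ openRNS) {j k : Fin m} {h h' : Fin 3} (hne : h ≠ h')
    (hj : claimants a β j = {h}ᶜ) (hk : claimants a β k = {h'}ᶜ) : SIndependent a j k := by
  rw [claimants_eq_compl_iff ha hβ] at hj hk
  exact ⟨position_notMem_supportingSegments ha hβ hne hj hk,
    position_notMem_supportingSegments ha hβ hne.symm hk hj⟩

theorem claimants_of_sIndependent {a : Evaluation m} (ha : ∀ i j, 0 < a i j) {β : E3}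
    (hβ : β ∈ openRNS) {j k : Fin m} (hi : SIndependent a j k)
    (hj : β ∈ supportingSegments a j) (hk : β ∈ supportingSegments a k) :
    ∃ h h', h ≠ h' ∧ claimants a β j = {h}ᶜ ∧ claimants a β k = {h'}ᶜ := by
  have hj' := (mem_supportingSegments_iff ha hβ j).1 hj
  have hk' := (mem_supportingSegments_iff ha hβ k).1 hk
  rcases hj' with rfl | ⟨h, hjd⟩
  · exact absurd hk hi.1
  rcases hk' with rfl | ⟨h', hkd⟩
  · exact absurd hj hi.2
  refine ⟨h, h', ?_, (claimants_eq_compl_iff ha hβ _ _).2 hjd,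
    (claimants_eq_compl_iff ha hβ _ _).2 hkd⟩
  rintro rfl
  obtain ⟨-, t, ht, hpj⟩ := hjd
  obtain ⟨-, s, hs, hpk⟩ := hkd
  rcases le_total t s with hts | hts
  · exact hi.1 (Set.mem_iUnion.2 ⟨h, disputing_mem_segment ht hts hpj hpk⟩)
  · exact hi.2 (Set.mem_iUnion.2 ⟨h, disputing_mem_segment hs hts hpk hpj⟩)

theorem mem_supportingSegments_of_claimants {a : Evaluation m} (ha : ∀ i j, 0 < a i j) {β : E3}
    (hβ : β ∈ openRNS) {j : Fin m} {h : Fin 3} (hj : claimants a β j = {h}ᶜ) :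
    β ∈ supportingSegments a j :=
  (mem_supportingSegments_iff ha hβ j).2 (Or.inr ⟨h, (claimants_eq_compl_iff ha hβ j h).1 hj⟩)

end

section

variable {m n : ℕ}

/-! ### Linear functionals on the partition range -/

/-- `x ↦ ∑ i, c i * x i`. -/
def weighted (c : Fin 3 → ℝ) : E3 →ₗ[ℝ] ℝ :=
  ∑ i, c i • (EuclideanSpace.proj i : E3 →L[ℝ] ℝ).toLinearMap

theorem weighted_apply (c : Fin 3 → ℝ) (x : E3) : weighted c x = ∑ i, c i * x i := by
  simp [weighted]

theorem value_apply (a : Evaluation m) (X : Fin 3 → Fin m → ℝ) (i : Fin 3) :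
    value a X i = ∑ j, a i j * X i j := rfl

theorem weighted_value (c : Fin 3 → ℝ) (a : Evaluation m) (X : Fin 3 → Fin m → ℝ) :
    weighted c (value a X) = ∑ j, ∑ i, c i * a i j * X i j := by
  rw [weighted_apply, Finset.sum_comm]
  simp only [value_apply, Finset.mul_sum, mul_assoc]

theorem isAllocation_integerAllocation (x : Fin m → Fin 3) :
    IsAllocation (integerAllocation x) := by
  refine ⟨fun i j => ?_, fun j => ?_⟩
  · unfold integerAllocation
    split_ifs <;> norm_num
  · simp [integerAllocation]

theorem IsAllocation.le_one {X : Fin 3 → Fin m → ℝ} (hX : IsAllocation X) (i j) : X i j ≤ 1 := by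
  rw [← hX.2 j]
  exact Finset.single_le_sum (fun k _ => hX.1 k j) (Finset.mem_univ i)

theorem exists_argmax (c : Fin 3 → ℝ) (a : Evaluation m) :
    ∃ g : Fin m → Fin 3, ∀ i j, c i * a i j ≤ c (g j) * a (g j) j := by
  choose g hg using fun j => Finite.exists_max fun i => c i * a i j
  exact ⟨g, fun i j => hg j i⟩

/-- An allocation maximizes a weighted sum of values iff every item goes to players for whom the
weighted value of the item is largest. -/
theorem isMax_weighted_iff (c : Fin 3 → ℝ) (a : Evaluation m) {X : Fin 3 → Fin m → ℝ}
    (hX : IsAllocation X) :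
    (∀ y ∈ IPS a, weighted c y ≤ weighted c (value a X)) ↔
      ∀ i j, 0 < X i j → ∀ k, c k * a k j ≤ c i * a i j := by
  constructor
  · intro h i j hij k
    -- The integer allocation `g` attains the item-by-item upper bound. A maximal `X` must attain it
    -- in every item, so a positive share can only go to a maximizing player.
    obtain ⟨g, hg⟩ := exists_argmax c a
    have h1 := h _ ⟨_, isAllocation_integerAllocation g, rfl⟩
    have hint : weighted c (value a (integerAllocation g)) = ∑ j, c (g j) * a (g j) j := by
      rw [weighted_value]
      simp [integerAllocation]
    rw [hint, weighted_value] at h1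
    have h2 : ∀ j, ∑ i, c i * a i j * X i j ≤ c (g j) * a (g j) j := fun j => by
      calc ∑ i, c i * a i j * X i j ≤ ∑ i, c (g j) * a (g j) j * X i j :=
            Finset.sum_le_sum fun i _ => mul_le_mul_of_nonneg_right (hg i j) (hX.1 i j)
        _ = _ := by rw [← Finset.mul_sum, hX.2, mul_one]
    have h3 := (Finset.sum_eq_sum_iff_of_le fun j _ => h2 j).1
      (le_antisymm (Finset.sum_le_sum fun j _ => h2 j) h1) j (Finset.mem_univ j)
    have h4 : ∑ i, (c (g j) * a (g j) j - c i * a i j) * X i j = 0 := by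
      simp only [sub_mul, Finset.sum_sub_distrib, ← Finset.mul_sum, hX.2, h3]
      ring
    have h5 := (Finset.sum_eq_zero_iff_of_nonneg fun i _ =>
      mul_nonneg (sub_nonneg.2 (hg i j)) (hX.1 i j)).1 h4 i (Finset.mem_univ i)
    rcases mul_eq_zero.1 h5 with h6 | h6
    · linarith [hg k j]
    · exact absurd h6 hij.ne'
  · rintro h _ ⟨Y, hY, rfl⟩
    rw [weighted_value, weighted_value]
    refine Finset.sum_le_sum fun j _ => ?_
    obtain ⟨i₀, hi₀⟩ : ∃ i, 0 < X i j := by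
      by_contra! hcon
      have := hX.2 j
      have h' : ∑ i, X i j ≤ 0 := Finset.sum_nonpos fun i _ => hcon i
      linarith
    have hmax := h i₀ j hi₀
    have h1 : ∀ i, c i * a i j * X i j = c i₀ * a i₀ j * X i j := fun i => by
      rcases (hX.1 i j).eq_or_lt with h0 | h0
      · simp [← h0]
      · rw [le_antisymm (hmax i) (h i j h0 i₀)]
    calc ∑ i, c i * a i j * Y i j ≤ ∑ i, c i₀ * a i₀ j * Y i j :=
          Finset.sum_le_sum fun i _ => mul_le_mul_of_nonneg_right (hmax i) (hY.1 i j)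
      _ = ∑ i, c i * a i j * X i j := by
          simp only [h1]
          rw [← Finset.mul_sum, ← Finset.mul_sum, hX.2, hY.2]

/-! ### The faces `faceAt a β` -/

theorem RD_apply (β : E3) (i : Fin 3) : RD β i = (1 / β i) / ∑ k, 1 / β k := rfl

theorem sum_inv_pos {β : E3} (hβ : β ∈ openRNS) : 0 < ∑ k, 1 / β k :=
  Finset.sum_pos (fun k _ => one_div_pos.2 (hβ.1 k)) Finset.univ_nonempty

theorem RD_pos {β : E3} (hβ : β ∈ openRNS) (i : Fin 3) : 0 < RD β i := by
  rw [RD_apply]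
  exact div_pos (one_div_pos.2 (hβ.1 i)) (sum_inv_pos hβ)

theorem RD_mul_le_iff {β : E3} (hβ : β ∈ openRNS) (i k : Fin 3) (x y : ℝ) :
    RD β k * y ≤ RD β i * x ↔ y * β i ≤ x * β k := by
  have hs := sum_inv_pos hβ
  rw [RD_apply, RD_apply, div_mul_eq_mul_div (1 / β k), div_mul_eq_mul_div (1 / β i),
    div_le_div_iff_of_pos_right hs, one_div_mul_eq_div, one_div_mul_eq_div,
    div_le_div_iff₀ (hβ.1 k) (hβ.1 i)]

/-- Allocations (possibly splitting items) following the Pareto allocation rule after `β`. -/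
def FollowsPAR (a : Evaluation m) (β : E3) (X : Fin 3 → Fin m → ℝ) : Prop :=
  IsAllocation X ∧ ∀ i j, 0 < X i j → i ∈ claimants a β j

theorem mem_faceAt_iff_isMax {a : Evaluation m} {β x : E3} :
    x ∈ faceAt a β ↔ x ∈ IPS a ∧ ∀ y ∈ IPS a, weighted (RD β) y ≤ weighted (RD β) x := by
  simp only [weighted_apply]
  rfl

/-- Comparing `RD β i * a i j` among players is comparing the ratios `a i j / β i`, so the
maximizing players are the claimants. -/
theorem value_mem_faceAt_iff {a : Evaluation m} (ha : ∀ i j, 0 < a i j) {β : E3}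
    (hβ : β ∈ openRNS) {X : Fin 3 → Fin m → ℝ} (hX : IsAllocation X) :
    value a X ∈ faceAt a β ↔ FollowsPAR a β X := by
  rw [mem_faceAt_iff_isMax, isMax_weighted_iff _ _ hX]
  simp only [RD_mul_le_iff hβ, FollowsPAR, mem_claimants_iff ha, hX, true_and]
  exact ⟨fun h => h.2, fun h => ⟨⟨X, hX, rfl⟩, h⟩⟩

theorem mem_faceAt_iff {a : Evaluation m} (ha : ∀ i j, 0 < a i j) {β : E3}
    (hβ : β ∈ openRNS) {x : E3} :
    x ∈ faceAt a β ↔ ∃ X, FollowsPAR a β X ∧ x = value a X := by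
  constructor
  · intro h
    obtain ⟨X, hX, rfl⟩ := h.1
    exact ⟨X, (value_mem_faceAt_iff ha hβ hX).1 h, rfl⟩
  · rintro ⟨X, hX, rfl⟩
    exact (value_mem_faceAt_iff ha hβ hX.1).2 hX

theorem FollowsPAR.eq_zero {a : Evaluation m} {β : E3} {X : Fin 3 → Fin m → ℝ}
    (h : FollowsPAR a β X) {i : Fin 3} {j : Fin m} (hi : i ∉ claimants a β j) : X i j = 0 :=
  le_antisymm (not_lt.1 fun h0 => hi (h.2 i j h0)) (h.1.1 i j)

theorem followsPAR_integerAllocation {a : Evaluation m} {β : E3} {x : Fin m → Fin 3}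
    (hx : x ∈ integerPAR a β) : FollowsPAR a β (integerAllocation x) := by
  refine ⟨isAllocation_integerAllocation x, fun i j h => ?_⟩
  unfold integerAllocation at h
  split_ifs at h with h'
  · exact h' ▸ hx j
  · exact absurd h (lt_irrefl _)

theorem convex_IPS (a : Evaluation m) : Convex ℝ (IPS a) := by
  rintro _ ⟨X, hX, rfl⟩ _ ⟨Y, hY, rfl⟩ s t hs ht hst
  refine ⟨fun i j => s * X i j + t * Y i j, ⟨fun i j => ?_, fun j => ?_⟩, ?_⟩
  · have := hX.1 i j
    have := hY.1 i j
    positivity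
  · rw [Finset.sum_add_distrib, ← Finset.mul_sum, ← Finset.mul_sum, hX.2, hY.2]
    linarith
  · ext i
    simp only [PiLp.add_apply, PiLp.smul_apply, value_apply, smul_eq_mul, Finset.mul_sum,
      ← Finset.sum_add_distrib]
    exact Finset.sum_congr rfl fun j _ => by ring

theorem convex_faceAt (a : Evaluation m) (β : E3) : Convex ℝ (faceAt a β) := by
  rintro x hx y hy s t hs ht hst
  rw [mem_faceAt_iff_isMax] at *
  refine ⟨convex_IPS a hx.1 hy.1 hs ht hst, fun z hz => ?_⟩
  rw [map_add, map_smul, map_smul, smul_eq_mul, smul_eq_mul]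
  have h1 := mul_le_mul_of_nonneg_left (hx.2 z hz) hs
  have h2 := mul_le_mul_of_nonneg_left (hy.2 z hz) ht
  have h3 : weighted (RD β) z = s * weighted (RD β) z + t * weighted (RD β) z := by
    rw [← add_mul, hst, one_mul]
  linarith

theorem isExposed_faceAt (a : Evaluation m) (β : E3) : IsExposed ℝ (IPS a) (faceAt a β) := by
  intro _
  refine ⟨(weighted (RD β)).toContinuousLinearMap, ?_⟩
  ext x
  exact mem_faceAt_iff_isMax

/-- The coefficients `RD β i` are strictly positive, so a Pareto improvement would increase the
maximized sum. -/
theorem faceAt_subset_paretoBoundary {a : Evaluation m} {β : E3} (hβ : β ∈ openRNS) :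
    faceAt a β ⊆ paretoBoundary a := by
  intro x hx
  obtain ⟨X, hX, rfl⟩ := hx.1
  refine ⟨X, ⟨hX, ?_⟩, rfl⟩
  rintro ⟨Y, hY, hle, i, hi⟩
  have := hx.2 _ ⟨Y, hY, rfl⟩
  have h2 : ∑ i, RD β i * value a X i < ∑ i, RD β i * value a Y i :=
    Finset.sum_lt_sum (fun k _ => mul_le_mul_of_nonneg_left (hle k) (RD_pos hβ k).le)
      ⟨i, Finset.mem_univ i, mul_lt_mul_of_pos_left hi (RD_pos hβ i)⟩
  linarith

theorem weighted_eq_of_mem_faceAt {a : Evaluation m} {β x y : E3} (hx : x ∈ faceAt a β)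
    (hy : y ∈ faceAt a β) : weighted (RD β) x = weighted (RD β) y := by
  rw [mem_faceAt_iff_isMax] at hx hy
  exact le_antisymm (hy.2 x hx.1) (hx.2 y hy.1)

/-! ### Merging -/

theorem merge_pos {a : Evaluation m} (ha : ∀ i j, 0 < a i j) {f : Fin m → Fin n}
    (hf : Function.Surjective f) (i : Fin 3) (l : Fin n) : 0 < merge a f i l := by
  obtain ⟨j, hj⟩ := hf l
  exact Finset.sum_pos (fun j _ => ha i j) ⟨j, by simp [hj]⟩

theorem IsMerging.claimants_eq {a : Evaluation m} (ha : ∀ i j, 0 < a i j) {β : E3}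
    (hβ : β ∈ openRNS) {f : Fin m → Fin n} (hf : IsMerging a β f) {j k : Fin m}
    (h : f j = f k) : claimants a β j = claimants a β k := by
  rcases eq_or_ne j k with rfl | hne
  · rfl
  rcases hf.2 j k hne h with ⟨h1, h2⟩ | ⟨l, h1, h2⟩
  · rw [(claimants_eq_univ_iff ha hβ j).2 h1, (claimants_eq_univ_iff ha hβ k).2 h2]
  · rw [(claimants_eq_compl_iff ha hβ j l).2 h1, (claimants_eq_compl_iff ha hβ k l).2 h2]

/-- The bounds `a i k ≤ β i * W k` add up over a fibre, and equality in the sum means equality for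
each item. As the items of a fibre have common claimants, the weight of the merged item is the sum
of their weights. -/
theorem claimants_merge {a : Evaluation m} (ha : ∀ i j, 0 < a i j) {β : E3}
    (hβ : β ∈ openRNS) {f : Fin m → Fin n} (hf : Function.Surjective f)
    (hc : ∀ j k, f j = f k → claimants a β j = claimants a β k) (j : Fin m) :
    claimants (merge a f) β (f j) = claimants a β j := by
  choose W hW hle hcl using fun j => exists_weight ha hβ j
  have hsum : ∀ i, merge a f i (f j) ≤ β i * ∑ k with f k = f j, W k := fun i => by
    rw [Finset.mul_sum]
    exact Finset.sum_le_sum fun k _ => hle k i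
  have heq : ∀ i, i ∈ claimants a β j ↔ merge a f i (f j) = β i * ∑ k with f k = f j, W k := by
    intro i
    rw [Finset.mul_sum, merge, Finset.sum_eq_sum_iff_of_le fun k _ => hle k i]
    constructor
    · intro h k hk
      rw [← hcl, hc k j (by simpa using hk)]
      exact h
    · intro h
      exact (hcl j i).2 (h j (by simp))
  obtain ⟨i₀, hi₀⟩ := claimants_nonempty ha hβ j
  obtain ⟨W', -, hle', hcl'⟩ := exists_weight (merge_pos ha hf) hβ (f j)
  obtain ⟨i₁, hi₁⟩ := claimants_nonempty (merge_pos ha hf) hβ (f j)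
  have hWW : W' = ∑ k with f k = f j, W k := by
    apply le_antisymm
    · have := hsum i₁
      rw [(hcl' i₁).1 hi₁] at this
      exact le_of_mul_le_mul_left this (hβ.1 i₁)
    · have := hle' i₀
      rw [(heq i₀).1 hi₀] at this
      exact le_of_mul_le_mul_left this (hβ.1 i₀)
  ext i
  rw [hcl', heq, hWW]

/-- An allocation of the merged items is copied to each item of the fibre. Conversely, shares in a
fibre are averaged with the weights `W`: claimants value the items in proportion to `W`, and
non-claimants have no share. -/
theorem faceAt_merge {a : Evaluation m} (ha : ∀ i j, 0 < a i j) {β : E3}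
    (hβ : β ∈ openRNS) {f : Fin m → Fin n} (hf : Function.Surjective f)
    (hc : ∀ j k, f j = f k → claimants a β j = claimants a β k) :
    faceAt (merge a f) β = faceAt a β := by
  have hcm := claimants_merge ha hβ hf hc
  have hb := merge_pos ha hf
  ext x
  rw [mem_faceAt_iff hb hβ, mem_faceAt_iff ha hβ]
  constructor
  · rintro ⟨X, hX, rfl⟩
    refine ⟨fun i j => X i (f j), ⟨⟨fun i j => hX.1.1 i _, fun j => hX.1.2 _⟩, fun i j h => ?_⟩, ?_⟩
    · rw [← hcm j]
      exact hX.2 _ _ h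
    · ext i
      rw [value_apply, value_apply, ← Finset.sum_fiberwise (s := Finset.univ) (g := f)]
      refine Finset.sum_congr rfl fun l _ => ?_
      rw [merge, Finset.sum_mul]
      refine Finset.sum_congr rfl fun j hj => ?_
      rw [(Finset.mem_filter.1 hj).2]
  · rintro ⟨X, hX, rfl⟩
    choose W hW hle hcl using fun j => exists_weight ha hβ j
    have hpos : ∀ l, 0 < ∑ k with f k = l, W k := fun l => by
      obtain ⟨j, hj⟩ := hf l
      exact Finset.sum_pos (fun j _ => hW j) ⟨j, by simp [hj]⟩
    have hzero : ∀ i l, i ∉ claimants (merge a f) β l → ∀ j, f j = l → X i j = 0 := by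
      rintro i l hi j rfl
      rw [hcm j] at hi
      exact hX.eq_zero hi
    refine ⟨fun i l => (∑ j with f j = l, W j * X i j) / ∑ j with f j = l, W j,
      ⟨⟨fun i l => ?_, fun l => ?_⟩, fun i l h => ?_⟩, ?_⟩
    · exact div_nonneg (Finset.sum_nonneg fun j _ => mul_nonneg (hW j).le (hX.1.1 i j)) (hpos l).le
    · rw [← Finset.sum_div, Finset.sum_comm]
      simp only [← Finset.mul_sum, hX.1.2, mul_one]
      exact div_self (hpos l).ne'
    · by_contra hi
      refine h.ne' (div_eq_zero_iff.2 (Or.inl (Finset.sum_eq_zero fun j hj => ?_)))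
      rw [hzero i l hi j (Finset.mem_filter.1 hj).2, mul_zero]
    · ext i
      rw [value_apply, value_apply, ← Finset.sum_fiberwise (s := Finset.univ) (g := f)]
      refine Finset.sum_congr rfl fun l _ => ?_
      by_cases hi : i ∈ claimants (merge a f) β l
      · have hval : ∀ j, f j = l → a i j = β i * W j := by
          rintro j rfl
          rw [hcm j] at hi
          exact (hcl j i).1 hi
        have h1 : merge a f i l = β i * ∑ j with f j = l, W j := by
          rw [merge, Finset.mul_sum]
          exact Finset.sum_congr rfl fun j hj => hval j (Finset.mem_filter.1 hj).2
        have h2 : ∑ j with f j = l, a i j * X i j = β i * ∑ j with f j = l, W j * X i j := by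
          rw [Finset.mul_sum]
          refine Finset.sum_congr rfl fun j hj => ?_
          rw [hval j (Finset.mem_filter.1 hj).2, mul_assoc]
        have := (hpos l).ne'
        rw [h1, h2]
        field_simp
      · have h1 : ∀ j ∈ Finset.univ.filter fun j => f j = l, a i j * X i j = 0 := fun j hj => by
          rw [hzero i l hi j (Finset.mem_filter.1 hj).2, mul_zero]
        have h2 : ∀ j ∈ Finset.univ.filter fun j => f j = l, W j * X i j = 0 := fun j hj => by
          rw [hzero i l hi j (Finset.mem_filter.1 hj).2, mul_zero]
        rw [Finset.sum_eq_zero h1, Finset.sum_eq_zero h2, zero_div, mul_zero]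

end

section

variable {m n : ℕ}

/-! ### Pareto optimal allocations maximize a positively weighted sum -/

/-- No cyclic exchange of (shares of) items among the players improves a Pareto optimal
allocation. -/
theorem IsParetoOptimal.cycle_le {a : Evaluation m} (ha : ∀ i j, 0 < a i j)
    {X : Fin 3 → Fin m → ℝ} (hX : IsParetoOptimal a X) (p : Fin 3 → Fin 3) (l : Fin 3 → Fin m)
    (hp : ∀ r, 0 < X (p r) (l r)) :
    a (p 1) (l 0) * a (p 2) (l 1) * a (p 0) (l 2) ≤
      a (p 0) (l 0) * a (p 1) (l 1) * a (p 2) (l 2) := by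
  by_contra! hlt
  -- Player `p r` hands an amount `ε r` of item `l r` to player `p (r + 1)`. The ratios `e1`, `e2`
  -- of the amounts make the exchange neutral for `p 1` and `p 2`, so that the gain goes to `p 0`.
  set e1 : ℝ := a (p 1) (l 0) / a (p 1) (l 1) with he1
  set e2 : ℝ := e1 * a (p 2) (l 1) / a (p 2) (l 2) with he2
  have h1pos : 0 < e1 := div_pos (ha _ _) (ha _ _)
  have h2pos : 0 < e2 := div_pos (mul_pos h1pos (ha _ _)) (ha _ _)
  obtain ⟨μ, hμ, hμX⟩ : ∃ μ : ℝ, 0 < μ ∧ ∀ r, μ ≤ X (p r) (l r) := by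
    obtain ⟨r, hr⟩ := Finite.exists_min fun r => X (p r) (l r)
    exact ⟨_, hp r, hr⟩
  -- The three amounts add up to the smallest share `μ`, so shares stay nonnegative even when
  -- players or items repeat in the cycle.
  set d : ℝ := μ / (1 + e1 + e2) with hd
  have hdpos : 0 < d := by positivity
  have hdsum : d * 1 + d * e1 + d * e2 = μ := by rw [hd]; field_simp
  let ε : Fin 3 → ℝ := ![d * 1, d * e1, d * e2]
  have hεpos : ∀ r, 0 < ε r := by
    intro r; fin_cases r <;> simp [ε] <;> positivity
  have hεsum : ∑ r, ε r = μ := by simpa [Fin.sum_univ_three, ε] using hdsum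
  let δ : Fin 3 → Fin 3 → Fin m → ℝ := fun r i j => if p r = i ∧ l r = j then ε r else 0
  let δ' : Fin 3 → Fin 3 → Fin m → ℝ := fun r i j => if p (r + 1) = i ∧ l r = j then ε r else 0
  let Y : Fin 3 → Fin m → ℝ := fun i j => X i j + ∑ r, δ' r i j - ∑ r, δ r i j
  have hY : IsAllocation Y := by
    constructor
    · intro i j
      have h1 : 0 ≤ ∑ r, δ' r i j := Finset.sum_nonneg fun r _ => by
        simp only [δ']; split_ifs; exacts [(hεpos r).le, le_rfl]
      have h2 : ∑ r, δ r i j ≤ X i j := by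
        by_cases h : ∃ r, p r = i ∧ l r = j
        · obtain ⟨r, rfl, rfl⟩ := h
          calc ∑ r', δ r' (p r) (l r) ≤ ∑ r', ε r' := Finset.sum_le_sum fun r' _ => by
                simp only [δ]; split_ifs; exacts [le_rfl, (hεpos r').le]
            _ ≤ _ := by rw [hεsum]; exact hμX r
        · push Not at h
          rw [Finset.sum_eq_zero fun r _ => if_neg fun hr => h r hr.1 hr.2]
          exact hX.1.1 i j
      simp only [Y]; linarith
    · intro j
      have h1 : ∀ r, ∑ i, δ r i j = if l r = j then ε r else 0 := fun r => by
        by_cases h : l r = j <;> simp [δ, h]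
      have h2 : ∀ r, ∑ i, δ' r i j = if l r = j then ε r else 0 := fun r => by
        by_cases h : l r = j <;> simp [δ', h]
      simp only [Y, Finset.sum_sub_distrib, Finset.sum_add_distrib]
      rw [hX.1.2, Finset.sum_comm, Finset.sum_comm (f := fun i r => δ r i j)]
      simp only [h1, h2]
      ring
  have hval : ∀ i, value a Y i = value a X i +
      ∑ r, (if p (r + 1) = i then a i (l r) * ε r else 0) -
      ∑ r, (if p r = i then a i (l r) * ε r else 0) := by
    intro i
    simp only [value_apply, Y, mul_sub, mul_add, Finset.sum_sub_distrib, Finset.sum_add_distrib,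
      Finset.mul_sum]
    rw [Finset.sum_comm, Finset.sum_comm (f := fun j r => a i j * δ r i j)]
    have h1 : ∀ r, ∑ j, a i j * δ' r i j = if p (r + 1) = i then a i (l r) * ε r else 0 :=
      fun r => by by_cases h : p (r + 1) = i <;> simp [δ', h]
    have h2 : ∀ r, ∑ j, a i j * δ r i j = if p r = i then a i (l r) * ε r else 0 :=
      fun r => by by_cases h : p r = i <;> simp [δ, h]
    simp only [h1, h2]
  have hb : a (p 1) (l 0) * ε 0 = a (p 1) (l 1) * ε 1 := by
    have := (ha (p 1) (l 1)).ne'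
    simp only [ε, Matrix.cons_val_zero, Matrix.cons_val_one, he1]
    field_simp
  have hc : a (p 2) (l 1) * ε 1 = a (p 2) (l 2) * ε 2 := by
    have := (ha (p 2) (l 2)).ne'
    simp only [ε, Matrix.cons_val_one, Matrix.cons_val, he2]
    field_simp
  have hgain : a (p 0) (l 0) * ε 0 < a (p 0) (l 2) * ε 2 := by
    have h1 := ha (p 1) (l 1)
    have h2 := ha (p 2) (l 2)
    have h3 : a (p 0) (l 0) < a (p 0) (l 2) * e2 := by
      rw [he2, he1, ← mul_div_assoc, lt_div_iff₀ h2, div_mul_eq_mul_div, mul_div_assoc',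
        lt_div_iff₀ h1]
      linarith
    have := mul_lt_mul_of_pos_left h3 hdpos
    simp only [ε, Matrix.cons_val_zero, Matrix.cons_val]
    linarith
  have hval' : ∀ i, value a Y i = value a X i +
      if p 0 = i then a (p 0) (l 2) * ε 2 - a (p 0) (l 0) * ε 0 else 0 := by
    intro i
    rw [hval i, Fin.sum_univ_three, Fin.sum_univ_three]
    have e1 : (0 : Fin 3) + 1 = 1 := rfl
    have e2 : (1 : Fin 3) + 1 = 2 := rfl
    have e3 : (2 : Fin 3) + 1 = 0 := rfl
    rw [e1, e2, e3]
    have hb' : (if p 1 = i then a i (l 0) * ε 0 else 0) =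
        if p 1 = i then a i (l 1) * ε 1 else 0 := by
      split_ifs with h
      · rw [← h]; exact hb
      · rfl
    have hc' : (if p 2 = i then a i (l 1) * ε 1 else 0) =
        if p 2 = i then a i (l 2) * ε 2 else 0 := by
      split_ifs with h
      · rw [← h]; exact hc
      · rfl
    rw [hb', hc']
    by_cases h : p 0 = i
    · subst h
      simp only [if_true]
      ring
    · simp only [if_neg h]
      ring
  refine hX.2 ⟨Y, hY, fun i => ?_, p 0, ?_⟩
  · rw [hval' i]
    split_ifs <;> linarith
  · rw [hval' (p 0), if_pos rfl]
    linarith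

/-- Potentials for a multiplicative matrix on three points whose cycles have product at most
one. -/
theorem exists_potential (D : Fin 3 → Fin 3 → ℝ) (h0 : ∀ i k, 0 ≤ D i k) (h1 : ∀ i, D i i = 1)
    (hc : ∀ i k l, D i k * D k l * D l i ≤ 1) :
    ∃ w : Fin 3 → ℝ, (∀ i, 0 < w i) ∧ ∀ i k, D i k * w k ≤ w i := by
  -- The potential of `i` is the largest product along a path of two steps from `i`; as the diagonal
  -- is one, shorter paths are included.
  choose q hq using fun i => Finite.exists_max fun q : Fin 3 × Fin 3 => D i q.1 * D q.1 q.2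
  have hmax : ∀ i k l, D i k * D k l ≤ D i (q i).1 * D (q i).1 (q i).2 :=
    fun i k l => hq i (k, l)
  have h2 : ∀ i k, D i k * D k i ≤ 1 := fun i k => by simpa [h1] using hc i k i
  refine ⟨fun i => D i (q i).1 * D (q i).1 (q i).2, fun i => ?_, fun i k => ?_⟩
  · have := hmax i i i
    rw [h1, one_mul] at this
    linarith
  · dsimp only
    obtain ⟨k', l⟩ := q k
    dsimp only
    -- A path of three steps visits four places among three indices, so it contains a cycle;
    -- removing it does not decrease the product and leaves at most two steps.
    have hpig : ∀ i k l r : Fin 3, i = k ∨ i = l ∨ i = r ∨ k = l ∨ k = r ∨ l = r := by decide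
    rcases hpig i k k' l with rfl | rfl | rfl | rfl | rfl | rfl
    · rw [h1, one_mul]; exact hmax _ _ _
    · have := hmax i l l
      have h3 := mul_le_mul_of_nonneg_right (h2 i k) (h0 i l)
      rw [h1, mul_one] at this
      linarith
    · have := hmax i i i
      rw [h1, mul_one] at this
      linarith [hc i k k']
    · rw [h1, one_mul]; exact hmax _ _ _
    · have := hmax i k k
      have h3 := mul_le_mul_of_nonneg_left (h2 k k') (h0 i k)
      rw [h1, mul_one] at this
      linarith
    · rw [h1, mul_one]; exact hmax _ _ _

/-- The wanted inequality says `(a k j / a i j) * w k ≤ w i` for all items held by `i`. With `D i k`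
the largest such ratio, `w` is a potential for `D`, and the cycle condition is the absence of
improving exchanges. -/
theorem IsParetoOptimal.exists_weights {a : Evaluation m} (ha : ∀ i j, 0 < a i j)
    {X : Fin 3 → Fin m → ℝ} (hX : IsParetoOptimal a X) :
    ∃ w : Fin 3 → ℝ, (∀ i, 0 < w i) ∧ ∀ i j, 0 < X i j → ∀ k, w k * a k j ≤ w i * a i j := by
  classical
  have hex : ∀ i k, ∃ d : ℝ, 0 ≤ d ∧ (∀ j, 0 < X i j → a k j / a i j ≤ d) ∧
      (d = 0 ∨ ∃ j, 0 < X i j ∧ d = a k j / a i j) := by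
    intro i k
    by_cases h : ∃ j, 0 < X i j
    · obtain ⟨j₀, hj₀⟩ := h
      obtain ⟨j, hj, hmax⟩ := Finset.exists_max_image (Finset.univ.filter fun j => 0 < X i j)
        (fun j => a k j / a i j) ⟨j₀, by simpa using hj₀⟩
      refine ⟨a k j / a i j, (div_pos (ha _ _) (ha _ _)).le, fun j' hj' => hmax j' (by simpa using hj'),
        Or.inr ⟨j, by simpa using hj, rfl⟩⟩
    · push Not at h
      exact ⟨0, le_rfl, fun j hj => absurd hj (not_lt.2 (h j)), Or.inl rfl⟩
  choose d hd0 hdle hd using hex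
  have hcase : ∀ i k, (if i = k then 1 else d i k) = 0 ∨ i = k ∨ ∃ j, 0 < X i j ∧
      (if i = k then 1 else d i k) = a k j / a i j := by
    intro i k
    by_cases h : i = k
    · exact Or.inr (Or.inl h)
    · rcases hd i k with h' | h'
      · left; rw [if_neg h, h']
      · right; right; rw [if_neg h]; exact h'
  -- A player holding nothing gets `d i k = 0`; the diagonal is set to one separately, as
  -- `exists_potential` requires.
  let D : Fin 3 → Fin 3 → ℝ := fun i k => if i = k then 1 else d i k
  have hD0 : ∀ i k, 0 ≤ D i k := fun i k => by
    simp only [D]; split_ifs; exacts [zero_le_one, hd0 i k]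
  have hD1 : ∀ i, D i i = 1 := fun i => if_pos rfl
  have hcyc : ∀ i k l j₀ j₁ j₂, 0 < X i j₀ → 0 < X k j₁ → 0 < X l j₂ →
      a k j₀ / a i j₀ * (a l j₁ / a k j₁) * (a i j₂ / a l j₂) ≤ 1 := by
    intro i k l j₀ j₁ j₂ e₀ e₁ e₂
    have := hX.cycle_le ha ![i, k, l] ![j₀, j₁, j₂] (by intro r; fin_cases r <;> assumption)
    simp only [Matrix.cons_val_zero, Matrix.cons_val_one, Matrix.cons_val] at this
    rw [div_mul_div_comm, div_mul_div_comm,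
      div_le_one (mul_pos (mul_pos (ha _ _) (ha _ _)) (ha _ _))]
    exact this
  have h2cyc : ∀ i k, D i k * D k i ≤ 1 := by
    intro i k
    rcases hcase i k with h | h | ⟨j, hj, h⟩
    · simp only [D]; rw [h, zero_mul]; exact zero_le_one
    · rw [h, hD1, one_mul]
    rcases hcase k i with h' | h' | ⟨j', hj', h'⟩
    · simp only [D]; rw [h', mul_zero]; exact zero_le_one
    · rw [h', hD1, one_mul]
    · have := hcyc i k k j j' j' hj hj' hj'
      rw [div_self (ha k j').ne', mul_one] at this
      simp only [D]; rw [h, h']; exact this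
  obtain ⟨w, hw, hwD⟩ := exists_potential D hD0 hD1 (by
    intro i k l
    rcases hcase i k with h | h | ⟨j, hj, h⟩
    · simp only [D]; rw [h, zero_mul, zero_mul]; exact zero_le_one
    · subst h; rw [hD1, one_mul]; exact h2cyc _ _
    rcases hcase k l with h' | h' | ⟨j', hj', h'⟩
    · simp only [D]; rw [h', mul_zero, zero_mul]; exact zero_le_one
    · subst h'; rw [hD1, mul_one]; exact h2cyc _ _
    rcases hcase l i with h'' | h'' | ⟨j'', hj'', h''⟩
    · simp only [D]; rw [h'', mul_zero]; exact zero_le_one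
    · subst h''; rw [hD1, mul_one]; exact h2cyc _ _
    simp only [D]
    rw [h, h', h'']
    exact hcyc i k l j j' j'' hj hj' hj'')
  refine ⟨w, hw, fun i j hij k => ?_⟩
  by_cases h : i = k
  · subst h; exact le_rfl
  have h1 : a k j / a i j ≤ D i k := by simp only [D]; rw [if_neg h]; exact hdle i k j hij
  have h2 := (mul_le_mul_of_nonneg_right h1 (hw k).le).trans (hwD i k)
  rw [div_mul_eq_mul_div, div_le_iff₀ (ha i j)] at h2
  linarith

/-! ### Pareto faces -/

theorem normalize_mem_openRNS {x : Fin 3 → ℝ} (hx : ∀ i, 0 < x i) : normalize x ∈ openRNS := by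
  have hs : 0 < ∑ i, x i := Finset.sum_pos (fun i _ => hx i) Finset.univ_nonempty
  refine ⟨fun i => div_pos (hx i) hs, ?_⟩
  change ∑ i, x i / ∑ k, x k = 1
  rw [← Finset.sum_div]
  exact div_self hs.ne'

theorem mem_claimants_normalize {a : Evaluation m} (ha : ∀ i j, 0 < a i j) {w : Fin 3 → ℝ}
    (hw : ∀ i, 0 < w i) (i : Fin 3) (j : Fin m) :
    i ∈ claimants a (normalize fun i => 1 / w i) j ↔ ∀ k, w k * a k j ≤ w i * a i j := by
  rw [mem_claimants_iff ha]
  have hs : 0 < ∑ i, 1 / w i :=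
    Finset.sum_pos (fun i _ => one_div_pos.2 (hw i)) Finset.univ_nonempty
  refine forall_congr' fun k => ?_
  change a k j * (1 / w i / _) ≤ a i j * (1 / w k / _) ↔ _
  rw [← mul_div_assoc (a k j), ← mul_div_assoc (a i j), div_le_div_iff_of_pos_right hs,
    mul_one_div, mul_one_div,
    div_le_div_iff₀ (hw i) (hw k), mul_comm (a k j), mul_comm (a i j)]

theorem vectorSpan_faceAt_le {a : Evaluation m} {β : E3} :
    vectorSpan ℝ (faceAt a β) ≤ LinearMap.ker (weighted (RD β)) := by
  rw [vectorSpan_def, Submodule.span_le]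
  rintro _ ⟨x, hx, y, hy, rfl⟩
  simp only [vsub_eq_sub, SetLike.mem_coe, LinearMap.mem_ker, map_sub]
  rw [weighted_eq_of_mem_faceAt hx hy, sub_self]

theorem finrank_ker_of_ne_zero {φ : E3 →ₗ[ℝ] ℝ} (hφ : φ ≠ 0) :
    Module.finrank ℝ (LinearMap.ker φ) = 2 := by
  have h1 := LinearMap.finrank_range_add_finrank_ker φ
  rw [LinearMap.range_eq_top.2 (LinearMap.surjective hφ)] at h1
  simp at h1
  omega

theorem weighted_single (c : Fin 3 → ℝ) (i : Fin 3) (r : ℝ) :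
    weighted c (EuclideanSpace.single i r) = c i * r := by
  rw [weighted_apply]
  simp [PiLp.single_apply]

theorem weighted_ne_zero {c : Fin 3 → ℝ} {i : Fin 3} (hc : c i ≠ 0) : weighted c ≠ 0 := by
  intro h
  have := weighted_single c i 1
  rw [h] at this
  simp at this
  exact hc this.symm

theorem RD_mul_self {β : E3} (hβ : β ∈ openRNS) (i : Fin 3) :
    RD β i * β i = 1 / ∑ k, 1 / β k := by
  have := (hβ.1 i).ne'
  rw [RD_apply]
  field_simp

/-- Both spaces have dimension two and one contains the other. -/
theorem vectorSpan_faceAt {a : Evaluation m} {β : E3} (hβ : β ∈ openRNS) {F : Set E3}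
    (hF : F ⊆ faceAt a β) (h2 : Module.finrank ℝ (vectorSpan ℝ F) = 2) :
    vectorSpan ℝ F = LinearMap.ker (weighted (RD β)) :=
  Submodule.eq_of_le_of_finrank_eq ((vectorSpan_mono ℝ hF).trans vectorSpan_faceAt_le)
    (by rw [h2, finrank_ker_of_ne_zero (weighted_ne_zero (RD_pos hβ 0).ne')])

/-- The direction that moves utility from player `k` to player `i` along the face. -/
theorem exchange_mem_ker {β : E3} (hβ : β ∈ openRNS) (i k : Fin 3) :
    EuclideanSpace.single i (β i) - EuclideanSpace.single k (β k) ∈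
      LinearMap.ker (weighted (RD β)) := by
  rw [LinearMap.mem_ker, map_sub, weighted_single, weighted_single,
    RD_mul_self hβ, RD_mul_self hβ, sub_self]

/-- The exchange directions of `β` lie in the common direction plane, so `RD β'` annihilates them;
this says that `β` and `β'` are proportional. -/
theorem faceAt_injective {a : Evaluation m} {β β' : E3} (hβ : β ∈ openRNS) (hβ' : β' ∈ openRNS)
    (h : faceAt a β = faceAt a β') (h2 : Module.finrank ℝ (vectorSpan ℝ (faceAt a β)) = 2) :
    β' = β := by
  have h1 := vectorSpan_faceAt hβ subset_rfl h2
  have h3 := vectorSpan_faceAt hβ' h.le h2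
  have key : ∀ i k, β i * β' k = β k * β' i := by
    intro i k
    have := exchange_mem_ker hβ i k
    rw [← h1, h3, LinearMap.mem_ker, map_sub, weighted_single, weighted_single, RD_apply,
      RD_apply, sub_eq_zero, div_mul_eq_mul_div (1 / β' i), div_mul_eq_mul_div (1 / β' k),
      div_left_inj' (sum_inv_pos hβ').ne', one_div_mul_eq_div, one_div_mul_eq_div,
      div_eq_div_iff (hβ'.1 i).ne' (hβ'.1 k).ne'] at this
    exact this
  ext i
  have := Finset.sum_congr rfl fun k (_ : k ∈ Finset.univ) => key i k
  rw [← Finset.mul_sum, ← Finset.sum_mul, hβ.2, hβ'.2] at this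
  linarith

/-- Splitting each item equally among all its maximizers gives the largest possible support:
whatever is derived for the support of this allocation holds for every maximizing allocation. -/
theorem exists_full_argmax (c : Fin 3 → ℝ) (a : Evaluation m) :
    ∃ X : Fin 3 → Fin m → ℝ, IsAllocation X ∧
      ∀ i j, 0 < X i j ↔ ∀ k, c k * a k j ≤ c i * a i j := by
  classical
  let A : Fin m → Finset (Fin 3) := fun j => {i | ∀ k, c k * a k j ≤ c i * a i j}
  have hA : ∀ j, 0 < ((A j).card : ℝ) := fun j => by
    obtain ⟨g, hg⟩ := exists_argmax c a
    exact_mod_cast Finset.card_pos.2 ⟨g j, by simp only [A, Finset.mem_filter]; exact ⟨Finset.mem_univ _, fun k => hg k j⟩⟩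
  refine ⟨fun i j => if i ∈ A j then 1 / ((A j).card : ℝ) else 0, ⟨fun i j => ?_, fun j => ?_⟩,
    fun i j => ?_⟩
  · dsimp only
    split_ifs
    · exact (one_div_pos.2 (hA j)).le
    · exact le_rfl
  · rw [Finset.sum_ite_mem, Finset.univ_inter, Finset.sum_const, nsmul_eq_mul]
    exact mul_one_div_cancel (hA j).ne'
  · have : (∀ k, c k * a k j ≤ c i * a i j) ↔ i ∈ A j := by simp [A]
    rw [this]
    dsimp only
    split_ifs with h
    · exact ⟨fun _ => h, fun _ => one_div_pos.2 (hA j)⟩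
    · exact ⟨fun h' => absurd h' (lt_irrefl _), fun h' => absurd h' h⟩

theorem exists_faceAt_of_isParetoFace {a : Evaluation m} (ha : ∀ i j, 0 < a i j) {F : Set E3}
    (hF : IsParetoFace a F) : ∃ β ∈ openRNS, F = faceAt a β := by
  obtain ⟨hexp, hpar, hdim⟩ := hF
  have hne : F.Nonempty := by
    by_contra h
    rw [Set.not_nonempty_iff_eq_empty.1 h, vectorSpan_empty] at hdim
    simp at hdim
  obtain ⟨l, hl⟩ := hexp hne
  have hlw : ∀ x : E3, l x = weighted (fun i => l (EuclideanSpace.single i 1)) x := fun x => by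
    rw [weighted_apply]
    conv_lhs => rw [← (EuclideanSpace.basisFun (Fin 3) ℝ).sum_repr x]
    simp [mul_comm]
  set c : Fin 3 → ℝ := fun i => l (EuclideanSpace.single i 1)
  have hFc : ∀ X, IsAllocation X →
      (value a X ∈ F ↔ ∀ i j, 0 < X i j → ∀ k, c k * a k j ≤ c i * a i j) := fun X hX => by
    rw [← isMax_weighted_iff c a hX, hl]
    simp only [Set.mem_ofPred_eq, hlw]
    exact ⟨fun h => h.2, fun h => ⟨⟨X, hX, rfl⟩, h⟩⟩
  obtain ⟨X, hX, hXc⟩ := exists_full_argmax c a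
  have hXF : value a X ∈ F := (hFc X hX).2 fun i j h => (hXc i j).1 h
  -- Pareto optimality depends only on the value, so it passes from the given representative `Y` to
  -- `X`.
  have hPO : IsParetoOptimal a X := by
    obtain ⟨Y, hY, hXY⟩ := hpar hXF
    refine ⟨hX, ?_⟩
    rw [hXY]
    exact hY.2
  obtain ⟨w, hw, hwX⟩ := hPO.exists_weights ha
  have hβ : normalize (fun i => 1 / w i) ∈ openRNS :=
    normalize_mem_openRNS fun i => one_div_pos.2 (hw i)
  have hsub : F ⊆ faceAt a (normalize fun i => 1 / w i) := by
    intro x hx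
    have hx' := hx
    rw [hl] at hx'
    obtain ⟨Y, hY, rfl⟩ := hx'.1
    rw [value_mem_faceAt_iff ha hβ hY]
    refine ⟨hY, fun i j hij => ?_⟩
    rw [mem_claimants_normalize ha hw]
    exact hwX i j ((hXc i j).2 ((hFc Y hY).1 hx i j hij))
  refine ⟨_, hβ, hsub.antisymm fun x hx => ?_⟩
  have hspan := vectorSpan_faceAt hβ hsub hdim
  -- The functional `l` is constant on `F`, hence vanishes on the plane of directions shared with
  -- `faceAt`; it is therefore constant on the larger face too.
  have hlker : vectorSpan ℝ F ≤ LinearMap.ker l.toLinearMap := by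
    rw [vectorSpan_def, Submodule.span_le]
    rintro _ ⟨x, hx, y, hy, rfl⟩
    rw [hl] at hx hy
    simp only [vsub_eq_sub, SetLike.mem_coe, LinearMap.mem_ker, map_sub]
    exact sub_eq_zero.2 (le_antisymm (hy.2 x hx.1) (hx.2 y hy.1))
  obtain ⟨y, hy⟩ := hne
  have hxy : x -ᵥ y ∈ vectorSpan ℝ F := by
    rw [hspan]
    exact vectorSpan_faceAt_le (vsub_mem_vectorSpan ℝ hx (hsub hy))
  have h0 : l x = l y := by
    have := hlker hxy
    simp only [vsub_eq_sub, LinearMap.mem_ker, map_sub] at this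
    exact sub_eq_zero.1 this
  rw [hl] at hy ⊢
  refine ⟨hx.1, fun z hz => ?_⟩
  rw [h0]
  exact hy.2 z hz

/-- A two dimensional face needs an item at `β`, or items on two disputing segments. -/
theorem exists_contested_of_finrank {a : Evaluation m} (ha : ∀ i j, 0 < a i j) {β : E3}
    (hβ : β ∈ openRNS) (h2 : Module.finrank ℝ (vectorSpan ℝ (faceAt a β)) = 2) (h : Fin 3) :
    ∃ j, h ∈ claimants a β j ∧ ¬ ∃! i, i ∈ claimants a β j := by
  by_contra! hcon
  have hspan := vectorSpan_faceAt hβ subset_rfl h2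
  have hconst : ∀ X Y, FollowsPAR a β X → FollowsPAR a β Y → ∀ j, X h j = Y h j := by
    have hone : ∀ X, FollowsPAR a β X → ∀ j, h ∈ claimants a β j → X h j = 1 := by
      intro X hX j hj
      obtain ⟨i, hi, hu⟩ := hcon j hj
      rw [← hX.1.2 j, eq_comm]
      refine Finset.sum_eq_single h (fun k _ hk => hX.eq_zero fun hk' => hk ?_) (by simp)
      rw [hu k hk', hu h hj]
    intro X Y hX hY j
    by_cases hj : h ∈ claimants a β j
    · rw [hone X hX j hj, hone Y hY j hj]
    · rw [hX.eq_zero hj, hY.eq_zero hj]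
  have hker : vectorSpan ℝ (faceAt a β) ≤
      LinearMap.ker (weighted (Pi.single h 1)) := by
    rw [vectorSpan_def, Submodule.span_le]
    rintro _ ⟨x, hx, y, hy, rfl⟩
    obtain ⟨X, hX, rfl⟩ := (mem_faceAt_iff ha hβ).1 hx
    obtain ⟨Y, hY, rfl⟩ := (mem_faceAt_iff ha hβ).1 hy
    simp only [vsub_eq_sub, SetLike.mem_coe, LinearMap.mem_ker, map_sub, weighted_apply,
      value_apply]
    simp only [Pi.single_apply, ite_mul, one_mul, zero_mul, Finset.sum_ite_eq', Finset.mem_univ,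
      if_true, hconst X Y hX hY, sub_self]
  -- If player `h` had no contested item, the coordinate `h` would be constant on the face, yet the
  -- exchange between `h` and `k` changes it.
  obtain ⟨k, hk⟩ : ∃ k : Fin 3, k ≠ h := exists_ne h
  have := hker (hspan ▸ exchange_mem_ker hβ h k)
  rw [LinearMap.mem_ker, map_sub, weighted_single, weighted_single] at this
  simp only [Pi.single_apply, if_true, if_neg hk] at this
  have := hβ.1 h
  linarith

end

section

variable {m n : ℕ}

/-! ### Configurations in terms of the claimants of the items -/

theorem not_existsUnique_univ : ¬ ∃! i : Fin 3, i ∈ (Set.univ : Set (Fin 3)) := by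
  rintro ⟨i, -, hu⟩
  obtain ⟨k, hk⟩ := exists_ne i
  exact hk (hu k (Set.mem_univ k))

theorem not_existsUnique_compl (h : Fin 3) : ¬ ∃! i : Fin 3, i ∈ ({h}ᶜ : Set (Fin 3)) := by
  rintro ⟨i, -, hu⟩
  obtain ⟨k, hk, hki⟩ := exists_third h i
  exact hki (hu k hk)

theorem compl_singleton_ne_univ (h : Fin 3) : ({h}ᶜ : Set (Fin 3)) ≠ Set.univ := fun e =>
  (e ▸ Set.mem_univ h : h ∈ ({h}ᶜ : Set (Fin 3))) rfl

theorem compl_singleton_injective {h h' : Fin 3} (e : ({h}ᶜ : Set (Fin 3)) = {h'}ᶜ) : h = h' :=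
  Set.singleton_injective (compl_injective e)

/-- A configuration described by the sets of players that can get the items. -/
def Configuration.OccursFor (cl : Fin m → Set (Fin 3)) : Configuration m → Prop
  | .f1 j => cl j = Set.univ ∧ ∀ q, q ≠ j → ∃! i, i ∈ cl q
  | .f2 j k => (∃ h h', h ≠ h' ∧ cl j = {h}ᶜ ∧ cl k = {h'}ᶜ) ∧
      ∀ q, q ≠ j → q ≠ k → ∃! i, i ∈ cl q
  | .f3 j k l => (∃ h h' h'', h ≠ h' ∧ h ≠ h'' ∧ h' ≠ h'' ∧
        cl j = {h}ᶜ ∧ cl k = {h'}ᶜ ∧ cl l = {h''}ᶜ) ∧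
      ∀ q, q ≠ j → q ≠ k → q ≠ l → ∃! i, i ∈ cl q
  | .f4 j k => cl j = Set.univ ∧ (∃ h, cl k = {h}ᶜ) ∧
      ∀ q, q ≠ j → q ≠ k → ∃! i, i ∈ cl q
  | .f5 j k r => (∃ h h', h ≠ h' ∧ cl j = {h}ᶜ ∧ cl k = {h'}ᶜ) ∧ cl r = Set.univ ∧
      ∀ q, q ≠ j → q ≠ k → q ≠ r → ∃! i, i ∈ cl q
  | .f6 j k l r => (∃ h h' h'', h ≠ h' ∧ h ≠ h'' ∧ h' ≠ h'' ∧
        cl j = {h}ᶜ ∧ cl k = {h'}ᶜ ∧ cl l = {h''}ᶜ) ∧ cl r = Set.univ ∧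
      ∀ q, q ≠ j → q ≠ k → q ≠ l → q ≠ r → ∃! i, i ∈ cl q

theorem sIndependent_pair_iff {a : Evaluation m} (ha : ∀ i j, 0 < a i j) {β : E3}
    (hβ : β ∈ openRNS) (j k : Fin m) :
    (SIndependent a j k ∧ β ∈ supportingSegments a j ∧ β ∈ supportingSegments a k) ↔
      ∃ h h', h ≠ h' ∧ claimants a β j = {h}ᶜ ∧ claimants a β k = {h'}ᶜ := by
  constructor
  · rintro ⟨h1, h2, h3⟩
    exact claimants_of_sIndependent ha hβ h1 h2 h3
  · rintro ⟨h, h', hne, hj, hk⟩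
    exact ⟨sIndependent_of_claimants ha hβ hne hj hk,
      mem_supportingSegments_of_claimants ha hβ hj, mem_supportingSegments_of_claimants ha hβ hk⟩

theorem sIndependent_triple_iff {a : Evaluation m} (ha : ∀ i j, 0 < a i j) {β : E3}
    (hβ : β ∈ openRNS) (j k l : Fin m) :
    (SIndependent a j k ∧ SIndependent a j l ∧ SIndependent a k l ∧
      β ∈ supportingSegments a j ∧ β ∈ supportingSegments a k ∧ β ∈ supportingSegments a l) ↔
      ∃ h h' h'', h ≠ h' ∧ h ≠ h'' ∧ h' ≠ h'' ∧
        claimants a β j = {h}ᶜ ∧ claimants a β k = {h'}ᶜ ∧ claimants a β l = {h''}ᶜ := by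
  constructor
  · rintro ⟨h1, h2, h3, h4, h5, h6⟩
    obtain ⟨x, y, hxy, hj, hk⟩ := claimants_of_sIndependent ha hβ h1 h4 h5
    obtain ⟨x', z, hxz, hj', hl⟩ := claimants_of_sIndependent ha hβ h2 h4 h6
    obtain ⟨y', z', hyz, hk', hl'⟩ := claimants_of_sIndependent ha hβ h3 h5 h6
    obtain rfl := compl_singleton_injective (hj.symm.trans hj')
    obtain rfl := compl_singleton_injective (hk.symm.trans hk')
    obtain rfl := compl_singleton_injective (hl.symm.trans hl')
    exact ⟨x, y, z, hxy, hxz, hyz, hj, hk, hl⟩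
  · rintro ⟨x, y, z, hxy, hxz, hyz, hj, hk, hl⟩
    exact ⟨sIndependent_of_claimants ha hβ hxy hj hk, sIndependent_of_claimants ha hβ hxz hj hl,
      sIndependent_of_claimants ha hβ hyz hk hl, mem_supportingSegments_of_claimants ha hβ hj,
      mem_supportingSegments_of_claimants ha hβ hk, mem_supportingSegments_of_claimants ha hβ hl⟩

theorem occurs_iff {a : Evaluation m} (ha : ∀ i j, 0 < a i j) {β : E3}
    (hβ : β ∈ openRNS) (c : Configuration m) :
    c.Occurs a β ↔ c.OccursFor (claimants a β) := by
  cases c with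
  | f1 j => simp only [Configuration.Occurs, Configuration.OccursFor, not_contested_iff ha hβ,
      claimants_eq_univ_iff ha hβ]
  | f2 j k =>
    simp only [Configuration.Occurs, Configuration.OccursFor, not_contested_iff ha hβ,
      ← sIndependent_pair_iff ha hβ, and_assoc]
  | f3 j k l =>
    simp only [Configuration.Occurs, Configuration.OccursFor, not_contested_iff ha hβ,
      ← sIndependent_triple_iff ha hβ, and_assoc]
  | f4 j k =>
    simp only [Configuration.Occurs, Configuration.OccursFor, not_contested_iff ha hβ,
      claimants_eq_univ_iff ha hβ, onDisputing_iff ha hβ]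
  | f5 j k h =>
    simp only [Configuration.Occurs, Configuration.OccursFor, not_contested_iff ha hβ,
      ← sIndependent_pair_iff ha hβ, claimants_eq_univ_iff ha hβ, and_assoc]
  | f6 j k l h =>
    simp only [Configuration.Occurs, Configuration.OccursFor, not_contested_iff ha hβ,
      ← sIndependent_triple_iff ha hβ, claimants_eq_univ_iff ha hβ, and_assoc]

/-! ### The type of a point is unique -/

/-- Whether some item is located at `β`. -/
def FaceType.center : FaceType → Prop
  | .f1 => True
  | .f2 => False
  | .f3 => False
  | .f4 => True
  | .f5 => True
  | .f6 => True

/-- The number of disputing segments that carry items. -/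
def FaceType.segments : FaceType → ℕ
  | .f1 => 0
  | .f2 => 2
  | .f3 => 3
  | .f4 => 1
  | .f5 => 2
  | .f6 => 3

theorem FaceType.ext_signature {s t : FaceType} (h1 : s.center ↔ t.center)
    (h2 : s.segments = t.segments) : s = t := by
  cases s <;> cases t <;> simp_all [FaceType.center, FaceType.segments]

/-- These two data are invariant under merging and separate the six types, which gives uniqueness of
the type. -/
theorem Configuration.OccursFor.signature {cl : Fin m → Set (Fin 3)} {c : Configuration m}
    (hc : c.OccursFor cl) :
    ((∃ j, cl j = Set.univ) ↔ c.type.center) ∧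
      {h | ∃ j, cl j = {h}ᶜ}.ncard = c.type.segments := by
  have hu : ∀ q, cl q = Set.univ → ¬ ∃! i, i ∈ cl q := fun q h => h ▸ not_existsUnique_univ
  have hs : ∀ q h, cl q = {h}ᶜ → ¬ ∃! i, i ∈ cl q := fun q h e => e ▸ not_existsUnique_compl h
  have hne : ∀ {q h}, cl q = {h}ᶜ → cl q ≠ Set.univ := fun e => e ▸ compl_singleton_ne_univ _
  have hinj : ∀ {q h h'}, cl q = {h}ᶜ → cl q = {h'}ᶜ → h = h' := fun e e' =>
    compl_singleton_injective (e.symm.trans e')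
  cases c with
  | f1 j =>
    obtain ⟨hj, hr⟩ := hc
    refine ⟨iff_of_true ⟨j, hj⟩ trivial, ?_⟩
    rw [FaceType.segments.eq_def, Configuration.type, Set.ncard_eq_zero]
    ext h
    simp only [Set.mem_ofPred_eq, Set.mem_empty_iff_false, iff_false, not_exists]
    intro q hq
    by_cases h1 : q = j
    · exact hne (h1 ▸ hq) hj
    · exact hs q h hq (hr q h1)
  | f2 j k =>
    obtain ⟨⟨h, h', hhh, hj, hk⟩, hr⟩ := hc
    have hq : ∀ q, ¬ (∃! i, i ∈ cl q) → q = j ∨ q = k := fun q hq => by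
      by_contra! hcon; exact hq (hr q hcon.1 hcon.2)
    refine ⟨iff_of_false ?_ not_false, Set.ncard_eq_two.2 ⟨h, h', hhh, ?_⟩⟩
    · rintro ⟨q, e⟩
      rcases hq q (hu q e) with rfl | rfl
      exacts [hne hj e, hne hk e]
    · ext x
      constructor
      · rintro ⟨q, e⟩
        rcases hq q (hs q x e) with rfl | rfl
        exacts [Or.inl (hinj e hj), Or.inr (hinj e hk)]
      · rintro (rfl | rfl)
        exacts [⟨j, hj⟩, ⟨k, hk⟩]
  | f3 j k l =>
    obtain ⟨⟨h, h', h'', h1, h2, h3, hj, hk, hl⟩, hr⟩ := hc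
    have hq : ∀ q, ¬ (∃! i, i ∈ cl q) → q = j ∨ q = k ∨ q = l := fun q hq => by
      by_contra! hcon; exact hq (hr q hcon.1 hcon.2.1 hcon.2.2)
    refine ⟨iff_of_false ?_ not_false, Set.ncard_eq_three.2 ⟨h, h', h'', h1, h2, h3, ?_⟩⟩
    · rintro ⟨q, e⟩
      rcases hq q (hu q e) with rfl | rfl | rfl
      exacts [hne hj e, hne hk e, hne hl e]
    · ext x
      constructor
      · rintro ⟨q, e⟩
        rcases hq q (hs q x e) with rfl | rfl | rfl
        exacts [Or.inl (hinj e hj), Or.inr (Or.inl (hinj e hk)), Or.inr (Or.inr (hinj e hl))]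
      · rintro (rfl | rfl | rfl)
        exacts [⟨j, hj⟩, ⟨k, hk⟩, ⟨l, hl⟩]
  | f4 j k =>
    obtain ⟨hj, ⟨h, hk⟩, hr⟩ := hc
    refine ⟨iff_of_true ⟨j, hj⟩ trivial, Set.ncard_eq_one.2 ⟨h, ?_⟩⟩
    ext x
    constructor
    · rintro ⟨q, e⟩
      by_cases e1 : q = j
      · exact absurd hj (hne (e1 ▸ e))
      by_cases e2 : q = k
      · exact hinj (e2 ▸ e) hk
      · exact absurd (hr q e1 e2) (hs q x e)
    · rintro rfl
      exact ⟨k, hk⟩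
  | f5 j k r =>
    obtain ⟨⟨h, h', hhh, hj, hk⟩, hr, hq⟩ := hc
    refine ⟨iff_of_true ⟨r, hr⟩ trivial, Set.ncard_eq_two.2 ⟨h, h', hhh, ?_⟩⟩
    ext x
    constructor
    · rintro ⟨q, e⟩
      by_cases e1 : q = j
      · exact Or.inl (hinj (e1 ▸ e) hj)
      by_cases e2 : q = k
      · exact Or.inr (hinj (e2 ▸ e) hk)
      by_cases e3 : q = r
      · exact absurd hr (hne (e3 ▸ e))
      · exact absurd (hq q e1 e2 e3) (hs q x e)
    · rintro (rfl | rfl)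
      exacts [⟨j, hj⟩, ⟨k, hk⟩]
  | f6 j k l r =>
    obtain ⟨⟨h, h', h'', h1, h2, h3, hj, hk, hl⟩, hr, hq⟩ := hc
    refine ⟨iff_of_true ⟨r, hr⟩ trivial, Set.ncard_eq_three.2 ⟨h, h', h'', h1, h2, h3, ?_⟩⟩
    ext x
    constructor
    · rintro ⟨q, e⟩
      by_cases e1 : q = j
      · exact Or.inl (hinj (e1 ▸ e) hj)
      by_cases e2 : q = k
      · exact Or.inr (Or.inl (hinj (e2 ▸ e) hk))
      by_cases e3 : q = l
      · exact Or.inr (Or.inr (hinj (e3 ▸ e) hl))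
      by_cases e4 : q = r
      · exact absurd hr (hne (e4 ▸ e))
      · exact absurd (hq q e1 e2 e3 e4) (hs q x e)
    · rintro (rfl | rfl | rfl)
      exacts [⟨j, hj⟩, ⟨k, hk⟩, ⟨l, hl⟩]

theorem HasType.signature {a : Evaluation m} (ha : ∀ i j, 0 < a i j) {β : E3}
    (hβ : β ∈ openRNS) {t : FaceType} (h : HasType a β t) :
    ((∃ j, claimants a β j = Set.univ) ↔ t.center) ∧
      {h | ∃ j, claimants a β j = {h}ᶜ}.ncard = t.segments := by
  obtain ⟨n, f, c, hf, rfl, hc⟩ := h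
  have hcm := claimants_merge ha hβ hf.1 fun j k => hf.claimants_eq ha hβ
  have := ((occurs_iff (merge_pos ha hf.1) hβ c).1 hc).signature
  simpa only [hf.1.exists, hcm] using this

theorem HasType.unique {a : Evaluation m} (ha : ∀ i j, 0 < a i j) {β : E3}
    (hβ : β ∈ openRNS) {s t : FaceType} (hs : HasType a β s) (ht : HasType a β t) : s = t :=
  FaceType.ext_signature ((hs.signature ha hβ).1.symm.trans (ht.signature ha hβ).1)
    ((hs.signature ha hβ).2.symm.trans (ht.signature ha hβ).2)

/-! ### Existence of a type -/

/-- All the items on a disputing segment, and all the items at `β`, can be merged. -/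
theorem exists_full_merging {a : Evaluation m} (ha : ∀ i j, 0 < a i j) {β : E3}
    (hβ : β ∈ openRNS) : ∃ (n : ℕ) (f : Fin m → Fin n), IsMerging a β f ∧
      ∀ q r : Fin n, (¬ ∃! i, i ∈ claimants (merge a f) β q) →
        claimants (merge a f) β q = claimants (merge a f) β r → q = r := by
  classical
  -- Contested items are keyed by their claimants, uncontested ones by themselves; the fibres of `κ`
  -- are the classes to be merged.
  let κ : Fin m → Set (Fin 3) ⊕ Fin m := fun j =>
    if ∃! i, i ∈ claimants a β j then Sum.inr j else Sum.inl (claimants a β j)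
  have hκ : ∀ j k, κ j = κ k → j ≠ k →
      (¬ ∃! i, i ∈ claimants a β j) ∧ claimants a β j = claimants a β k := by
    intro j k h hne
    simp only [κ] at h
    split_ifs at h with h1 h2 h3
    · exact absurd (Sum.inr_injective h) hne
    · exact ⟨h1, Sum.inl_injective h⟩
  let e := Finite.equivFin (Set.range κ)
  let f : Fin m → Fin (Nat.card (Set.range κ)) := fun j => e ⟨κ j, j, rfl⟩
  have hfκ : ∀ j k, f j = f k ↔ κ j = κ k := fun j k =>
    e.injective.eq_iff.trans Subtype.ext_iff
  have hsurj : Function.Surjective f := by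
    intro l
    obtain ⟨j, hj⟩ := (e.symm l).2
    refine ⟨j, e.symm.injective ?_⟩
    simp only [f, Equiv.symm_apply_apply]
    exact Subtype.ext hj
  have hmerge : IsMerging a β f := by
    refine ⟨hsurj, fun j k hne h => ?_⟩
    obtain ⟨h1, h2⟩ := hκ j k ((hfκ j k).1 h) hne
    rcases set_fin_three_cases _ (claimants_nonempty ha hβ j) with h3 | ⟨x, h3⟩ | h3
    · exact Or.inl ⟨(claimants_eq_univ_iff ha hβ j).1 h3,
        (claimants_eq_univ_iff ha hβ k).1 (h2 ▸ h3)⟩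
    · exact Or.inr ⟨x, (claimants_eq_compl_iff ha hβ j x).1 h3,
        (claimants_eq_compl_iff ha hβ k x).1 (h2 ▸ h3)⟩
    · exact absurd h3 h1
  have hcm := claimants_merge ha hβ hsurj fun j k => hmerge.claimants_eq ha hβ
  refine ⟨_, f, hmerge, fun q r hq hqr => ?_⟩
  obtain ⟨j, rfl⟩ := hsurj q
  obtain ⟨k, rfl⟩ := hsurj r
  rw [hcm, hcm] at hqr
  rw [hcm] at hq
  rw [hfκ]
  have hk := hqr ▸ hq
  simp only [κ]
  rw [if_neg hq, if_neg hk, hqr]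

theorem finset_fin_three_cases' : ∀ t : Finset (Fin 3),
    t = ∅ ∨ (∃ h, t = {h}) ∨ (∃ h h', h ≠ h' ∧ t = {h, h'}) ∨
      ∃ h h' h'', h ≠ h' ∧ h ≠ h'' ∧ h' ≠ h'' ∧ t = {h, h', h''} := by decide

/-- The fully merged problem has at most one item at `β` and one per disputing segment, so the type
is read off from `occ`, the set of segments that carry an item. -/
theorem exists_hasType {a : Evaluation m} (ha : ∀ i j, 0 < a i j) {β : E3}
    (hβ : β ∈ openRNS) (h2 : Module.finrank ℝ (vectorSpan ℝ (faceAt a β)) = 2) :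
    ∃ t, HasType a β t := by
  classical
  obtain ⟨n, f, hf, huniq⟩ := exists_full_merging ha hβ
  have hb := merge_pos ha hf.1
  rw [← faceAt_merge ha hβ hf.1 fun j k => hf.claimants_eq ha hβ] at h2
  suffices ∃ c : Configuration n, c.OccursFor (claimants (merge a f) β) by
    obtain ⟨c, hc⟩ := this
    exact ⟨c.type, n, f, c, hf, rfl, (occurs_iff hb hβ c).2 hc⟩
  have hcon := exists_contested_of_finrank hb hβ h2
  have hcases := fun q => set_fin_three_cases _ (claimants_nonempty hb hβ q)
  generalize claimants (merge a f) β = cl at *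
  have hu : ∀ q r, cl q = Set.univ → cl r = Set.univ → q = r := fun q r h h' =>
    huniq q r (h ▸ not_existsUnique_univ) (h.trans h'.symm)
  have hs : ∀ {q r h}, cl q = {h}ᶜ → cl r = {h}ᶜ → q = r := fun {q r h} e e' =>
    huniq q r (e ▸ not_existsUnique_compl h) (e.trans e'.symm)
  let occ : Finset (Fin 3) := {h | ∃ j, cl j = {h}ᶜ}
  have hocc : ∀ h, h ∈ occ ↔ ∃ j, cl j = {h}ᶜ := fun h => by simp [occ]
  have hrest : ∀ q, cl q ≠ Set.univ → (∀ h ∈ occ, cl q ≠ {h}ᶜ) → ∃! i, i ∈ cl q := by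
    intro q h1 h3
    rcases hcases q with h | ⟨h, e⟩ | h
    · exact absurd h h1
    · exact absurd e (h3 h ((hocc h).2 ⟨q, e⟩))
    · exact h
  by_cases hc : ∃ r, cl r = Set.univ
  · obtain ⟨r, hr⟩ := hc
    rcases finset_fin_three_cases' occ with ho | ⟨h, ho⟩ | ⟨h, h', hne, ho⟩ |
      ⟨h, h', h'', h12, h13, h23, ho⟩
    · exact ⟨.f1 r, hr, fun q hq => hrest q (fun e => hq (hu q r e hr)) (by simp [ho])⟩
    · obtain ⟨j, hj⟩ := (hocc h).1 (by simp [ho])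
      refine ⟨.f4 r j, hr, ⟨h, hj⟩, fun q hq1 hq2 => hrest q (fun e => hq1 (hu q r e hr)) ?_⟩
      simp only [ho, Finset.mem_singleton, forall_eq]
      exact fun e => hq2 (hs e hj)
    · obtain ⟨j, hj⟩ := (hocc h).1 (by simp [ho])
      obtain ⟨k, hk⟩ := (hocc h').1 (by simp [ho])
      refine ⟨.f5 j k r, ⟨h, h', hne, hj, hk⟩, hr, fun q hq1 hq2 hq3 =>
        hrest q (fun e => hq3 (hu q r e hr)) ?_⟩
      simp only [ho, Finset.mem_insert, Finset.mem_singleton, forall_eq_or_imp, forall_eq]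
      exact ⟨fun e => hq1 (hs e hj), fun e => hq2 (hs e hk)⟩
    · obtain ⟨j, hj⟩ := (hocc h).1 (by simp [ho])
      obtain ⟨k, hk⟩ := (hocc h').1 (by simp [ho])
      obtain ⟨l, hl⟩ := (hocc h'').1 (by simp [ho])
      refine ⟨.f6 j k l r, ⟨h, h', h'', h12, h13, h23, hj, hk, hl⟩, hr, fun q hq1 hq2 hq3 hq4 =>
        hrest q (fun e => hq4 (hu q r e hr)) ?_⟩
      simp only [ho, Finset.mem_insert, Finset.mem_singleton, forall_eq_or_imp, forall_eq]
      exact ⟨fun e => hq1 (hs e hj), fun e => hq2 (hs e hk), fun e => hq3 (hs e hl)⟩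
  · push Not at hc
    rcases finset_fin_three_cases' occ with ho | ⟨h, ho⟩ | ⟨h, h', hne, ho⟩ |
      ⟨h, h', h'', h12, h13, h23, ho⟩
    · obtain ⟨j, -, hj⟩ := hcon 0
      exact absurd (hrest j (hc j) (by simp [ho])) hj
    -- With no item at `β` and only the segment opposite to `h` occupied, `h` would take part in no
    -- dispute.
    · obtain ⟨j, hhj, hj⟩ := hcon h
      refine absurd (hrest j (hc j) ?_) hj
      simp only [ho, Finset.mem_singleton, forall_eq]
      exact fun e => (e ▸ hhj : h ∈ ({h}ᶜ : Set (Fin 3))) rfl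
    · obtain ⟨j, hj⟩ := (hocc h).1 (by simp [ho])
      obtain ⟨k, hk⟩ := (hocc h').1 (by simp [ho])
      refine ⟨.f2 j k, ⟨h, h', hne, hj, hk⟩, fun q hq1 hq2 => hrest q (hc q) ?_⟩
      simp only [ho, Finset.mem_insert, Finset.mem_singleton, forall_eq_or_imp, forall_eq]
      exact ⟨fun e => hq1 (hs e hj), fun e => hq2 (hs e hk)⟩
    · obtain ⟨j, hj⟩ := (hocc h).1 (by simp [ho])
      obtain ⟨k, hk⟩ := (hocc h').1 (by simp [ho])
      obtain ⟨l, hl⟩ := (hocc h'').1 (by simp [ho])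
      refine ⟨.f3 j k l, ⟨h, h', h'', h12, h13, h23, hj, hk, hl⟩, fun q hq1 hq2 hq3 =>
        hrest q (hc q) ?_⟩
      simp only [ho, Finset.mem_insert, Finset.mem_singleton, forall_eq_or_imp, forall_eq]
      exact ⟨fun e => hq1 (hs e hj), fun e => hq2 (hs e hk), fun e => hq3 (hs e hl)⟩

end

section

variable {m n : ℕ}

/-! ### Polygons given by supporting functionals -/

/-- The set of points that lie in `S` or strictly below the level `c` is convex and contains all `v
k`, hence the whole hull. So `φ ≤ c` there, with equality exactly on `S`. -/
theorem isExtreme_convexHull_of_le {ι : Type*} {v : ι → E3} {φ : E3 →ₗ[ℝ] ℝ} {c : ℝ}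
    {S : Set E3} (hS : Convex ℝ S) (hne : S ⊆ convexHull ℝ (Set.range v)) (hφ : ∀ x ∈ S, φ x = c)
    (hv : ∀ k, v k ∈ S ∨ φ (v k) < c) : IsExtreme ℝ (convexHull ℝ (Set.range v)) S := by
  have hconv : Convex ℝ {x | x ∈ S ∨ φ x < c} := by
    have hle : ∀ x, x ∈ S ∨ φ x < c → φ x ≤ c := by
      rintro x (h | h)
      exacts [(hφ x h).le, h.le]
    rw [convex_iff_forall_pos]
    intro x hx y hy s t hs ht hst
    have h1 := mul_le_mul_of_nonneg_left (hle x hx) hs.le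
    have h2 := mul_le_mul_of_nonneg_left (hle y hy) ht.le
    have h3 : c = s * c + t * c := by rw [← add_mul, hst, one_mul]
    rcases hx with hx | hx
    · rcases hy with hy | hy
      · exact Or.inl (hS hx hy hs.le ht.le hst)
      · right
        have := mul_lt_mul_of_pos_left hy ht
        simp only [map_add, map_smul, smul_eq_mul]
        linarith
    · right
      have := mul_lt_mul_of_pos_left hx hs
      simp only [map_add, map_smul, smul_eq_mul]
      linarith
  have hall : ∀ x ∈ convexHull ℝ (Set.range v), x ∈ S ∨ φ x < c := by
    refine fun x hx => convexHull_min ?_ hconv hx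
    rintro _ ⟨k, rfl⟩
    exact hv k
  have hle : ∀ x ∈ convexHull ℝ (Set.range v), φ x ≤ c := fun x hx => by
    rcases hall x hx with h | h
    exacts [(hφ x h).le, h.le]
  refine ⟨hne, fun x hx y hy z hz hxyz => ?_⟩
  refine (hall x hx).resolve_right fun hlt => ?_
  obtain ⟨s, t, hs, ht, hst, rfl⟩ := hxyz
  have h0 := hφ _ hz
  simp only [map_add, map_smul, smul_eq_mul] at h0
  have h1 := mul_lt_mul_of_pos_left hlt hs
  have h2 := mul_le_mul_of_nonneg_left (hle y hy) ht.le
  have h3 : c = s * c + t * c := by rw [← add_mul, hst, one_mul]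
  linarith

/-- Points in a plane form a convex polygon when for each pair of consecutive points there is a
linear functional that is maximal exactly at these two points. -/
theorem isPolygon_of_functionals {n : ℕ} [NeZero n]
    (hn : ∀ i : Fin n, i + 1 ≠ i ∧ i - 1 ≠ i ∧ i + 1 ≠ i - 1) {F : Set E3} {v : Fin n → E3}
    (φ : Fin n → E3 →ₗ[ℝ] ℝ) (hF : F = convexHull ℝ (Set.range v))
    (h1 : ∀ i, φ i (v (i + 1)) = φ i (v i))
    (h2 : ∀ i k, k ≠ i → k ≠ i + 1 → φ i (v k) < φ i (v i))
    (hplane : Module.finrank ℝ (vectorSpan ℝ F) ≤ 2) : IsPolygon n F v := by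
  have hle : ∀ i k, φ i (v k) ≤ φ i (v i) := fun i k => by
    by_cases hk : k = i
    · rw [hk]
    by_cases hk' : k = i + 1
    · rw [hk', h1]
    · exact (h2 i k hk hk').le
  -- The functionals of the two sides meeting at `v i` add up to one that is maximal at `v i` only.
  have hlt : ∀ i k, k ≠ i → (φ i + φ (i - 1)) (v k) < (φ i + φ (i - 1)) (v i) := by
    intro i k hk
    have h3 : φ (i - 1) (v i) = φ (i - 1) (v (i - 1)) := by
      have := h1 (i - 1)
      rwa [sub_add_cancel] at this
    have h4 := hle (i - 1) k
    have h5 := hle i k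
    simp only [LinearMap.add_apply]
    by_cases hk' : k = i + 1
    · have := h2 (i - 1) k (hk' ▸ (hn i).2.2) (by rwa [sub_add_cancel])
      linarith
    · have := h2 i k hk hk'
      linarith
  have hext : ∀ i, v i ∈ Set.extremePoints ℝ (convexHull ℝ (Set.range v)) := fun i => by
    rw [← isExtreme_singleton]
    refine isExtreme_convexHull_of_le (φ := φ i + φ (i - 1)) (convex_singleton _)
      (Set.singleton_subset_iff.2 (subset_convexHull ℝ _ ⟨i, rfl⟩))
      (fun x hx => by rw [Set.mem_singleton_iff.1 hx]) fun k => ?_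
    by_cases hk : k = i
    · exact Or.inl (hk ▸ rfl)
    · exact Or.inr (hlt i k hk)
  refine ⟨fun i k h => ?_, hF, ?_, fun i => ?_, le_antisymm hplane ?_⟩
  · by_contra hne
    exact (hlt i k (Ne.symm hne)).ne (by rw [h])
  · rw [hF]
    refine (extremePoints_convexHull_subset).antisymm ?_
    rintro _ ⟨i, rfl⟩
    exact hext i
  · rw [hF]
    refine isExtreme_convexHull_of_le (φ := φ i) (c := φ i (v i)) (convex_segment _ _)
      ((convex_convexHull ℝ _).segment_subset (subset_convexHull ℝ _ ⟨_, rfl⟩)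
        (subset_convexHull ℝ _ ⟨_, rfl⟩)) ?_ fun k => ?_
    · rintro x ⟨s, t, -, -, hst, rfl⟩
      simp only [map_add, map_smul, smul_eq_mul, h1, ← add_mul, hst, one_mul]
    · by_cases hk : k = i
      · exact Or.inl (hk ▸ left_mem_segment ℝ _ _)
      by_cases hk' : k = i + 1
      · exact Or.inl (hk' ▸ right_mem_segment ℝ _ _)
      · exact Or.inr (h2 i k hk hk')
  · have hmem : ∀ i, v i ∈ F := fun i => hF ▸ subset_convexHull ℝ _ ⟨i, rfl⟩
    obtain ⟨i⟩ : Nonempty (Fin n) := ⟨0⟩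
    have hli : LinearIndependent ℝ ![v (i + 1) - v i, v (i - 1) - v i] := by
      rw [LinearIndependent.pair_iff]
      intro s t hst
      have e1 := congrArg (φ i) hst
      simp only [map_add, map_smul, map_sub, smul_eq_mul, h1, sub_self, mul_zero, zero_add,
        map_zero] at e1
      have e2 := h2 i (i - 1) (hn i).2.1 (hn i).2.2.symm
      have ht : t = 0 := by
        rcases mul_eq_zero.1 e1 with h | h
        · exact h
        · linarith
      have e3 := congrArg (φ (i - 1)) hst
      have e4 := h2 (i - 1) (i + 1) (hn i).2.2 (by rw [sub_add_cancel]; exact (hn i).1)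
      have e5 := h1 (i - 1)
      rw [sub_add_cancel] at e5
      rw [ht, zero_smul, add_zero, map_smul, map_sub, map_zero, smul_eq_mul, e5] at e3
      refine ⟨?_, ht⟩
      rcases mul_eq_zero.1 e3 with h | h
      · exact h
      · linarith
    have hspan : Submodule.span ℝ (Set.range ![v (i + 1) - v i, v (i - 1) - v i]) ≤
        vectorSpan ℝ F := by
      rw [Submodule.span_le]
      rintro _ ⟨r, rfl⟩
      fin_cases r
      exacts [vsub_mem_vectorSpan ℝ (hmem _) (hmem _), vsub_mem_vectorSpan ℝ (hmem _) (hmem _)]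
    have := Submodule.finrank_mono hspan
    rwa [finrank_span_eq_card hli, Fintype.card_fin] at this

/-! ### Hexagons cut out by bounds on the coordinates -/

theorem Convex.lineMap_mem_of_le {E : Type*} [AddCommGroup E] [Module ℝ E] {K : Set E}
    (hK : Convex ℝ K) (o d : E) {s₀ s s₁ : ℝ} (h0 : o + s₀ • d ∈ K) (h1 : o + s₁ • d ∈ K)
    (hs0 : s₀ ≤ s) (hs1 : s ≤ s₁) : o + s • d ∈ K := by
  have h : Convex ℝ {r : ℝ | o + r • d ∈ K} := by
    rintro x hx y hy a b ha hb hab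
    have := hK hx hy ha hb hab
    have e : a • (o + x • d) + b • (o + y • d) = o + (a • x + b • y) • d := by
      have : b = 1 - a := by linarith
      subst this
      simp only [smul_add, smul_smul, smul_eq_mul, add_smul, sub_smul, one_smul]
      abel
    rwa [e] at this
  exact h.ordConnected.out h0 h1 ⟨hs0, hs1⟩

/-- Vectors with sum `S` and with coordinates between `0` and the given upper bounds. -/
def hexagon (ub : Fin 3 → ℝ) (S : ℝ) : Set (Fin 3 → ℝ) :=
  {y | (∀ l, 0 ≤ y l ∧ y l ≤ ub l) ∧ ∑ l, y l = S}

/-- The vertex of the hexagon in which first the coordinate `l₁` and then the coordinate `l₂`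
is as large as possible. -/
def hexVertex (ub : Fin 3 → ℝ) (S : ℝ) (l₁ l₂ : Fin 3) : Fin 3 → ℝ :=
  fun l => if l = l₁ then ub l₁ else if l = l₂ then S - ub l₁ else 0

theorem sum_eq_of_ne {l l₁ l₂ : Fin 3} (h1 : l₁ ≠ l) (h2 : l₂ ≠ l) (h3 : l₂ ≠ l₁)
    (y : Fin 3 → ℝ) : ∑ x, y x = y l + y l₁ + y l₂ := by
  have key : ∀ l l₁ l₂ : Fin 3, l₁ ≠ l → l₂ ≠ l → l₂ ≠ l₁ → Finset.univ = {l, l₁, l₂} := by decide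
  rw [key l l₁ l₂ h1 h2 h3, Finset.sum_insert (by simp [h1.symm, h2.symm]),
    Finset.sum_insert (by simpa using h3.symm), Finset.sum_singleton, add_assoc]

theorem eq_or_eq_or_eq_of_ne : ∀ l l₁ l₂ : Fin 3, l₁ ≠ l → l₂ ≠ l → l₂ ≠ l₁ →
    ∀ x, x = l ∨ x = l₁ ∨ x = l₂ := by decide

/-- Vectors with the same sum and the same coordinate `l` lie on a line. -/
theorem Convex.mem_of_coordinate {K : Set (Fin 3 → ℝ)} (hK : Convex ℝ K) {l l₁ : Fin 3}
    (h1 : l₁ ≠ l) {y w₀ w₁ : Fin 3 → ℝ} (h0K : w₀ ∈ K) (h1K : w₁ ∈ K)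
    (hs0 : ∑ x, w₀ x = ∑ x, y x) (hs1 : ∑ x, w₁ x = ∑ x, y x) (hl0 : w₀ l = y l)
    (hl1 : w₁ l = y l) (hle0 : w₀ l₁ ≤ y l₁) (hle1 : y l₁ ≤ w₁ l₁) : y ∈ K := by
  obtain ⟨l₂, h2, h3⟩ := exists_third l l₁
  have hd : ∀ z : Fin 3 → ℝ, z l = y l → ∑ x, z x = ∑ x, y x →
      z = (Pi.single l (y l) + Pi.single l₂ (∑ x, y x - y l)) +
        z l₁ • (Pi.single l₁ 1 - Pi.single l₂ 1) := by
    intro z e1 e2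
    rw [sum_eq_of_ne h1 h2 h3 z] at e2
    ext x
    rcases eq_or_eq_or_eq_of_ne l l₁ l₂ h1 h2 h3 x with rfl | rfl | rfl
    · simp [e1, h1.symm, h2.symm]
    · simp [h3.symm, h1]
    · simp [h3, h2]; linarith
  rw [hd _ hl0 hs0] at h0K
  rw [hd _ hl1 hs1] at h1K
  rw [hd y rfl rfl]
  exact Convex.lineMap_mem_of_le hK _ _ h0K h1K hle0 hle1

theorem sum_hexVertex (ub : Fin 3 → ℝ) (S : ℝ) {l₁ l₂ : Fin 3} (h : l₁ ≠ l₂) :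
    ∑ x, hexVertex ub S l₁ l₂ x = S := by
  obtain ⟨l, h1, h2⟩ := exists_third l₁ l₂
  rw [sum_eq_of_ne (l := l) h1.symm h2.symm h.symm]
  simp [hexVertex, h1, h2, h.symm]

/-- Each side lies between two of the listed vertices, and any point lies on a chord along which one
coordinate is constant and whose ends are on sides. -/
theorem hexagon_subset_of_convex {ub : Fin 3 → ℝ} {S : ℝ} {K : Set (Fin 3 → ℝ)}
    (hK : Convex ℝ K) (hv : ∀ l₁ l₂, l₁ ≠ l₂ → hexVertex ub S l₁ l₂ ∈ K) : hexagon ub S ⊆ K := by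
  have hlow : ∀ l y, y ∈ hexagon ub S → y l = 0 → y ∈ K := by
    intro l y hy hl
    obtain ⟨l₁, h1, -⟩ := exists_third l l
    obtain ⟨l₂, h2, h3⟩ := exists_third l l₁
    have hsum := hy.2
    rw [sum_eq_of_ne h1 h2 h3] at hsum
    refine Convex.mem_of_coordinate hK h1 (hv l₂ l₁ h3) (hv l₁ l₂ h3.symm)
      ((sum_hexVertex _ _ h3).trans hy.2.symm) ((sum_hexVertex _ _ h3.symm).trans hy.2.symm)
      ?_ ?_ ?_ ?_
    · simp [hexVertex, hl, h1.symm, h2.symm]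
    · simp [hexVertex, hl, h1.symm, h2.symm]
    · simp only [hexVertex, if_neg h3.symm, if_true]
      linarith [(hy.1 l₂).2]
    · simpa [hexVertex] using (hy.1 l₁).2
  have hup : ∀ l y, y ∈ hexagon ub S → y l = ub l → y ∈ K := by
    intro l y hy hl
    obtain ⟨l₁, h1, -⟩ := exists_third l l
    obtain ⟨l₂, h2, h3⟩ := exists_third l l₁
    have hsum := hy.2
    rw [sum_eq_of_ne h1 h2 h3] at hsum
    refine Convex.mem_of_coordinate hK h1 (hv l l₂ h2.symm) (hv l l₁ h1.symm)
      ((sum_hexVertex _ _ h2.symm).trans hy.2.symm) ((sum_hexVertex _ _ h1.symm).trans hy.2.symm)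
      ?_ ?_ ?_ ?_
    · simp [hexVertex, hl]
    · simp [hexVertex, hl]
    · simpa [hexVertex, h1, h3.symm] using (hy.1 l₁).1
    · simp only [hexVertex, if_neg h1, if_true]
      linarith [(hy.1 l₂).1]
  intro y hy
  have hsum := hy.2
  rw [Fin.sum_univ_three] at hsum
  have b0 := hy.1 0
  have b1 := hy.1 1
  have b2 := hy.1 2
  -- The chord through `y` with fixed coordinate `2`; at its ends one of the bounds for coordinate
  -- `0` or `1` is attained.
  have hmem : ∀ α, max 0 (S - y 2 - ub 1) ≤ α → α ≤ min (ub 0) (S - y 2) →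
      ![α, S - y 2 - α, y 2] ∈ hexagon ub S := by
    intro α h1 h2
    have := max_le_iff.1 h1
    have := le_min_iff.1 h2
    refine ⟨?_, by simp [Fin.sum_univ_three]⟩
    intro l
    fin_cases l <;> simp <;> constructor <;> linarith
  have hle : max 0 (S - y 2 - ub 1) ≤ y 0 := max_le b0.1 (by linarith)
  have hle' : y 0 ≤ min (ub 0) (S - y 2) := le_min b0.2 (by linarith)
  have m0 := hmem _ le_rfl (hle.trans hle')
  have m1 := hmem _ (hle.trans hle') le_rfl
  refine Convex.mem_of_coordinate hK (l := 2) (l₁ := 0) (by decide) (w₀ := _) (w₁ := _) ?_ ?_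
    (m0.2.trans hy.2.symm) (m1.2.trans hy.2.symm) rfl rfl hle hle'
  · rcases max_choice 0 (S - y 2 - ub 1) with h | h
    · exact hlow 0 _ m0 h
    · exact hup 1 _ m0 (by simp [h])
  · rcases min_choice (ub 0) (S - y 2) with h | h
    · exact hup 0 _ m1 h
    · exact hlow 1 _ m1 (by simp [h])

/-! ### Charts of the plane of a face -/

/-- The affine coordinate system with origin `o` and the axes of the players `σ l`, scaled
by `β`. -/
def chart (β o : E3) (σ : Equiv.Perm (Fin 3)) (y : Fin 3 → ℝ) : E3 :=
  WithLp.toLp 2 fun i => o i + β i * y (σ.symm i)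

variable {β o : E3} {σ : Equiv.Perm (Fin 3)}

theorem chart_apply (β o : E3) (σ : Equiv.Perm (Fin 3)) (y : Fin 3 → ℝ) (i : Fin 3) :
    chart β o σ y i = o i + β i * y (σ.symm i) := rfl

theorem chart_combo (y z : Fin 3 → ℝ) {s t : ℝ} (hst : s + t = 1) :
    s • chart β o σ y + t • chart β o σ z = chart β o σ (s • y + t • z) := by
  have : t = 1 - s := by linarith
  subst this
  ext i
  simp [chart_apply]
  ring

theorem chart_injective (hβ : β ∈ openRNS) : Function.Injective (chart β o σ) := by
  intro y z h
  ext l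
  have := congrArg (fun x : E3 => x (σ l)) h
  simp only [chart_apply, Equiv.symm_apply_apply, add_right_inj] at this
  exact mul_left_cancel₀ (hβ.1 _).ne' this

theorem convex_chart_preimage {K : Set E3} (hK : Convex ℝ K) :
    Convex ℝ (chart β o σ ⁻¹' K) := by
  intro y hy z hz s t hs ht hst
  rw [Set.mem_preimage, ← chart_combo y z hst]
  exact hK hy hz hs ht hst

theorem chart_mem_openSegment_iff (hβ : β ∈ openRNS) (x y z : Fin 3 → ℝ) :
    chart β o σ x ∈ openSegment ℝ (chart β o σ y) (chart β o σ z) ↔ x ∈ openSegment ℝ y z := by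
  constructor
  · rintro ⟨s, t, hs, ht, hst, h⟩
    rw [chart_combo y z hst] at h
    exact ⟨s, t, hs, ht, hst, chart_injective hβ h⟩
  · rintro ⟨s, t, hs, ht, hst, rfl⟩
    exact ⟨s, t, hs, ht, hst, chart_combo y z hst⟩

theorem mem_openSegment_iff_coordinate {l l₁ : Fin 3} (h1 : l₁ ≠ l) {x y z : Fin 3 → ℝ}
    (hs : ∑ k, y k = ∑ k, x k) (hs' : ∑ k, z k = ∑ k, x k) (hl : z l = y l) (hlt : y l₁ < z l₁) :
    x ∈ openSegment ℝ y z ↔ x l = y l ∧ y l₁ < x l₁ ∧ x l₁ < z l₁ := by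
  obtain ⟨l₂, h2, h3⟩ := exists_third l l₁
  rw [sum_eq_of_ne h1 h2 h3, sum_eq_of_ne h1 h2 h3] at hs hs'
  constructor
  · rintro ⟨s, t, hs, ht, hst, rfl⟩
    obtain rfl : s = 1 - t := by linarith
    simp only [Pi.add_apply, Pi.smul_apply, smul_eq_mul, hl]
    refine ⟨by ring, by nlinarith, by nlinarith⟩
  · rintro ⟨e, e1, e2⟩
    have hd : 0 < z l₁ - y l₁ := by linarith
    refine ⟨(z l₁ - x l₁) / (z l₁ - y l₁), (x l₁ - y l₁) / (z l₁ - y l₁),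
      div_pos (by linarith) hd, div_pos (by linarith) hd, by field_simp; ring, ?_⟩
    ext k
    simp only [Pi.add_apply, Pi.smul_apply, smul_eq_mul]
    rw [div_mul_eq_mul_div, div_mul_eq_mul_div, ← add_div, div_eq_iff hd.ne']
    rcases eq_or_eq_or_eq_of_ne l l₁ l₂ h1 h2 h3 k with rfl | rfl | rfl
    · rw [hl, e]; ring
    · ring
    · have e3 : y k = x l + x l₁ + x k - y l - y l₁ := by linarith
      have e4 : z k = x l + x l₁ + x k - y l - z l₁ := by linarith
      rw [e3, e4, e]; ring

/-- The segment from `z` to `x` can be prolonged a little beyond `x` inside `F`; if `φ z < φ x`, the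
maximum would be exceeded there. -/
theorem mem_intrinsicInterior_of_functional {F : Set E3} {x z : E3} (φ : E3 →ₗ[ℝ] ℝ)
    (hx : x ∈ intrinsicInterior ℝ F) (hle : ∀ y ∈ F, φ y ≤ φ x) (hz : z ∈ F) : φ z = φ x := by
  rw [mem_intrinsicInterior] at hx
  obtain ⟨w, hw, rfl⟩ := hx
  have hz' : z ∈ affineSpan ℝ F := subset_affineSpan ℝ F hz
  let γ : ℝ → affineSpan ℝ F := fun t =>
    ⟨AffineMap.lineMap (w : E3) z t, AffineMap.lineMap_mem t w.2 hz'⟩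
  have hγ : Continuous γ := by
    refine Continuous.subtype_mk ?_ _
    exact AffineMap.lineMap_continuous
  have hγ0 : γ 0 = w := Subtype.ext (by simp [γ])
  have hnhds : γ ⁻¹' (((↑) : affineSpan ℝ F → E3) ⁻¹' F) ∈ nhds (0 : ℝ) :=
    hγ.continuousAt.preimage_mem_nhds (by rw [hγ0]; exact mem_interior_iff_mem_nhds.1 hw)
  obtain ⟨ε, hε, hball⟩ := Metric.mem_nhds_iff.1 hnhds
  have hmem : γ (-(ε / 2)) ∈ ((↑) : affineSpan ℝ F → E3) ⁻¹' F :=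
    hball (by simp [abs_of_pos hε]; linarith)
  have h1 := hle _ hmem
  have h2 : φ (γ (-(ε / 2)) : E3) = φ w - ε / 2 * (φ z - φ w) := by
    simp only [γ, AffineMap.lineMap_apply, vsub_eq_sub, vadd_eq_add, map_add, map_smul, map_sub,
      smul_eq_mul]
    ring
  rw [h2] at h1
  have h3 := hle z hz
  nlinarith

/-- The coordinate functional of a player. -/
def coordinate (i : Fin 3) : E3 →ₗ[ℝ] ℝ := weighted (Pi.single i 1)

theorem coordinate_apply (i : Fin 3) (x : E3) : coordinate i x = x i := by
  simp [coordinate, weighted_apply, Pi.single_apply]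

/-- The assumption `hnc` says that no bound is attained on the whole hexagon, so a point attaining
one cannot be interior. Conversely, the strict bounds define an open subset of the affine span. -/
theorem chart_mem_intrinsicInterior_iff (hβ : β ∈ openRNS) {ub : Fin 3 → ℝ} {S : ℝ}
    (hnc : ∀ l, (∃ y ∈ hexagon ub S, y l ≠ 0) ∧ ∃ y ∈ hexagon ub S, y l ≠ ub l)
    {y : Fin 3 → ℝ} (hy : y ∈ hexagon ub S) :
    chart β o σ y ∈ intrinsicInterior ℝ (chart β o σ '' hexagon ub S) ↔
      ∀ l, 0 < y l ∧ y l < ub l := by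
  constructor
  · intro h l
    obtain ⟨⟨y₀, hy0, h0⟩, y₁, hy1, h1⟩ := hnc l
    have hb := hβ.1 (σ l)
    refine ⟨lt_of_le_of_ne (hy.1 l).1 fun e => h0 ?_, lt_of_le_of_ne (hy.1 l).2 fun e => h1 ?_⟩
    · have := mem_intrinsicInterior_of_functional (-coordinate (σ l)) h (z := chart β o σ y₀) ?_
        ⟨y₀, hy0, rfl⟩
      · simp only [LinearMap.neg_apply, coordinate_apply, chart_apply, Equiv.symm_apply_apply,
          ← e, neg_inj, add_right_inj] at this
        exact mul_left_cancel₀ hb.ne' this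
      · rintro _ ⟨z, hz, rfl⟩
        simp only [LinearMap.neg_apply, coordinate_apply, chart_apply, Equiv.symm_apply_apply,
          ← e]
        have := mul_nonneg hb.le (hz.1 l).1
        linarith
    · have := mem_intrinsicInterior_of_functional (coordinate (σ l)) h (z := chart β o σ y₁) ?_
        ⟨y₁, hy1, rfl⟩
      · simp only [coordinate_apply, chart_apply, Equiv.symm_apply_apply, e,
          add_right_inj] at this
        exact mul_left_cancel₀ hb.ne' this
      · rintro _ ⟨z, hz, rfl⟩
        simp only [coordinate_apply, chart_apply, Equiv.symm_apply_apply, e]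
        have := mul_le_mul_of_nonneg_left (hz.1 l).2 hb.le
        linarith
  · intro h
    set F := chart β o σ '' hexagon ub S
    have hmem : chart β o σ y ∈ affineSpan ℝ F := subset_affineSpan ℝ F ⟨y, hy, rfl⟩
    let r : Fin 3 → E3 → ℝ := fun l x => (x (σ l) - o (σ l)) / β (σ l)
    have hr : ∀ l z, r l (chart β o σ z) = z l := fun l z => by
      have := (hβ.1 (σ l)).ne'
      simp only [r, chart_apply, Equiv.symm_apply_apply]
      field_simp
      ring
    have hrc : ∀ l, Continuous (r l) := fun l => by
      simp only [r]
      fun_prop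
    have hsum : ∀ x ∈ affineSpan ℝ F, ∑ l, r l x = S := by
      intro x hx
      refine affineSpan_induction hx ?_ ?_
      · rintro _ ⟨z, hz, rfl⟩
        simp only [hr]
        exact hz.2
      · intro c u v w hu hv hw
        have : ∀ l, r l (c • (u -ᵥ v) +ᵥ w) = c * (r l u - r l v) + r l w := fun l => by
          simp only [r, vsub_eq_sub, vadd_eq_add, PiLp.add_apply, PiLp.smul_apply,
            PiLp.sub_apply, smul_eq_mul]
          ring
        simp only [this, Finset.sum_add_distrib, ← Finset.mul_sum, Finset.sum_sub_distrib, hu, hv,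
          hw]
        ring
    rw [mem_intrinsicInterior]
    refine ⟨⟨_, hmem⟩, ?_, rfl⟩
    rw [mem_interior]
    refine ⟨{x : affineSpan ℝ F | ∀ l, 0 < r l x ∧ r l x < ub l}, ?_, ?_, ?_⟩
    · rintro ⟨x, hx⟩ hlt
      refine ⟨fun l => r l x, ⟨fun l => ⟨(hlt l).1.le, (hlt l).2.le⟩, hsum x hx⟩, ?_⟩
      ext i
      have := (hβ.1 i).ne'
      simp only [r, chart_apply, Equiv.apply_symm_apply]
      field_simp
      ring
    · simp only [Set.ofPred_forall]
      refine isOpen_iInter_of_finite fun l => ?_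
      have hc : Continuous fun x : affineSpan ℝ F => r l x := (hrc l).comp continuous_subtype_val
      exact (isOpen_lt continuous_const hc).inter (isOpen_lt hc continuous_const)
    · intro l
      simp only [hr]
      exact h l

/-! ### Directions, lengths and midpoints in a chart -/

theorem chart_sub (y z : Fin 3 → ℝ) :
    chart β o σ y - chart β o σ z = chart β 0 σ (y - z) := by
  ext i
  simp [chart_apply]
  ring

theorem chart_zero_smul (r : ℝ) (d : Fin 3 → ℝ) : chart β 0 σ (r • d) = r • chart β 0 σ d := by
  ext i
  simp [chart_apply]
  ring

theorem chart_zero_ne_zero (hβ : β ∈ openRNS) {d : Fin 3 → ℝ} (hd : d ≠ 0) :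
    chart β 0 σ d ≠ 0 := by
  intro h
  refine hd (chart_injective (o := 0) (σ := σ) hβ (h.trans ?_))
  ext i
  simp [chart_apply]

theorem sidesParallel_chart {k : ℕ} [NeZero k] {y : Fin k → Fin 3 → ℝ} {i j : Fin k}
    {r s : ℝ} (hr : r ≠ 0) (hs : s ≠ 0) {d : Fin 3 → ℝ} (hi : y (i + 1) - y i = r • d)
    (hj : y (j + 1) - y j = s • d) : SidesParallel (fun q => chart β o σ (y q)) i j := by
  rw [SidesParallel, AffineSubspace.affineSpan_pair_parallel_iff_vectorSpan_eq,
    vectorSpan_pair_rev, vectorSpan_pair_rev]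
  simp only [vsub_eq_sub, chart_sub, hi, hj, chart_zero_smul]
  rw [Submodule.span_singleton_smul_eq hr.isUnit, Submodule.span_singleton_smul_eq hs.isUnit]

theorem sideLength_chart {k : ℕ} [NeZero k] {y : Fin k → Fin 3 → ℝ} {i : Fin k}
    {r : ℝ} {d : Fin 3 → ℝ} (hi : y (i + 1) - y i = r • d) :
    sideLength (fun q => chart β o σ (y q)) i = |r| * ‖chart β 0 σ d‖ := by
  rw [sideLength, dist_comm, dist_eq_norm, chart_sub, hi, chart_zero_smul, norm_smul,
    Real.norm_eq_abs]

theorem not_sidesParallel_chart (hβ : β ∈ openRNS) {k : ℕ} [NeZero k] {y : Fin k → Fin 3 → ℝ}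
    {i j : Fin k} {l : Fin 3} (hi : y (i + 1) l = y i l) (hj : y (j + 1) l ≠ y j l) :
    ¬ SidesParallel (fun q => chart β o σ (y q)) i j := by
  rw [SidesParallel, AffineSubspace.affineSpan_pair_parallel_iff_vectorSpan_eq,
    vectorSpan_pair_rev, vectorSpan_pair_rev]
  simp only [vsub_eq_sub, chart_sub]
  intro h
  have := h.symm ▸ Submodule.mem_span_singleton_self (chart β 0 σ (y (j + 1) - y j))
  obtain ⟨r, hr⟩ := Submodule.mem_span_singleton.1 this
  rw [← chart_zero_smul] at hr
  have := congrFun (chart_injective hβ hr) l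
  simp only [Pi.smul_apply, Pi.sub_apply, hi, sub_self, smul_zero] at this
  exact hj (sub_eq_zero.1 this.symm)

theorem midpoint_chart (y z : Fin 3 → ℝ) :
    midpoint ℝ (chart β o σ y) (chart β o σ z) = chart β o σ ((1 / 2 : ℝ) • (y + z)) := by
  ext i
  simp [midpoint_eq_smul_add, chart_apply]
  ring

end

section

variable {n c k : ℕ}

/-! ### Distributing weights among labels -/

/-- What the labels get when weight `s` goes to label `g s`. -/
def load (W : Fin c → ℝ) (g : Fin c → Fin 3) (l : Fin 3) : ℝ := ∑ s, if g s = l then W s else 0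

/-- The most that a label can get when weight `s` may go to the labels in `D s`. -/
def maxLoad (W : Fin c → ℝ) (D : Fin c → Finset (Fin 3)) (l : Fin 3) : ℝ :=
  ∑ s, if l ∈ D s then W s else 0

/-- The assignment that favours first the label `l₁` and then the label `l₂`. -/
def greedy (D : Fin c → Finset (Fin 3)) (l₁ l₂ : Fin 3) (s : Fin c) : Fin 3 :=
  if l₁ ∈ D s then l₁ else l₂

section Load

variable {W : Fin c → ℝ} {D : Fin c → Finset (Fin 3)}

theorem load_nonneg (hW : ∀ s, 0 < W s) (g : Fin c → Fin 3) (l : Fin 3) : 0 ≤ load W g l :=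
  Finset.sum_nonneg fun s _ => by split_ifs; exacts [(hW s).le, le_rfl]

theorem load_pos_iff (hW : ∀ s, 0 < W s) (g : Fin c → Fin 3) (l : Fin 3) :
    0 < load W g l ↔ ∃ s, g s = l := by
  constructor
  · intro h
    by_contra! hcon
    exact h.ne' (Finset.sum_eq_zero fun s _ => if_neg (hcon s))
  · rintro ⟨s, hs⟩
    refine Finset.sum_pos' (fun s _ => by split_ifs; exacts [(hW s).le, le_rfl])
      ⟨s, Finset.mem_univ s, ?_⟩
    rw [if_pos hs]
    exact hW s

theorem load_eq_zero_iff (hW : ∀ s, 0 < W s) (g : Fin c → Fin 3) (l : Fin 3) :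
    load W g l = 0 ↔ ∀ s, g s ≠ l := by
  have h1 := load_pos_iff hW g l
  have h2 := load_nonneg hW g l
  constructor
  · intro h s hs
    exact (h1.2 ⟨s, hs⟩).ne' h
  · intro h
    refine le_antisymm (not_lt.1 fun hlt => ?_) h2
    obtain ⟨s, hs⟩ := h1.1 hlt
    exact h s hs

theorem load_term_le (hW : ∀ s, 0 < W s) {g : Fin c → Fin 3} (hg : ∀ s, g s ∈ D s) (l : Fin 3)
    (s : Fin c) : (if g s = l then W s else 0) ≤ if l ∈ D s then W s else 0 := by
  by_cases h : g s = l
  · rw [if_pos h, if_pos (h ▸ hg s)]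
  · rw [if_neg h]
    split_ifs
    exacts [(hW s).le, le_rfl]

theorem load_le_maxLoad (hW : ∀ s, 0 < W s) {g : Fin c → Fin 3} (hg : ∀ s, g s ∈ D s)
    (l : Fin 3) : load W g l ≤ maxLoad W D l :=
  Finset.sum_le_sum fun s _ => load_term_le hW hg l s

theorem load_eq_maxLoad_iff (hW : ∀ s, 0 < W s) {g : Fin c → Fin 3} (hg : ∀ s, g s ∈ D s)
    (l : Fin 3) : load W g l = maxLoad W D l ↔ ∀ s, l ∈ D s → g s = l := by
  rw [load, maxLoad, Finset.sum_eq_sum_iff_of_le fun s _ => load_term_le hW hg l s]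
  refine ⟨fun h s hs => ?_, fun h s _ => ?_⟩
  · have := h s (Finset.mem_univ s)
    rw [if_pos hs] at this
    by_contra hne
    rw [if_neg hne] at this
    exact (hW s).ne this
  · by_cases hs : l ∈ D s
    · rw [if_pos hs, if_pos (h s hs)]
    · rw [if_neg hs, if_neg fun e : g s = l => hs (e ▸ hg s)]

theorem load_lt_maxLoad_iff (hW : ∀ s, 0 < W s) {g : Fin c → Fin 3} (hg : ∀ s, g s ∈ D s)
    (l : Fin 3) : load W g l < maxLoad W D l ↔ ∃ s, l ∈ D s ∧ g s ≠ l := by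
  rw [(load_le_maxLoad hW hg l).lt_iff_ne, Ne, load_eq_maxLoad_iff hW hg]
  push Not
  rfl

theorem sum_load (W : Fin c → ℝ) (g : Fin c → Fin 3) : ∑ l, load W g l = ∑ s, W s := by
  simp only [load]
  rw [Finset.sum_comm]
  simp

theorem load_mem_hexagon (hW : ∀ s, 0 < W s) {g : Fin c → Fin 3} (hg : ∀ s, g s ∈ D s) :
    load W g ∈ hexagon (maxLoad W D) (∑ s, W s) :=
  ⟨fun l => ⟨load_nonneg hW g l, load_le_maxLoad hW hg l⟩, sum_load W g⟩

/-- Every weight can go to at least two labels. -/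
def NoForced (D : Fin c → Finset (Fin 3)) : Prop := ∀ s l l', l ≠ l' → l ∈ D s ∨ l' ∈ D s

instance (D : Fin c → Finset (Fin 3)) : Decidable (NoForced D) :=
  inferInstanceAs (Decidable (∀ s l l', l ≠ l' → l ∈ D s ∨ l' ∈ D s))

theorem greedy_mem (hD : NoForced D) {l₁ l₂ : Fin 3} (h : l₁ ≠ l₂) (s : Fin c) :
    greedy D l₁ l₂ s ∈ D s := by
  unfold greedy
  split_ifs with h'
  · exact h'
  · exact (hD s l₁ l₂ h).resolve_left h'

theorem load_greedy (W : Fin c → ℝ) (D : Fin c → Finset (Fin 3)) {l₁ l₂ : Fin 3} (h : l₁ ≠ l₂) :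
    load W (greedy D l₁ l₂) = hexVertex (maxLoad W D) (∑ s, W s) l₁ l₂ := by
  have h1 : load W (greedy D l₁ l₂) l₁ = maxLoad W D l₁ := by
    refine Finset.sum_congr rfl fun s _ => ?_
    by_cases hs : l₁ ∈ D s <;> simp [greedy, hs, h.symm]
  obtain ⟨l, hl1, hl2⟩ := exists_third l₁ l₂
  have h0 : load W (greedy D l₁ l₂) l = 0 := by
    refine Finset.sum_eq_zero fun s _ => ?_
    by_cases hs : l₁ ∈ D s <;> simp [greedy, hs, hl1.symm, hl2.symm]
  have h2 := sum_load W (greedy D l₁ l₂)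
  rw [sum_eq_of_ne hl1.symm hl2.symm h.symm] at h2
  ext x
  rcases eq_or_eq_or_eq_of_ne l l₁ l₂ hl1.symm hl2.symm h.symm x with rfl | rfl | rfl
  · simp [hexVertex, hl1, hl2, h0]
  · simp [hexVertex, h1]
  · simp only [hexVertex, if_neg h.symm, if_true]
    linarith

/-- Greedy assignments are determined by the loads. -/
theorem eq_greedy_of_load_eq (hW : ∀ s, 0 < W s) (hD : NoForced D) {l₁ l₂ : Fin 3} (h : l₁ ≠ l₂)
    {g : Fin c → Fin 3} (hg : ∀ s, g s ∈ D s) (he : load W g = load W (greedy D l₁ l₂)) :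
    g = greedy D l₁ l₂ := by
  obtain ⟨l, hl1, hl2⟩ := exists_third l₁ l₂
  -- A full load for `l₁` forces every item it may get, and a zero load for the third label leaves
  -- the rest to `l₂`.
  have h1 := (load_eq_maxLoad_iff hW hg l₁).1 (by
    rw [he, load_eq_maxLoad_iff hW (greedy_mem hD h)]
    intro s hs
    exact if_pos hs)
  have h0 := (load_eq_zero_iff hW g l).1 (by
    rw [he, load_eq_zero_iff hW]
    intro s
    unfold greedy
    split_ifs
    exacts [hl1.symm, hl2.symm])
  ext1 s
  unfold greedy
  split_ifs with hs
  · exact h1 s hs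
  · rcases eq_or_eq_or_eq_of_ne l l₁ l₂ hl1.symm hl2.symm h.symm (g s) with e | e | e
    · exact absurd e (h0 s)
    · exact absurd (e ▸ hg s) hs
    · exact e

/-- Every weight can go to `l₁` or `l₂`, and some weight is counted twice. This makes the side
between the two greedy vertices nondegenerate. -/
theorem sum_lt_maxLoad_add (hW : ∀ s, 0 < W s) (hD : NoForced D) {l₁ l₂ : Fin 3} (h : l₁ ≠ l₂)
    (hex : ∃ s, l₁ ∈ D s ∧ l₂ ∈ D s) : ∑ s, W s < maxLoad W D l₁ + maxLoad W D l₂ := by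
  rw [maxLoad, maxLoad, ← Finset.sum_add_distrib]
  obtain ⟨s, hs1, hs2⟩ := hex
  refine Finset.sum_lt_sum (fun t _ => ?_) ⟨s, Finset.mem_univ s, ?_⟩
  · have := hW t
    rcases hD t l₁ l₂ h with ht | ht <;> rw [if_pos ht] <;> split_ifs <;> linarith
  · have := hW s
    rw [if_pos hs1, if_pos hs2]
    linarith

end Load

/-- A cyclic list of assignments that yields the vertices of a polygon, where the side starting
at `vert i` consists of the assignments in which the label `(side i).2` gets as much as possible
(`true`) or nothing (`false`). -/
structure PolygonPattern [NeZero k] (D : Fin c → Finset (Fin 3)) (vert : Fin k → Fin c → Fin 3)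
    (side : Fin k → Bool × Fin 3) : Prop where
  length : ∀ i : Fin k, i + 1 ≠ i ∧ i - 1 ≠ i ∧ i + 1 ≠ i - 1
  noForced : NoForced D
  exists_greedy : ∀ l₁ l₂, l₁ ≠ l₂ → ∃ i, ∀ s, vert i s = greedy D l₁ l₂ s
  eq_greedy : ∀ i, ∃ l₁ l₂, l₁ ≠ l₂ ∧ ∀ s, vert i s = greedy D l₁ l₂ s
  side_iff : ∀ i j, (j = i ∨ j = i + 1) ↔
    if (side i).1 then ∀ s, (side i).2 ∈ D s → vert j s = (side i).2
    else ∀ s, vert j s ≠ (side i).2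

/-! ### The items contested at `β` -/

variable {b : Evaluation n} {β : E3} {J : Fin c → Fin n} {σ : Equiv.Perm (Fin 3)}
  {D : Fin c → Finset (Fin 3)} {o : E3} {W : Fin c → ℝ}

/-- The items `J s` are those contested at `β`; after naming the players by labels, `D s` is the
set of claimants of `J s`. -/
structure IsContestedList (b : Evaluation n) (β : E3) (J : Fin c → Fin n)
    (σ : Equiv.Perm (Fin 3)) (D : Fin c → Finset (Fin 3)) : Prop where
  inj : Function.Injective J
  mem_iff : ∀ s l, σ l ∈ claimants b β (J s) ↔ l ∈ D s
  rest : ∀ q, (∀ s, q ≠ J s) → ∃! i, i ∈ claimants b β q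

/-- The labels of the players who get the contested items. -/
def labels (J : Fin c → Fin n) (σ : Equiv.Perm (Fin 3)) (x : Fin n → Fin 3) : Fin c → Fin 3 :=
  fun s => σ.symm (x (J s))

/-- In the given chart the values of allocations depend only on the contested items. -/
structure IsItemChart (b : Evaluation n) (β : E3) (J : Fin c → Fin n) (σ : Equiv.Perm (Fin 3))
    (D : Fin c → Finset (Fin 3)) (o : E3) (W : Fin c → ℝ) : Prop extends
    IsContestedList b β J σ D where
  weight_pos : ∀ s, 0 < W s
  value_eq : ∀ X, FollowsPAR b β X →
    value b X = chart β o σ fun l => ∑ s, W s * X (σ l) (J s)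

/-- The origin `o` collects the uncontested items, whose owners are the same in all allocations
following the rule; a contested item contributes its weight times the share. -/
theorem IsContestedList.exists_chart (h : IsContestedList b β J σ D) (hb : ∀ i j, 0 < b i j)
    (hβ : β ∈ openRNS) : ∃ o W, IsItemChart b β J σ D o W := by
  classical
  choose V hV hle hcl using fun j => exists_weight hb hβ j
  refine ⟨WithLp.toLp 2 fun i => β i * ∑ q ∈ (Finset.univ.image J)ᶜ,
    (if i ∈ claimants b β q then V q else 0), fun s => V (J s), h, fun s => hV _, fun X hX => ?_⟩
  ext i
  have h1 : value b X i = β i * ∑ q, V q * X i q := by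
    rw [value_apply, Finset.mul_sum]
    refine Finset.sum_congr rfl fun q _ => ?_
    by_cases hi : i ∈ claimants b β q
    · rw [(hcl q i).1 hi, mul_assoc]
    · rw [hX.eq_zero hi]
      ring
  have h2 : ∀ q ∈ (Finset.univ.image J)ᶜ,
      V q * X i q = if i ∈ claimants b β q then V q else 0 := by
    intro q hq
    obtain ⟨r, hr, hu⟩ := h.rest q fun s e => by simp [e] at hq
    by_cases hi : i ∈ claimants b β q
    · obtain rfl := hu i hi
      have : X i q = 1 := by
        rw [← hX.1.2 q, eq_comm]
        exact Finset.sum_eq_single i (fun k _ hk => hX.eq_zero fun hk' => hk (hu k hk')) (by simp)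
      rw [if_pos hi, this, mul_one]
    · rw [if_neg hi, hX.eq_zero hi, mul_zero]
  rw [h1, chart_apply, ← Finset.sum_add_sum_compl (Finset.univ.image J), Finset.sum_congr rfl h2,
    Finset.sum_image fun s _ t _ e => h.inj e]
  simp only [Equiv.apply_symm_apply]
  ring

theorem IsContestedList.labels_mem (h : IsContestedList b β J σ D) {x : Fin n → Fin 3}
    (hx : x ∈ integerPAR b β) (s : Fin c) : labels J σ x s ∈ D s := by
  rw [← h.mem_iff, labels, Equiv.apply_symm_apply]
  exact hx _

theorem IsContestedList.labels_injOn (h : IsContestedList b β J σ D) :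
    Set.InjOn (labels J σ) (integerPAR b β) := by
  intro x hx y hy hxy
  ext1 q
  by_cases hq : ∃ s, q = J s
  · obtain ⟨s, rfl⟩ := hq
    exact σ.symm.injective (congrFun hxy s)
  · push Not at hq
    exact (h.rest q hq).unique (hx q) (hy q)

theorem IsContestedList.exists_labels_eq (h : IsContestedList b β J σ D) {g : Fin c → Fin 3}
    (hg : ∀ s, g s ∈ D s) : ∃ x ∈ integerPAR b β, labels J σ x = g := by
  classical
  have hex : ∀ q, ∃ i, i ∈ claimants b β q ∧ ∀ s, q = J s → i = σ (g s) := by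
    intro q
    by_cases hq : ∃ s, q = J s
    · obtain ⟨s, rfl⟩ := hq
      exact ⟨σ (g s), (h.mem_iff _ _).2 (hg s), fun t ht => by rw [h.inj ht]⟩
    · push Not at hq
      obtain ⟨i, hi, -⟩ := h.rest q hq
      exact ⟨i, hi, fun s e => absurd e (hq s)⟩
  choose x hx hx' using hex
  refine ⟨x, hx, ?_⟩
  ext1 s
  rw [labels, hx' _ s rfl, Equiv.symm_apply_apply]

/-- Passing to labels identifies the integer allocations with the admissible `g`, which turns each
count into a finite computation. -/
theorem IsContestedList.ncard_eq (h : IsContestedList b β J σ D) {Q : (Fin n → Fin 3) → Prop}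
    (R : (Fin c → Fin 3) → Prop) [DecidablePred R]
    (hQ : ∀ x ∈ integerPAR b β, Q x ↔ R (labels J σ x)) :
    {x | x ∈ integerPAR b β ∧ Q x}.ncard =
      (Finset.univ.filter fun g : Fin c → Fin 3 => (∀ s, g s ∈ D s) ∧ R g).card := by
  have himg : labels J σ '' {x | x ∈ integerPAR b β ∧ Q x} =
      ↑(Finset.univ.filter fun g : Fin c → Fin 3 => (∀ s, g s ∈ D s) ∧ R g) := by
    ext g
    simp only [Finset.coe_filter, Finset.mem_univ, true_and]
    constructor
    · rintro ⟨x, ⟨hx, hq⟩, rfl⟩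
      exact ⟨h.labels_mem hx, (hQ x hx).1 hq⟩
    · rintro ⟨hg, hr⟩
      obtain ⟨x, hx, rfl⟩ := h.exists_labels_eq hg
      exact ⟨x, ⟨hx, (hQ x hx).2 hr⟩, rfl⟩
  rw [← Set.ncard_coe_finset, ← himg,
    (h.labels_injOn.mono fun x hx => hx.1).ncard_image]

theorem IsContestedList.ncard_integerPAR (h : IsContestedList b β J σ D) :
    (integerPAR b β).ncard =
      (Finset.univ.filter fun g : Fin c → Fin 3 => ∀ s, g s ∈ D s).card := by
  have := h.ncard_eq (Q := fun _ => True) (fun _ => True) fun _ _ => Iff.rfl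
  simpa using this

theorem IsItemChart.value_integerAllocation (h : IsItemChart b β J σ D o W) {x : Fin n → Fin 3}
    (hx : x ∈ integerPAR b β) :
    value b (integerAllocation x) = chart β o σ (load W (labels J σ x)) := by
  rw [h.value_eq _ (followsPAR_integerAllocation hx)]
  congr 1
  ext l
  refine Finset.sum_congr rfl fun s _ => ?_
  simp [integerAllocation, labels, Equiv.symm_apply_eq]

theorem IsItemChart.load_mem_faceAt (h : IsItemChart b β J σ D o W) (hb : ∀ i j, 0 < b i j)
    (hβ : β ∈ openRNS) {g : Fin c → Fin 3} (hg : ∀ s, g s ∈ D s) :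
    chart β o σ (load W g) ∈ faceAt b β := by
  obtain ⟨x, hx, rfl⟩ := h.exists_labels_eq hg
  rw [← h.value_integerAllocation hx]
  exact (mem_faceAt_iff hb hβ).2 ⟨_, followsPAR_integerAllocation hx, rfl⟩

theorem IsItemChart.faceAt_subset (h : IsItemChart b β J σ D o W) (hb : ∀ i j, 0 < b i j)
    (hβ : β ∈ openRNS) : faceAt b β ⊆ chart β o σ '' hexagon (maxLoad W D) (∑ s, W s) := by
  intro x hx
  obtain ⟨X, hX, rfl⟩ := (mem_faceAt_iff hb hβ).1 hx
  rw [h.value_eq X hX]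
  refine ⟨_, ⟨fun l => ⟨Finset.sum_nonneg fun s _ => mul_nonneg (h.weight_pos s).le (hX.1.1 _ _),
    Finset.sum_le_sum fun s _ => ?_⟩, ?_⟩, rfl⟩
  · split_ifs with hs
    · exact mul_le_of_le_one_right (h.weight_pos s).le (hX.1.le_one _ _)
    · rw [hX.eq_zero fun hc => hs ((h.mem_iff s l).1 hc), mul_zero]
  · rw [Finset.sum_comm]
    refine Finset.sum_congr rfl fun s _ => ?_
    rw [← Finset.mul_sum, Equiv.sum_comp σ fun i => X i (J s), hX.1.2, mul_one]

theorem image_hexagon_subset {K : Set E3} (hK : Convex ℝ K)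
    (h : ∀ l₁ l₂, l₁ ≠ l₂ → chart β o σ (load W (greedy D l₁ l₂)) ∈ K) :
    chart β o σ '' hexagon (maxLoad W D) (∑ s, W s) ⊆ K := by
  rw [Set.image_subset_iff]
  refine hexagon_subset_of_convex (convex_chart_preimage hK) fun l₁ l₂ hne => ?_
  rw [← load_greedy W D hne]
  exact h l₁ l₂ hne

/-- The bounds hold for all shares; conversely the vertices of the hexagon are loads of greedy
assignments, which are admissible thanks to `NoForced`. -/
theorem IsItemChart.faceAt_eq (h : IsItemChart b β J σ D o W) (hb : ∀ i j, 0 < b i j)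
    (hβ : β ∈ openRNS) (hD : NoForced D) :
    faceAt b β = chart β o σ '' hexagon (maxLoad W D) (∑ s, W s) :=
  (h.faceAt_subset hb hβ).antisymm (image_hexagon_subset (convex_faceAt b β) fun _ _ hne =>
    h.load_mem_faceAt hb hβ (greedy_mem hD hne))

/-! ### The face as a polygon and the place of the integer allocations -/

section Polygon

variable [NeZero k] {vert : Fin k → Fin c → Fin 3} {side : Fin k → Bool × Fin 3}

theorem PolygonPattern.vert_mem (p : PolygonPattern D vert side) (i : Fin k) (s : Fin c) :
    vert i s ∈ D s := by
  obtain ⟨l₁, l₂, hne, e⟩ := p.eq_greedy i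
  rw [e]
  exact greedy_mem p.noForced hne s

theorem IsItemChart.isPolygon (h : IsItemChart b β J σ D o W) (hb : ∀ i j, 0 < b i j)
    (hβ : β ∈ openRNS) (p : PolygonPattern D vert side) :
    IsPolygon k (faceAt b β) fun i => chart β o σ (load W (vert i)) := by
  have hnonneg : ∀ i l, 0 ≤ load W (vert i) l := fun i l => load_nonneg h.weight_pos _ _
  have hle : ∀ i l, load W (vert i) l ≤ maxLoad W D l := fun i l =>
    load_le_maxLoad h.weight_pos (p.vert_mem i) l
  have hside : ∀ i j, (j = i ∨ j = i + 1) ↔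
      if (side i).1 then load W (vert j) (side i).2 = maxLoad W D (side i).2
      else load W (vert j) (side i).2 = 0 := by
    intro i j
    rw [p.side_iff i j]
    split_ifs
    · rw [load_eq_maxLoad_iff h.weight_pos (p.vert_mem j)]
    · rw [load_eq_zero_iff h.weight_pos]
  -- The functional of a side is plus or minus a coordinate, according to whether the label is at
  -- its upper bound or at zero.
  refine isPolygon_of_functionals p.length
    (fun i => (if (side i).1 then 1 else -1 : ℝ) • coordinate (σ (side i).2)) ?_ ?_ ?_ ?_
  · refine Set.Subset.antisymm ?_ (convexHull_min ?_ (convex_faceAt b β))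
    · refine (h.faceAt_subset hb hβ).trans (image_hexagon_subset (convex_convexHull ℝ _) ?_)
      intro l₁ l₂ hne
      obtain ⟨i, hi⟩ := p.exists_greedy l₁ l₂ hne
      rw [← funext hi]
      exact subset_convexHull ℝ _ ⟨i, rfl⟩
    · rintro _ ⟨i, rfl⟩
      exact h.load_mem_faceAt hb hβ (p.vert_mem i)
  · intro i
    have h1 := (hside i i).1 (Or.inl rfl)
    have h2 := (hside i (i + 1)).1 (Or.inr rfl)
    simp only [LinearMap.smul_apply, coordinate_apply, chart_apply, Equiv.symm_apply_apply]
    split_ifs at h1 h2 ⊢ <;> rw [h1, h2]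
  · intro i j hj hj'
    have h1 := (hside i i).1 (Or.inl rfl)
    have h2 := (not_congr (hside i j)).1 (not_or.2 ⟨hj, hj'⟩)
    have hpos := hβ.1 (σ (side i).2)
    simp only [LinearMap.smul_apply, coordinate_apply, chart_apply, Equiv.symm_apply_apply]
    split_ifs at h1 h2 ⊢
    · have := mul_lt_mul_of_pos_left (lt_of_le_of_ne (hle j _) h2) hpos
      rw [h1]
      simp only [smul_eq_mul]
      linarith
    · have := mul_pos hpos (lt_of_le_of_ne (hnonneg j (side i).2) (Ne.symm h2))
      rw [h1]
      simp only [smul_eq_mul]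
      linarith
  · rw [← finrank_ker_of_ne_zero (weighted_ne_zero (RD_pos hβ 0).ne')]
    exact Submodule.finrank_mono vectorSpan_faceAt_le

theorem IsItemChart.verticesFromPAR (h : IsItemChart b β J σ D o W)
    (hβ : β ∈ openRNS) (p : PolygonPattern D vert side) :
    VerticesFromPAR b β fun i => chart β o σ (load W (vert i)) := by
  intro i
  obtain ⟨x, hx, hxl⟩ := h.exists_labels_eq (p.vert_mem i)
  refine ⟨x, ⟨hx, by rw [h.value_integerAllocation hx, hxl]⟩, ?_⟩
  rintro y ⟨hy, hyv⟩
  rw [h.value_integerAllocation hy] at hyv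
  obtain ⟨l₁, l₂, hne, e⟩ := p.eq_greedy i
  refine h.labels_injOn hy hx ?_
  rw [hxl, funext e]
  exact eq_greedy_of_load_eq h.weight_pos p.noForced hne (h.labels_mem hy)
    (by rw [chart_injective hβ hyv, funext e])

/-- On a side where label `l` gets nothing, being strictly between the ends means that neither `l₁`
nor `l₂` gets all it could. -/
theorem IsItemChart.ncard_extraOnSide (h : IsItemChart b β J σ D o W)
    (hβ : β ∈ openRNS) (p : PolygonPattern D vert side) (i : Fin k) (l l₁ l₂ : Fin 3)
    (h1 : l₁ ≠ l) (h2 : l₂ ≠ l) (h3 : l₂ ≠ l₁) (hi : ∀ s, vert i s = greedy D l₂ l₁ s)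
    (hi' : ∀ s, vert (i + 1) s = greedy D l₁ l₂ s) (hex : ∃ s, l₁ ∈ D s ∧ l₂ ∈ D s) :
    (extraOnSide b β (fun i => chart β o σ (load W (vert i))) i).ncard =
      (Finset.univ.filter fun g : Fin c → Fin 3 => (∀ s, g s ∈ D s) ∧ (∀ s, g s ≠ l) ∧
        (∃ s, l₂ ∈ D s ∧ g s ≠ l₂) ∧ ∃ s, l₁ ∈ D s ∧ g s ≠ l₁).card := by
  refine h.ncard_eq _ fun x hx => ?_
  have hg := h.labels_mem hx
  have hW := h.weight_pos
  set g := labels J σ x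
  rw [h.value_integerAllocation hx, chart_mem_openSegment_iff hβ, funext hi, funext hi',
    ← load_eq_zero_iff hW, ← load_lt_maxLoad_iff hW hg, ← load_lt_maxLoad_iff hW hg,
    load_greedy W D h3, load_greedy W D h3.symm]
  have hsum := sum_load W g
  have hlt := sum_lt_maxLoad_add hW p.noForced h3.symm hex
  rw [mem_openSegment_iff_coordinate h1 ((sum_hexVertex _ _ h3).trans hsum.symm)
    ((sum_hexVertex _ _ h3.symm).trans hsum.symm) (by simp [hexVertex, h1.symm, h2.symm])
    (by simp only [hexVertex, if_neg h3.symm, if_true]; linarith)]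
  rw [sum_eq_of_ne h1 h2 h3] at hsum
  simp only [hexVertex, if_neg h1.symm, if_neg h2.symm, if_neg h3.symm, if_true]
  refine and_congr_right fun h0 => and_congr_left fun _ => ?_
  rw [← hsum, h0]
  constructor <;> intro <;> linarith

theorem IsItemChart.ncard_insideFace (h : IsItemChart b β J σ D o W) (hb : ∀ i j, 0 < b i j)
    (hβ : β ∈ openRNS) (hD : NoForced D) (hex : ∀ l, ∃ s, l ∈ D s) :
    (insideFace b β (faceAt b β)).ncard =
      (Finset.univ.filter fun g : Fin c → Fin 3 => (∀ s, g s ∈ D s) ∧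
        ∀ l, (∃ s, g s = l) ∧ ∃ s, l ∈ D s ∧ g s ≠ l).card := by
  refine h.ncard_eq _ fun x hx => ?_
  have hg := h.labels_mem hx
  have hW := h.weight_pos
  have hmax : ∀ l, 0 < maxLoad W D l := fun l => by
    obtain ⟨s, hs⟩ := hex l
    refine Finset.sum_pos' (fun s _ => by split_ifs; exacts [(hW s).le, le_rfl])
      ⟨s, Finset.mem_univ s, ?_⟩
    rw [if_pos hs]
    exact hW s
  rw [h.value_integerAllocation hx, h.faceAt_eq hb hβ hD,
    chart_mem_intrinsicInterior_iff hβ (fun l => ?_) (load_mem_hexagon hW hg)]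
  · exact forall_congr' fun l => and_congr (load_pos_iff hW _ l) (load_lt_maxLoad_iff hW hg l)
  · obtain ⟨l₁, h1, -⟩ := exists_third l l
    obtain ⟨l₂, h2, h3⟩ := exists_third l l₁
    refine ⟨⟨_, load_mem_hexagon hW (greedy_mem hD h1.symm), ?_⟩,
      _, load_mem_hexagon hW (greedy_mem hD h3), ?_⟩
    · rw [load_greedy W D h1.symm]
      simpa [hexVertex] using (hmax l).ne'
    · rw [load_greedy W D h3]
      simpa [hexVertex, h1.symm, h2.symm] using (hmax l).ne

/-! ### Counting claimants and disputes -/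

theorem IsContestedList.othersAssigned (h : IsContestedList b β J σ D) {S : Set (Fin n)}
    (hS : ∀ s, J s ∈ S) : OthersAssigned b β S :=
  fun q hq => h.rest q fun s e => hq (e ▸ hS s)

theorem IsContestedList.claimants_eq (h : IsContestedList b β J σ D) (s : Fin c) :
    claimants b β (J s) = σ '' (D s : Set (Fin 3)) := by
  ext i
  rw [← Equiv.apply_symm_apply σ i, h.mem_iff, σ.injective.mem_set_image, Finset.mem_coe]

theorem IsContestedList.ncard_claimants (h : IsContestedList b β J σ D) (s : Fin c) :
    (claimants b β (J s)).ncard = (D s).card := by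
  rw [h.claimants_eq, Set.ncard_image_of_injective _ σ.injective, Set.ncard_coe_finset]

theorem IsContestedList.ncard_inter (h : IsContestedList b β J σ D) (s t : Fin c) :
    (claimants b β (J s) ∩ claimants b β (J t)).ncard = (D s ∩ D t).card := by
  rw [h.claimants_eq, h.claimants_eq, ← Set.image_inter σ.injective,
    Set.ncard_image_of_injective _ σ.injective, ← Finset.coe_inter, Set.ncard_coe_finset]

theorem IsContestedList.ncard_disputes (h : IsContestedList b β J σ D) (A : Finset (Fin c))
    {P : Fin n → Prop} (hP : ∀ q, P q ↔ ∃ s ∈ A, q = J s) (i : Fin 3) :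
    {q | P q ∧ i ∈ claimants b β q}.ncard = (A.filter fun s => σ.symm i ∈ D s).card := by
  have : {q | P q ∧ i ∈ claimants b β q} = J '' ↑(A.filter fun s => σ.symm i ∈ D s) := by
    ext q
    simp only [hP, Finset.coe_filter]
    constructor
    · rintro ⟨⟨s, hs, rfl⟩, hi⟩
      refine ⟨s, ⟨hs, ?_⟩, rfl⟩
      rwa [← h.mem_iff, Equiv.apply_symm_apply]
    · rintro ⟨s, ⟨hs, hi⟩, rfl⟩
      rw [← h.mem_iff, Equiv.apply_symm_apply] at hi
      exact ⟨⟨s, hs, rfl⟩, hi⟩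
  rw [this, Set.ncard_image_of_injective _ h.inj, Set.ncard_coe_finset]

end Polygon

end

section

variable {m n c k : ℕ}

/-! ### The six types of faces -/

theorem exists_perm_two : ∀ h h' : Fin 3, h ≠ h' →
    ∃ σ : Equiv.Perm (Fin 3), σ 2 = h ∧ σ 1 = h' := by decide

theorem exists_perm_three : ∀ h h' h'' : Fin 3, h ≠ h' → h ≠ h'' → h' ≠ h'' →
    ∃ σ : Equiv.Perm (Fin 3), σ 2 = h ∧ σ 0 = h' ∧ σ 1 = h'' := by decide

variable {b : Evaluation n} {β : E3} {J : Fin c → Fin n} {σ : Equiv.Perm (Fin 3)}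
  {D : Fin c → Finset (Fin 3)} {o : E3} {W : Fin c → ℝ}

/-- Items with different sets of claimants are different, so distinctness of the listed items need
not be assumed. -/
theorem isContestedList_of_injective (hD : Function.Injective D)
    (h : ∀ s, claimants b β (J s) = σ '' (D s : Set (Fin 3)))
    (hr : ∀ q, (∀ s, q ≠ J s) → ∃! i, i ∈ claimants b β q) : IsContestedList b β J σ D where
  inj s t e := hD (Finset.coe_injective (σ.injective.image_injective (by rw [← h, ← h, e])))
  mem_iff s l := by rw [h, σ.injective.mem_set_image, Finset.mem_coe]
  rest := hr

theorem eq_image_univ {s : Set (Fin 3)} (h : s = Set.univ) (σ : Equiv.Perm (Fin 3)) :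
    s = σ '' ((Finset.univ : Finset (Fin 3)) : Set (Fin 3)) := by
  rw [h, Finset.coe_univ, Set.image_univ, σ.surjective.range_eq]

theorem eq_image_compl {s : Set (Fin 3)} {h r : Fin 3} {σ : Equiv.Perm (Fin 3)} (e : s = {h}ᶜ)
    (hr : σ r = h) : s = σ '' (({r}ᶜ : Finset (Fin 3)) : Set (Fin 3)) := by
  rw [e, Finset.coe_compl, Set.image_compl_eq σ.bijective, Finset.coe_singleton,
    Set.image_singleton, hr]

theorem describes_f1 (hb : ∀ i j, 0 < b i j) (hβ : β ∈ openRNS) {j : Fin n}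
    (h : (Configuration.f1 j).OccursFor (claimants b β)) :
    (Configuration.f1 j).Describes b β (faceAt b β) := by
  obtain ⟨hj, hr⟩ := h
  have hl : IsContestedList b β ![j] (Equiv.refl _) ![Finset.univ] :=
    isContestedList_of_injective (by decide) (by intro s; fin_cases s; exact eq_image_univ hj _)
      fun q hq => hr q (hq 0)
  obtain ⟨o, W, hc⟩ := hl.exists_chart hb hβ
  have hp : PolygonPattern ![Finset.univ] ![![0], ![1], ![2]]
      ![(false, 2), (false, 0), (false, 1)] := by
    constructor <;> decide
  refine ⟨hj, hl.othersAssigned fun s => ?_, ?_, _, hc.isPolygon hb hβ hp,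
    hc.verticesFromPAR hβ hp⟩
  · fin_cases s; rfl
  · rw [hl.ncard_integerPAR]; decide

theorem describes_f2 (hb : ∀ i j, 0 < b i j) (hβ : β ∈ openRNS) {j k : Fin n}
    (h : (Configuration.f2 j k).OccursFor (claimants b β)) :
    (Configuration.f2 j k).Describes b β (faceAt b β) := by
  obtain ⟨⟨h₁, h₂, hne, hj, hk⟩, hr⟩ := h
  obtain ⟨σ, e1, e2⟩ := exists_perm_two h₁ h₂ hne
  have hl : IsContestedList b β ![j, k] σ ![{2}ᶜ, {1}ᶜ] :=
    isContestedList_of_injective (by decide)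
      (by intro s; fin_cases s; exacts [eq_image_compl hj e1, eq_image_compl hk e2])
      fun q hq => hr q (hq 0) (hq 1)
  obtain ⟨o, W, hc⟩ := hl.exists_chart hb hβ
  -- Label `0` is the player in both disputes. Each row of `vert` lists who gets `j` and `k`; these
  -- are the greedy assignments in cyclic order.
  set vert : Fin 4 → Fin 2 → Fin 3 := ![![0, 0], ![1, 0], ![1, 2], ![0, 2]] with hvert
  have hp : PolygonPattern ![{2}ᶜ, {1}ᶜ] vert
      ![(false, 2), (true, 1), (true, 2), (false, 1)] := by
    constructor <;> decide
  have w0 := (hc.weight_pos 0).ne'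
  have w1 := (hc.weight_pos 1).ne'
  have s0 : load W (vert (0 + 1)) - load W (vert 0) = W 0 • ![-1, 1, 0] := by
    ext l; fin_cases l <;> simp [load, hvert, Fin.sum_univ_two]
  have s1 : load W (vert (1 + 1)) - load W (vert 1) = W 1 • ![-1, 0, 1] := by
    ext l; fin_cases l <;> simp [load, hvert, Fin.sum_univ_two]
  have s2 : load W (vert (2 + 1)) - load W (vert 2) = (-W 0) • ![-1, 1, 0] := by
    ext l; fin_cases l <;> simp [load, hvert, Fin.sum_univ_two]
  have s3 : load W (vert (3 + 1)) - load W (vert 3) = (-W 1) • ![-1, 0, 1] := by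
    ext l; fin_cases l <;> simp [load, hvert, Fin.sum_univ_two]
  refine ⟨(hl.ncard_claimants 0).trans (by decide), (hl.ncard_claimants 1).trans (by decide),
    (hl.ncard_inter 0 1).trans (by decide), hl.othersAssigned fun s => ?_, ?_, _,
    hc.isPolygon hb hβ hp, hc.verticesFromPAR hβ hp,
    sidesParallel_chart (y := fun i => load W (vert i)) w0 (neg_ne_zero.2 w0) s0 s2,
    sidesParallel_chart (y := fun i => load W (vert i)) w1 (neg_ne_zero.2 w1) s1 s3, ?_, ?_⟩
  · fin_cases s <;> simp
  · rw [hl.ncard_integerPAR]; decide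
  · rw [sideLength_chart (y := fun i => load W (vert i)) s0,
      sideLength_chart (y := fun i => load W (vert i)) s2, abs_neg]
  · rw [sideLength_chart (y := fun i => load W (vert i)) s1,
      sideLength_chart (y := fun i => load W (vert i)) s3, abs_neg]

theorem describes_f3 (hb : ∀ i j, 0 < b i j) (hβ : β ∈ openRNS) {j k l : Fin n}
    (h : (Configuration.f3 j k l).OccursFor (claimants b β)) :
    (Configuration.f3 j k l).Describes b β (faceAt b β) := by
  obtain ⟨⟨h₁, h₂, h₃, h12, h13, h23, hj, hk, hl⟩, hr⟩ := h
  obtain ⟨σ, e1, e2, e3⟩ := exists_perm_three h₁ h₂ h₃ h12 h13 h23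
  have hL : IsContestedList b β ![j, k, l] σ ![{2}ᶜ, {0}ᶜ, {1}ᶜ] :=
    isContestedList_of_injective (by decide)
      (by
        intro s; fin_cases s
        exacts [eq_image_compl hj e1, eq_image_compl hk e2, eq_image_compl hl e3])
      fun q hq => hr q (hq 0) (hq 1) (hq 2)
  obtain ⟨o, W, hc⟩ := hL.exists_chart hb hβ
  set vert : Fin 6 → Fin 3 → Fin 3 :=
    ![![0, 1, 0], ![1, 1, 0], ![1, 1, 2], ![1, 2, 2], ![0, 2, 2], ![0, 2, 0]] with hvert
  have hp : PolygonPattern ![{2}ᶜ, {0}ᶜ, {1}ᶜ] vert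
      ![(false, 2), (true, 1), (false, 0), (true, 2), (false, 1), (true, 0)] := by
    constructor <;> decide
  -- Signed multiples of the directions `d`; opposite sides have opposite signs and equal size.
  let r : Fin 6 → ℝ := ![W 0, W 2, W 1, -W 0, -W 2, -W 1]
  let d : Fin 6 → Fin 3 → ℝ :=
    ![![-1, 1, 0], ![-1, 0, 1], ![0, -1, 1], ![-1, 1, 0], ![-1, 0, 1], ![0, -1, 1]]
  have hs : ∀ i, load W (vert (i + 1)) - load W (vert i) = r i • d i := by
    intro i
    ext x
    fin_cases i <;> fin_cases x <;> simp [load, hvert, Fin.sum_univ_three, r, d]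
  have hd : ∀ i, d (i + 3) = d i := by intro i; fin_cases i <;> rfl
  have hr0 : ∀ i, r i ≠ 0 := by
    intro i
    fin_cases i <;> simp [r, (hc.weight_pos _).ne']
  have hs' : ∀ i, load W (vert (i + 3 + 1)) - load W (vert (i + 3)) = r (i + 3) • d i := by
    intro i
    rw [hs, hd]
  refine ⟨(hL.ncard_claimants 0).trans (by decide), (hL.ncard_claimants 1).trans (by decide),
    (hL.ncard_claimants 2).trans (by decide), fun i => ?_, hL.othersAssigned fun s => ?_, ?_, _,
    hc.isPolygon hb hβ hp, hc.verticesFromPAR hβ hp,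
    ⟨chart β o σ ((1 / 2 : ℝ) • (load W (vert 0) + load W (vert 3))), fun i => ?_⟩, fun i =>
    ⟨sidesParallel_chart (y := fun i => load W (vert i)) (hr0 i) (hr0 _) (hs i) (hs' i), ?_⟩, ?_⟩
  · rw [hL.ncard_disputes Finset.univ (by simp [Fin.exists_fin_succ])]
    generalize σ.symm i = x
    revert x
    decide
  · fin_cases s <;> simp
  · rw [hL.ncard_integerPAR]; decide
  · rw [midpoint_chart]
    congr 2
    ext x
    fin_cases i <;> fin_cases x <;> simp [load, hvert, Fin.sum_univ_three] <;> ring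
  · rw [sideLength_chart (y := fun i => load W (vert i)) (hs i),
      sideLength_chart (y := fun i => load W (vert i)) (hs' i)]
    congr 1
    fin_cases i <;> simp [r]
  · rw [hc.ncard_insideFace hb hβ (by decide) (by decide)]; decide

theorem describes_f4 (hb : ∀ i j, 0 < b i j) (hβ : β ∈ openRNS) {j k : Fin n}
    (h : (Configuration.f4 j k).OccursFor (claimants b β)) :
    (Configuration.f4 j k).Describes b β (faceAt b β) := by
  obtain ⟨hj, ⟨h₁, hk⟩, hr⟩ := h
  obtain ⟨σ, e1⟩ : ∃ σ : Equiv.Perm (Fin 3), σ 2 = h₁ := ⟨Equiv.swap 2 h₁, by simp⟩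
  have hL : IsContestedList b β ![j, k] σ ![Finset.univ, {2}ᶜ] :=
    isContestedList_of_injective (by decide)
      (by intro s; fin_cases s; exacts [eq_image_univ hj _, eq_image_compl hk e1])
      fun q hq => hr q (hq 0) (hq 1)
  obtain ⟨o, W, hc⟩ := hL.exists_chart hb hβ
  set vert : Fin 4 → Fin 2 → Fin 3 := ![![0, 0], ![1, 1], ![2, 1], ![2, 0]] with hvert
  have hp : PolygonPattern ![Finset.univ, {2}ᶜ] vert
      ![(false, 2), (false, 0), (true, 2), (false, 1)] := by
    constructor <;> decide
  have w0 := hc.weight_pos 0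
  have w1 := hc.weight_pos 1
  have s0 : load W (vert (0 + 1)) - load W (vert 0) = (W 0 + W 1) • ![-1, 1, 0] := by
    ext l; fin_cases l <;> simp [load, hvert, Fin.sum_univ_two]
  have s2 : load W (vert (2 + 1)) - load W (vert 2) = (-W 1) • ![-1, 1, 0] := by
    ext l; fin_cases l <;> simp [load, hvert, Fin.sum_univ_two]
  have hN : 0 < ‖chart β 0 σ ![-1, 1, 0]‖ :=
    norm_pos_iff.2 (chart_zero_ne_zero hβ fun e => by simpa using congrFun e 1)
  refine ⟨hj, (hL.ncard_claimants 1).trans (by decide), hL.othersAssigned fun s => ?_, ?_, _,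
    hc.isPolygon hb hβ hp, hc.verticesFromPAR hβ hp,
    sidesParallel_chart (y := fun i => load W (vert i)) (add_pos w0 w1).ne'
      (neg_ne_zero.2 w1.ne') s0 s2,
    not_sidesParallel_chart (y := fun i => load W (vert i)) hβ (l := 0) ?_ ?_, ?_, ?_⟩
  · fin_cases s <;> simp
  · rw [hL.ncard_integerPAR]; decide
  · simp [load, hvert, Fin.sum_univ_two]
  · simp [load, hvert, Fin.sum_univ_two, w0.ne']
  · rw [sideLength_chart (y := fun i => load W (vert i)) s0,
      sideLength_chart (y := fun i => load W (vert i)) s2, abs_neg, abs_of_pos w1,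
      abs_of_pos (add_pos w0 w1)]
    exact mul_lt_mul_of_pos_right (by linarith) hN
  · rw [hc.ncard_extraOnSide hβ hp 0 2 1 0 (by decide) (by decide) (by decide) (by decide)
      (by decide) (by decide)]
    decide

theorem describes_f5 (hb : ∀ i j, 0 < b i j) (hβ : β ∈ openRNS) {j k t : Fin n}
    (h : (Configuration.f5 j k t).OccursFor (claimants b β)) :
    (Configuration.f5 j k t).Describes b β (faceAt b β) := by
  obtain ⟨⟨h₁, h₂, hne, hj, hk⟩, ht, hr⟩ := h
  obtain ⟨σ, e1, e2⟩ := exists_perm_two h₁ h₂ hne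
  have hL : IsContestedList b β ![j, k, t] σ ![{2}ᶜ, {1}ᶜ, Finset.univ] :=
    isContestedList_of_injective (by decide)
      (by
        intro s; fin_cases s
        exacts [eq_image_compl hj e1, eq_image_compl hk e2, eq_image_univ ht _])
      fun q hq => hr q (hq 0) (hq 1) (hq 2)
  obtain ⟨o, W, hc⟩ := hL.exists_chart hb hβ
  -- The item at `β` lengthens the sides starting at vertices `0` and `1`, where label `2`
  -- respectively label `1` gets nothing.
  set vert : Fin 5 → Fin 3 → Fin 3 :=
    ![![1, 0, 1], ![0, 0, 0], ![0, 2, 2], ![1, 2, 2], ![1, 2, 1]] with hvert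
  have hp : PolygonPattern ![{2}ᶜ, {1}ᶜ, Finset.univ] vert
      ![(false, 2), (false, 1), (true, 2), (false, 0), (true, 1)] := by
    constructor <;> decide
  have w0 := hc.weight_pos 0
  have w1 := hc.weight_pos 1
  have w2 := hc.weight_pos 2
  have s0 : load W (vert (0 + 1)) - load W (vert 0) = (W 0 + W 2) • ![1, -1, 0] := by
    ext l; fin_cases l <;> simp [load, hvert, Fin.sum_univ_three] <;> ring
  have s1 : load W (vert (1 + 1)) - load W (vert 1) = (W 1 + W 2) • ![-1, 0, 1] := by
    ext l; fin_cases l <;> simp [load, hvert, Fin.sum_univ_three] <;> ring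
  have s2 : load W (vert (2 + 1)) - load W (vert 2) = (-W 0) • ![1, -1, 0] := by
    ext l; fin_cases l <;> simp [load, hvert, Fin.sum_univ_three]
  have s4 : load W (vert (4 + 1)) - load W (vert 4) = (-W 1) • ![-1, 0, 1] := by
    ext l; fin_cases l <;> simp [load, hvert, Fin.sum_univ_three]
  have hN : 0 < ‖chart β 0 σ ![1, -1, 0]‖ :=
    norm_pos_iff.2 (chart_zero_ne_zero hβ fun e => by simpa using congrFun e 0)
  have hN' : 0 < ‖chart β 0 σ ![-1, 0, 1]‖ :=
    norm_pos_iff.2 (chart_zero_ne_zero hβ fun e => by simpa using congrFun e 2)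
  refine ⟨(hL.ncard_claimants 0).trans (by decide), (hL.ncard_claimants 1).trans (by decide),
    (hL.ncard_inter 0 1).trans (by decide), ht, hL.othersAssigned fun s => ?_, ?_, _,
    hc.isPolygon hb hβ hp, hc.verticesFromPAR hβ hp,
    sidesParallel_chart (y := fun i => load W (vert i)) (add_pos w0 w2).ne'
      (neg_ne_zero.2 w0.ne') s0 s2, ?_,
    sidesParallel_chart (y := fun i => load W (vert i)) (add_pos w1 w2).ne'
      (neg_ne_zero.2 w1.ne') s1 s4, ?_, ?_, ?_, ?_⟩
  · fin_cases s <;> simp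
  · rw [hL.ncard_integerPAR]; decide
  · rw [sideLength_chart (y := fun i => load W (vert i)) s0,
      sideLength_chart (y := fun i => load W (vert i)) s2, abs_neg, abs_of_pos w0,
      abs_of_pos (add_pos w0 w2)]
    exact mul_lt_mul_of_pos_right (by linarith) hN
  · rw [sideLength_chart (y := fun i => load W (vert i)) s1,
      sideLength_chart (y := fun i => load W (vert i)) s4, abs_neg, abs_of_pos w1,
      abs_of_pos (add_pos w1 w2)]
    exact mul_lt_mul_of_pos_right (by linarith) hN'
  · rw [hc.ncard_extraOnSide hβ hp 0 2 0 1 (by decide) (by decide) (by decide) (by decide)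
      (by decide) (by decide)]
    decide
  · rw [hc.ncard_extraOnSide hβ hp 1 1 2 0 (by decide) (by decide) (by decide) (by decide)
      (by decide) (by decide)]
    decide
  · rw [hc.ncard_insideFace hb hβ (by decide) (by decide)]; decide

theorem describes_f6 (hb : ∀ i j, 0 < b i j) (hβ : β ∈ openRNS) {j k l t : Fin n}
    (h : (Configuration.f6 j k l t).OccursFor (claimants b β)) :
    (Configuration.f6 j k l t).Describes b β (faceAt b β) := by
  obtain ⟨⟨h₁, h₂, h₃, h12, h13, h23, hj, hk, hl⟩, ht, hr⟩ := h
  obtain ⟨σ, e1, e2, e3⟩ := exists_perm_three h₁ h₂ h₃ h12 h13 h23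
  have hL : IsContestedList b β ![j, k, l, t] σ ![{2}ᶜ, {0}ᶜ, {1}ᶜ, Finset.univ] :=
    isContestedList_of_injective (by decide)
      (by
        intro s; fin_cases s
        exacts [eq_image_compl hj e1, eq_image_compl hk e2, eq_image_compl hl e3,
          eq_image_univ ht _])
      fun q hq => hr q (hq 0) (hq 1) (hq 2) (hq 3)
  obtain ⟨o, W, hc⟩ := hL.exists_chart hb hβ
  set vert : Fin 6 → Fin 4 → Fin 3 :=
    ![![0, 1, 0, 0], ![1, 1, 0, 1], ![1, 1, 2, 1], ![1, 2, 2, 2], ![0, 2, 2, 2],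
      ![0, 2, 0, 0]] with hvert
  have hp : PolygonPattern ![{2}ᶜ, {0}ᶜ, {1}ᶜ, Finset.univ] vert
      ![(false, 2), (true, 1), (false, 0), (true, 2), (false, 1), (true, 0)] := by
    constructor <;> decide
  have w0 := hc.weight_pos 0
  have w1 := hc.weight_pos 1
  have w2 := hc.weight_pos 2
  have w3 := hc.weight_pos 3
  -- As without an item at `β`, except that its weight `W 3` is added to every second side, namely
  -- where some label gets nothing.
  let r : Fin 6 → ℝ := ![W 0 + W 3, W 2, W 1 + W 3, -W 0, -(W 2 + W 3), -W 1]
  let d : Fin 6 → Fin 3 → ℝ :=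
    ![![-1, 1, 0], ![-1, 0, 1], ![0, -1, 1], ![-1, 1, 0], ![-1, 0, 1], ![0, -1, 1]]
  have hs : ∀ i, load W (vert (i + 1)) - load W (vert i) = r i • d i := by
    intro i
    ext x
    fin_cases i <;> fin_cases x <;> simp [load, hvert, Fin.sum_univ_four, r, d] <;> ring
  have hd : ∀ i, d (i + 3) = d i := by intro i; fin_cases i <;> rfl
  have habs : ∀ i, |r i| = ![W 0 + W 3, W 2, W 1 + W 3, W 0, W 2 + W 3, W 1] i := by
    intro i
    fin_cases i <;> simp only [r, Fin.zero_eta, Fin.mk_one, Fin.reduceFinMk, Matrix.cons_val_zero,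
      Matrix.cons_val_one, Matrix.cons_val, abs_neg] <;> exact abs_of_pos (by linarith)
  have hr0 : ∀ i, r i ≠ 0 := by
    intro i
    rw [← abs_pos, habs]
    fin_cases i <;> (simp; linarith)
  have hs' : ∀ i, load W (vert (i + 3 + 1)) - load W (vert (i + 3)) = r (i + 3) • d i := by
    intro i
    rw [hs, hd]
  have hN : ∀ i, 0 < ‖chart β 0 σ (d i)‖ := by
    intro i
    refine norm_pos_iff.2 (chart_zero_ne_zero hβ fun e => ?_)
    have e0 := congrFun e 0
    have e1 := congrFun e 1
    fin_cases i <;> simp [d] at e0 e1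
  refine ⟨(hL.ncard_claimants 0).trans (by decide), (hL.ncard_claimants 1).trans (by decide),
    (hL.ncard_claimants 2).trans (by decide), fun i => ?_, ht, hL.othersAssigned fun s => ?_, ?_,
    _, hc.isPolygon hb hβ hp, hc.verticesFromPAR hβ hp, fun i =>
    ⟨sidesParallel_chart (y := fun i => load W (vert i)) (hr0 i) (hr0 _) (hs i) (hs' i), ?_, ?_⟩,
    ?_⟩
  · rw [hL.ncard_disputes {0, 1, 2} (by simp)]
    generalize σ.symm i = x
    revert x
    decide
  · fin_cases s <;> simp
  · rw [hL.ncard_integerPAR]; decide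
  · rw [sideLength_chart (y := fun i => load W (vert i)) (hs i),
      sideLength_chart (y := fun i => load W (vert i)) (hs' i), Ne,
      mul_left_inj' (hN i).ne', habs, habs]
    fin_cases i <;> (simp; linarith)
  · rw [sideLength_chart (y := fun i => load W (vert i)) (hs i),
      sideLength_chart (y := fun i => load W (vert i)) (hs' i),
      mul_lt_mul_iff_left₀ (hN i), habs, habs]
    intro hlt
    -- Only the even sides are the longer ones of their pairs; for odd `i` the hypothesis `hlt` is
    -- contradictory.
    fin_cases i
    · exact (hc.ncard_extraOnSide hβ hp 0 2 1 0 (by decide) (by decide) (by decide) (by decide)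
        (by decide) (by decide)).trans (by decide)
    · exfalso; simp at hlt; linarith
    · exact (hc.ncard_extraOnSide hβ hp 2 0 2 1 (by decide) (by decide) (by decide) (by decide)
        (by decide) (by decide)).trans (by decide)
    · exfalso; simp at hlt; linarith
    · exact (hc.ncard_extraOnSide hβ hp 4 1 0 2 (by decide) (by decide) (by decide) (by decide)
        (by decide) (by decide)).trans (by decide)
    · exfalso; simp at hlt; linarith
  · rw [hc.ncard_insideFace hb hβ (by decide) (by decide)]; decide

theorem Configuration.OccursFor.describes (hb : ∀ i j, 0 < b i j) (hβ : β ∈ openRNS)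
    {q : Configuration n} (h : q.OccursFor (claimants b β)) :
    q.Describes b β (faceAt b β) := by
  cases q with
  | f1 j => exact describes_f1 hb hβ h
  | f2 j k => exact describes_f2 hb hβ h
  | f3 j k l => exact describes_f3 hb hβ h
  | f4 j k => exact describes_f4 hb hβ h
  | f5 j k t => exact describes_f5 hb hβ h
  | f6 j k l t => exact describes_f6 hb hβ h

theorem Configuration.Describes.finrank_eq {q : Configuration n} {F : Set E3}
    (h : q.Describes b β F) : Module.finrank ℝ (vectorSpan ℝ F) = 2 := by
  cases q with
  | f1 j => obtain ⟨-, -, -, v, hv, -⟩ := h; exact hv.planar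
  | f2 j k => obtain ⟨-, -, -, -, -, v, hv, -⟩ := h; exact hv.planar
  | f3 j k l => obtain ⟨-, -, -, -, -, -, v, hv, -⟩ := h; exact hv.planar
  | f4 j k => obtain ⟨-, -, -, -, v, hv, -⟩ := h; exact hv.planar
  | f5 j k t => obtain ⟨-, -, -, -, -, -, v, hv, -⟩ := h; exact hv.planar
  | f6 j k l t => obtain ⟨-, -, -, -, -, -, -, v, hv, -⟩ := h; exact hv.planar

end

end FairDivision

end

/-! ### The classification -/

theorem mainTheorem1 {m : ℕ} (a : FairDivision.Evaluation m)
    (hnorm : ∀ i, ∑ j, a i j = 1) (hMAC : ∀ i j, 0 < a i j) :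
    -- every face of the Pareto boundary corresponds to exactly one point of the open simplex,
    -- and this point is of exactly one of the six types
    (∀ F : Set FairDivision.E3, FairDivision.IsParetoFace a F →
      ∃ β ∈ FairDivision.openRNS, F = FairDivision.faceAt a β ∧
        (∀ β' ∈ FairDivision.openRNS, F = FairDivision.faceAt a β' → β' = β) ∧
        ∃! t : FairDivision.FaceType, FairDivision.HasType a β t) ∧
    -- every point of the open simplex at which a configuration occurs, after the replacement of
    -- several items by one, corresponds to a face of the Pareto boundary, which is described by
    -- the configuration
    (∀ β ∈ FairDivision.openRNS, ∀ (n : ℕ) (f : Fin m → Fin n),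
      FairDivision.IsMerging a β f →
      ∀ c : FairDivision.Configuration n, c.Occurs (FairDivision.merge a f) β →
        FairDivision.IsParetoFace a (FairDivision.faceAt a β) ∧
        FairDivision.faceAt (FairDivision.merge a f) β = FairDivision.faceAt a β ∧
        c.Describes (FairDivision.merge a f) β (FairDivision.faceAt a β)) := by
  refine ⟨fun F hF => ?_, fun β hβ n f hf c hc => ?_⟩
  · obtain ⟨β, hβ, rfl⟩ := FairDivision.exists_faceAt_of_isParetoFace hMAC hF
    obtain ⟨t, ht⟩ := FairDivision.exists_hasType hMAC hβ hF.2.2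
    exact ⟨β, hβ, rfl, fun β' hβ' h => FairDivision.faceAt_injective hβ hβ' h hF.2.2,
      t, ht, fun s hs => hs.unique hMAC hβ ht⟩
  · have hb := FairDivision.merge_pos hMAC hf.1
    have hface := FairDivision.faceAt_merge hMAC hβ hf.1 fun j k => hf.claimants_eq hMAC hβ
    have hd := ((FairDivision.occurs_iff hb hβ c).1 hc).describes hb hβ
    rw [hface] at hd
    exact ⟨⟨FairDivision.isExposed_faceAt a β, FairDivision.faceAt_subset_paretoBoundary hβ,
      hd.finrank_eq⟩, hface, hd⟩
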